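/- **Setting.** Let $m\ge 1$, let $p_1,\dots,p_m$ be probability vectors in $\mathbb R^N$, $C_1,\dots,C_m\in\mathbb R^{N\times N}$ cost matrices, and $w_1,\dots,w_m>0$ weights with $\sum_l w_l=1$. Let $\|C_l\|_\infty$ be the largest absolute value of an entry, $\Pi(p,q)$ the set of nonnegative matrices with row sums $p$ and column sums $q$, $W_C(p,q)=\min_{\pi\in\Pi(p,q)}\langle C,\pi\rangle$, and $J(q)=\sum_l w_lW_{C_l}(p_l,q)$ the barycenter objective on the probability simplex. For $\gamma>0$ put $$f(\pi)=\sum_{l} w_l\bigl(\langle C_l,\pi_l\rangle+\gamma\langle \pi_l,\ln \pi_l-1\rangle\bigr),\qquad [B_l(u,v)]_{ij}=\exp\bigl([u_l]_i+[v_l]_j-[C_l]_{ij}/\gamma\bigr),$$ $$\varphi(u,v)=\gamma\sum_{l} w_l\bigl\{\ln(\mathbf 1^TB_l\mathbf 1)-\langle u_l,p_l\rangle\bigr\}+\gamma ,\qquad V=\Bigl\{(u,v):u_l,v_l\in\mathbb R^N,\ \sum_l w_lv_l=0\Bigr\},\qquad x_l(u,v)=\frac{B_l(u,v)}{\mathbf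 1^TB_l(u,v)\mathbf 1}.$$ The regularized barycenter problem is to minimize $f$ over $\pi$ with $\pi_l\in\Pi(p_l,q)$ for all $l$ and a common probability vector $q$; its dual is to minimize $\varphi$ over $V$. Equip $V$ with an inner product $\langle (u,v),(u',v')\rangle_s=\sum_l s_l(\langle u_l,u_l'\rangle+\langle v_l,v_l'\rangle)$, where $s_l>0$ ($s\equiv1$ is the Euclidean one); $\nabla\varphi$ is the gradient on $V$ for it, and $\|\cdot\|_s$ is its norm. Put $L_\varphi=2\gamma\max_l (w_l/s_l)$ and $\kappa=\max_l(w_l/s_l)\sum_l s_l$; so $\kappa=1$ for $s=w$ with any weights, and for $s\equiv 1$ with $w_l=1/m$. **Accelerated Iterative Bregman Projections.** Given $L_0>0$, start from $a_0=0$, $\eta^0=\zeta^0=0$. In iteration $k\ge 0$, for $L_{k+1}=L_k/2,\,L_k,\,2L_k,\dots$ in turn, compute $a_{k+1}=\frac1{2L_{k+1}}+\sqrt{\frac1{4L_{k+1}^2}+a_k^2\frac{L_k}{L_{k+1}}}$, $\tau_k=\frac1{a_{k+1}L_{k+1}}$, $\lambda^k=\tau_k\zeta^k+(1-\tau_k)\eta^k$;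 choose the block ($u$ or $v$) whose part of $\nabla\varphi(\lambda^k)$ has the larger norm; let $\eta^{k+1}$ be $\lambda^k=(u,v)$ with that block replaced by, respectively, $u_l+\ln p_l-\ln(B_l\mathbf 1)$ or $v_l+\sum_j w_j\ln(B_j^T\mathbf 1)-\ln (B_l^T\mathbf 1)$, where $B_l=B_l(\lambda^k)$; let $\zeta^{k+1}=\zeta^k-a_{k+1}\nabla\varphi(\lambda^k)$; until $\varphi(\eta^{k+1})\le\varphi(\lambda^k)-\frac{\|\nabla\varphi(\lambda^k)\|_s^2}{2L_{k+1}}$. Then set $\hat x^{k+1}=\frac{a_{k+1}x(\lambda^k)+L_ka_k^2\hat x^k}{L_{k+1}a_{k+1}^2}$. **Claim.** 1. (Two blocks.) Suppose $p_l>0$ entrywise. The two updates are exact minimizations: for every $(u,v)\in V$ the first minimizes $\varphi$ over all points of $V$ with the same $v$, and the second over all points of $V$ with the same $u$ (and stays in $V$). Moreover $\nabla\varphi(u,v)$ has the components $\gamma\frac{w_l}{s_l}(x_l\mathbf 1-p_l)$ and $\gamma\frac{w_l}{s_l}(x_l^T\mathbf 1-h)$, where $x_l=x_l(u,v)$ and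 $h=\bigl(\sum_l\frac{w_l^2}{s_l}x_l^T\mathbf 1\bigr)/\sum_l\frac{w_l^2}{s_l}$. 2. (Primal-dual guarantees.) Suppose $p_l>0$ entrywise. The dual problem has a solution and every inner loop terminates. If $L\ge L_\varphi$, $0<L_0\le 8L$, and some dual solution has norm $\|\cdot\|_s$ at most $R$, then for all $k\ge1$ $$\|r(\hat x^k)\|_s\le\frac{32LR}{k^2},\qquad |\varphi(\eta^k)+f(\hat x^k)|\le\frac{32LR^2}{k^2},\qquad \Bigl(\sum_l w_l\|\hat x^k_l-\pi^*_l\|_1^2\Bigr)^{1/2}\le 8\sqrt{\frac{2L}{\gamma}}\,\frac{R}{k}$$ for every solution $\pi^*$ of the regularized problem. Here $r(\pi)$ is the residual of the linear constraints, given by the formula for $\nabla\varphi$ in part 1 with $\pi_l$ in place of $x_l$. 3. (Complexity.) Consider the following procedure for $N\ge2$ and $0<\varepsilon\le\max_l\|C_l\|_\infty$ (here $p_l$ may have zero entries). Put $\gamma=\frac{\varepsilon}{4\ln N}$ and $\varepsilon'=\frac{\varepsilon}{8\max_l\|C_l\|_\infty}$, and run the method with this $\gamma$ on the histograms $\tilde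 p_l=(1-\frac{\varepsilon'}8)\bigl(p_l+\frac{\varepsilon'}{N(8-\varepsilon')}\mathbf 1\bigr)$. After each iteration $k$ put $q=\sum_l w_l(\hat x_l^k)^T\mathbf 1$, round $\hat x^k_l$ to $\hat\pi_l\in\Pi(p_l,q)$ by the rounding algorithm of Altschuler, Weed and Rigollet, and stop with the output $(q,\hat\pi)$ as soon as $\sum_l w_l\langle C_l,\hat\pi_l-\hat x_l^k\rangle\le\frac\varepsilon6$ and $f(\hat x^k)+\varphi(\eta^k)\le\frac\varepsilon6$. Then for every $L_0>0$ the procedure terminates with a probability vector $q$ and plans $\hat\pi_l\in\Pi(p_l,q)$ such that $$J(q)\le\sum_l w_l\langle C_l,\hat\pi_l\rangle\le\min_{q'}J(q')+\varepsilon ,$$ and the number of its elementary operations (arithmetic, $\exp$, $\ln$, square root, minimum, comparison of real numbers) is at most $$K\sqrt{\kappa}\;\frac{mN^{5/2}\sqrt{\ln N}\,\max_l\|C_l\|_\infty}{\varepsilon}+K\,mN^2\,\Bigl|\log_2\frac{L_0}{L_\varphi}\Bigr|$$ with a universal constant $K$. In particular, if $L_0$ is within a constant factor of $L_\varphi$ and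 $\kappa=1$, the complexity is $O\bigl(mN^{5/2}\sqrt{\ln N}\max_l\|C_l\|_\infty/\varepsilon\bigr)$. -/

import Mathlib

/-! ### Real-number programs with a count of arithmetic operations -/

namespace WBary

/-- The result of a computation together with the number of elementary operations on real numbers
(`+`, `-`, `*`, `/`, `exp`, `log`, `sqrt`, `min`, comparison) that it has performed. -/
structure Counted (α : Type) where
  val : α
  ops : ℕ

noncomputable section

namespace Counted

instance : Monad Counted where
  pure a := ⟨a, 0⟩
  bind x f := ⟨(f x.val).val, x.ops + (f x.val).ops⟩

/-- Reading a real number that is already known; free of charge. -/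
def rd (x : ℝ) : Counted ℝ := ⟨x, 0⟩

instance : Add (Counted ℝ) := ⟨fun x y => ⟨x.val + y.val, x.ops + y.ops + 1⟩⟩
instance : Sub (Counted ℝ) := ⟨fun x y => ⟨x.val - y.val, x.ops + y.ops + 1⟩⟩
instance : Mul (Counted ℝ) := ⟨fun x y => ⟨x.val * y.val, x.ops + y.ops + 1⟩⟩
instance : Div (Counted ℝ) := ⟨fun x y => ⟨x.val / y.val, x.ops + y.ops + 1⟩⟩

def exp (x : Counted ℝ) : Counted ℝ := ⟨Real.exp x.val, x.ops + 1⟩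
def log (x : Counted ℝ) : Counted ℝ := ⟨Real.log x.val, x.ops + 1⟩
def sqrt (x : Counted ℝ) : Counted ℝ := ⟨Real.sqrt x.val, x.ops + 1⟩
def min (x y : Counted ℝ) : Counted ℝ := ⟨Min.min x.val y.val, x.ops + y.ops + 1⟩

/-- Comparison of two real numbers. -/
def le (x y : ℝ) : Counted Bool := ⟨decide (x ≤ y), 1⟩

/-- `for i = 1, …, n` compute the entry `f i` of an array. -/
def tab {n : ℕ} {α : Type} (f : Fin n → Counted α) : Counted (Fin n → α) :=
  ⟨fun i => (f i).val, ∑ i, (f i).ops⟩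

/-- Compute `n` numbers and add them up. -/
def sum {n : ℕ} (f : Fin n → Counted ℝ) : Counted ℝ :=
  ⟨∑ i, (f i).val, (∑ i, (f i).ops) + n⟩

/-- Compute `n` numbers and the largest of their absolute values (the sup norm of the array). -/
def maxAbs {n : ℕ} (f : Fin n → Counted ℝ) : Counted ℝ :=
  ⟨‖fun i => (f i).val‖, (∑ i, (f i).ops) + 2 * n⟩

end Counted

/-- `LoopsTo body x o n`: the loop that starts at `x` and repeats `body` (going on with `y` when
the result is `Sum.inl y`, leaving the loop with `o` when it is `Sum.inr o`) terminates with
result `o` after `n` elementary operations in total. -/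
inductive LoopsTo {σ ο : Type} (body : σ → Counted (σ ⊕ ο)) : σ → ο → ℕ → Prop
  | done {x : σ} {o : ο} {n : ℕ} : body x = ⟨Sum.inr o, n⟩ → LoopsTo body x o n
  | next {x y : σ} {o : ο} {n k : ℕ} :
      body x = ⟨Sum.inl y, n⟩ → LoopsTo body y o k → LoopsTo body x o (n + k)

/-! ### Wasserstein barycenters -/

/-- `m` families of `N` numbers. -/
abbrev Blocks (m N : ℕ) : Type := Fin m → Fin N → ℝ

/-- `m` matrices of size `N × N`. The norm of this space is the largest absolute value of an
entry, that is, `max_l ‖C_l‖_∞` for `C : Plans m N`. -/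
abbrev Plans (m N : ℕ) : Type := Fin m → Fin N → Fin N → ℝ

/-- A dual point `(u, v)`, made of the two blocks `u = (u_1, …, u_m)` and `v = (v_1, …, v_m)`. -/
abbrev Dual (m N : ℕ) : Type := Blocks m N × Blocks m N

/-- The weights, the histograms and the cost matrices of a barycenter problem. -/
structure BaryData (m N : ℕ) where
  w : Fin m → ℝ
  p : Blocks m N
  C : Plans m N

/-- The data of an entropy-regularized problem: in addition, the regularization parameter `γ` and
the weights `s` of the inner product of the space of dual points (see `dualInner`). -/
structure RegData (m N : ℕ) extends BaryData m N where
  γ : ℝ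
  s : Fin m → ℝ

variable {m N : ℕ}

/-- Transport plans with marginals `p` (row sums) and `q` (column sums). -/
def couplings (p q : Fin N → ℝ) : Set (Fin N → Fin N → ℝ) :=
  {π | (∀ i j, 0 ≤ π i j) ∧ (∀ i, ∑ j, π i j = p i) ∧ (∀ j, ∑ i, π i j = q j)}

/-- The optimal transportation distance `W_C(p, q)`. -/
def transportCost (C : Fin N → Fin N → ℝ) (p q : Fin N → ℝ) : ℝ :=
  sInf ((fun π : Fin N → Fin N → ℝ => ∑ i, ∑ j, C i j * π i j) '' couplings p q)

/-- The objective `∑ l, w_l W_{C_l}(p_l, q)` of the (non-regularized) barycenter problem. -/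
def baryObjective (D : BaryData m N) (q : Fin N → ℝ) : ℝ :=
  ∑ l, D.w l * transportCost (D.C l) (D.p l) q

/-- The total cost `∑ l, w_l ⟨C_l, π_l⟩` of `m` transport plans. -/
def planCost (D : BaryData m N) (π : Plans m N) : ℝ :=
  ∑ l, D.w l * ∑ i, ∑ j, D.C l i j * π l i j

/-- The feasible set of the barycenter problem in expanded form: `π_l` has marginals `p_l` and
`q`, with the same probability vector `q` for all `l`. -/
def primalFeasible (D : BaryData m N) : Set (Plans m N) :=
  {π | ∃ q ∈ stdSimplex ℝ (Fin N), ∀ l, π l ∈ couplings (D.p l) q}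

/-- The regularized objective `f(π) = ∑ l, w_l (⟨C_l, π_l⟩ + γ ⟨π_l, ln π_l - 1⟩)`. -/
def primal (D : RegData m N) (π : Plans m N) : ℝ :=
  ∑ l, D.w l * ((∑ i, ∑ j, D.C l i j * π l i j) +
    D.γ * ∑ i, ∑ j, π l i j * (Real.log (π l i j) - 1))

/-- The matrices `B_l(u_l, v_l) = diag(e^{u_l}) exp(-C_l / γ) diag(e^{v_l})`. -/
def scaling (D : RegData m N) (x : Dual m N) : Plans m N :=
  fun l i j => Real.exp (x.1 l i + x.2 l j - D.C l i j / D.γ)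

/-- `1ᵀ B_l(u_l, v_l) 1`. -/
def mass (D : RegData m N) (x : Dual m N) (l : Fin m) : ℝ :=
  ∑ i, ∑ j, scaling D x l i j

/-- The primal point `x(u, v)`, with components `B_l(u_l, v_l) / (1ᵀ B_l(u_l, v_l) 1)`. -/
def plan (D : RegData m N) (x : Dual m N) : Plans m N :=
  fun l i j => scaling D x l i j / mass D x l

/-- The dual objective (to be minimized)
`φ(u, v) = γ ∑ l, w_l (ln (1ᵀ B_l(u_l, v_l) 1) - ⟨u_l, p_l⟩) + γ`. -/
def dual (D : RegData m N) (x : Dual m N) : ℝ :=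
  D.γ * (∑ l, D.w l * (Real.log (mass D x l) - ∑ i, x.1 l i * D.p l i)) + D.γ

/-- The space of dual points: `∑ l, w_l v_l = 0`. -/
def dualFeasible (D : BaryData m N) : Set (Dual m N) :=
  {x | ∀ j, ∑ l, D.w l * x.2 l j = 0}

/-- `(u, v)` is a solution of the dual problem. -/
def IsDualSolution (D : RegData m N) (x : Dual m N) : Prop :=
  x ∈ dualFeasible D.toBaryData ∧ IsMinOn (dual D) (dualFeasible D.toBaryData) x

/-- The inner product `∑ l, s_l (⟨u_l, u'_l⟩ + ⟨v_l, v'_l⟩)` of dual points. It is the Euclidean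
one when `s = 1`. -/
def dualInner (s : Fin m → ℝ) (x y : Dual m N) : ℝ :=
  ∑ l, s l * ((∑ i, x.1 l i * y.1 l i) + ∑ j, x.2 l j * y.2 l j)

/-- The norm of `dualInner`. -/
def dualNorm (s : Fin m → ℝ) (x : Dual m N) : ℝ :=
  Real.sqrt (dualInner s x x)

/-- The vector `h` for which the residual below satisfies the constraint `∑ l, w_l v_l = 0`. -/
def commonMarginal (D : RegData m N) (π : Plans m N) : Fin N → ℝ :=
  fun j => (∑ l, D.w l ^ 2 / D.s l * ∑ i, π l i j) / ∑ l, D.w l ^ 2 / D.s l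

/-- The residual of the linear constraints `π_l 1 = p_l` and `π_1ᵀ 1 = … = π_mᵀ 1` at `π`,
as an element of the space of dual points (with the inner product `dualInner`): it represents the
linear form `(u, v) ↦ γ ∑ l, w_l (⟨u_l, π_l 1 - p_l⟩ + ⟨v_l, π_lᵀ 1⟩)` on that space. -/
def constraintResidual (D : RegData m N) (π : Plans m N) : Dual m N :=
  (fun l i => D.γ * (D.w l / D.s l) * ((∑ j, π l i j) - D.p l i),
   fun l j => D.γ * (D.w l / D.s l) * ((∑ i, π l i j) - commonMarginal D π j))

/-- The gradient of `φ` on the space of dual points, for the inner product `dualInner`. -/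
def grad (D : RegData m N) (x : Dual m N) : Dual m N := constraintResidual D (plan D x)

/-- Exact minimization of `φ` over the block `u`. -/
def uStep (D : RegData m N) (x : Dual m N) : Dual m N :=
  (fun l i => x.1 l i + Real.log (D.p l i) - Real.log (∑ j, scaling D x l i j), x.2)

/-- Exact minimization of `φ` over the block `v` (under the constraint `∑ l, w_l v_l = 0`). -/
def vStep (D : RegData m N) (x : Dual m N) : Dual m N :=
  (x.1, fun l j => x.2 l j + (∑ k, D.w k * Real.log (∑ i, scaling D x k i j)) -
    Real.log (∑ i, scaling D x l i j))

/-! ### Programs for the basic quantities -/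

open Counted

/-- Program for `scaling`. -/
def scalingC (D : RegData m N) (x : Dual m N) : Counted (Plans m N) :=
  tab fun l => tab fun i => tab fun j =>
    exp (rd (x.1 l i) + rd (x.2 l j) - rd (D.C l i j) / rd D.γ)

/-- Program for `mass`, from the value of `scaling`. -/
def massC (B : Plans m N) : Counted (Fin m → ℝ) :=
  tab fun l => sum fun i => sum fun j => rd (B l i j)

/-- Program for `plan`. -/
def planC (D : RegData m N) (x : Dual m N) : Counted (Plans m N) := do
  let B ← scalingC D x
  let Z ← massC B
  tab fun l => tab fun i => tab fun j => rd (B l i j) / rd (Z l)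

/-- Program for `dual`. -/
def dualC (D : RegData m N) (x : Dual m N) : Counted ℝ := do
  let B ← scalingC D x
  let Z ← massC B
  rd D.γ * (sum fun l =>
    rd (D.w l) * (log (rd (Z l)) - sum fun i => rd (x.1 l i) * rd (D.p l i))) + rd D.γ

/-- Program for `primal`. -/
def primalC (D : RegData m N) (π : Plans m N) : Counted ℝ :=
  sum fun l => rd (D.w l) * ((sum fun i => sum fun j => rd (D.C l i j) * rd (π l i j)) +
    rd D.γ * sum fun i => sum fun j => rd (π l i j) * (log (rd (π l i j)) - rd 1))

/-- Row sums of the matrices `π_l`. -/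
def rowSumsC (π : Plans m N) : Counted (Blocks m N) :=
  tab fun l => tab fun i => sum fun j => rd (π l i j)

/-- Column sums of the matrices `π_l`. -/
def colSumsC (π : Plans m N) : Counted (Blocks m N) :=
  tab fun l => tab fun j => sum fun i => rd (π l i j)

/-- Program for `constraintResidual`. -/
def residualC (D : RegData m N) (π : Plans m N) : Counted (Dual m N) := do
  let r ← rowSumsC π
  let c ← colSumsC π
  let t ← tab fun l => rd (D.w l) * rd (D.w l) / rd (D.s l)
  let T ← sum fun l => rd (t l)
  let h ← tab fun j => (sum fun l => rd (t l) * rd (c l j)) / rd T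
  let gu ← tab fun l => tab fun i =>
    rd D.γ * (rd (D.w l) / rd (D.s l)) * (rd (r l i) - rd (D.p l i))
  let gv ← tab fun l => tab fun j =>
    rd D.γ * (rd (D.w l) / rd (D.s l)) * (rd (c l j) - rd (h j))
  pure (gu, gv)

/-- Program for the squared norm `∑ l, s_l ‖g_l‖²` of one of the two blocks. -/
def blockSqC (s : Fin m → ℝ) (g : Blocks m N) : Counted ℝ :=
  sum fun l => rd (s l) * sum fun i => rd (g l i) * rd (g l i)

/-- Program for `uStep`. -/
def uStepC (D : RegData m N) (x : Dual m N) : Counted (Dual m N) := do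
  let B ← scalingC D x
  let r ← rowSumsC B
  let u ← tab fun l => tab fun i => rd (x.1 l i) + log (rd (D.p l i)) - log (rd (r l i))
  pure (u, x.2)

/-- Program for `vStep`. -/
def vStepC (D : RegData m N) (x : Dual m N) : Counted (Dual m N) := do
  let B ← scalingC D x
  let c ← colSumsC B
  let t ← tab fun j => sum fun k => rd (D.w k) * log (rd (c k j))
  let v ← tab fun l => tab fun j => rd (x.2 l j) + rd (t j) - log (rd (c l j))
  pure (x.1, v)

/-- Program for the linear combination `a x + b y` of two dual points. -/
def combineC (a b : ℝ) (x y : Dual m N) : Counted (Dual m N) := do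
  let u ← tab fun l => tab fun i => rd a * rd (x.1 l i) + rd b * rd (y.1 l i)
  let v ← tab fun l => tab fun j => rd a * rd (x.2 l j) + rd b * rd (y.2 l j)
  pure (u, v)

theorem planC_val (D : RegData m N) (x : Dual m N) : (planC D x).val = plan D x := rfl

theorem dualC_val (D : RegData m N) (x : Dual m N) : (dualC D x).val = dual D x := rfl

theorem primalC_val (D : RegData m N) (π : Plans m N) : (primalC D π).val = primal D π := rfl

theorem residualC_val (D : RegData m N) (π : Plans m N) :
    (residualC D π).val = constraintResidual D π := by
  simp only [constraintResidual, commonMarginal, sq]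
  rfl

theorem uStepC_val (D : RegData m N) (x : Dual m N) : (uStepC D x).val = uStep D x := rfl

theorem vStepC_val (D : RegData m N) (x : Dual m N) : (vStepC D x).val = vStep D x := rfl

theorem combineC_val (a b : ℝ) (x y : Dual m N) : (combineC a b x y).val = a • x + b • y := rfl

/-! ### Accelerated Iterative Bregman Projections -/

/-- What the method keeps between two iterations: `L_k`, `a_k`, `η^k`, `ζ^k`, `x̂^k`. -/
structure State (m N : ℕ) where
  L : ℝ
  a : ℝ
  η : Dual m N
  ζ : Dual m N
  x : Plans m N

/-- The initial state, for the initial estimate `L₀` of the Lipschitz constant. -/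
def initial (m N : ℕ) (L₀ : ℝ) : State m N := ⟨L₀, 0, 0, 0, 0⟩

/-- One pass through the body of the inner loop of iteration `k`, started with the state `S` of
that iteration and the trial value `M` of `L_{k+1}`. The result is the next trial value if the
pass fails, and the state of iteration `k + 1` if it succeeds. -/
def pass (D : RegData m N) (S : State m N) (M : ℝ) : Counted (ℝ ⊕ State m N) := do
  let a ← rd 1 / (rd 2 * rd M) +
    sqrt (rd 1 / (rd 4 * (rd M * rd M)) + rd S.a * rd S.a * (rd S.L / rd M))
  let τ ← rd 1 / (rd a * rd M)
  let τ' ← rd 1 - rd τ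
  let x ← combineC τ τ' S.ζ S.η
  let π ← planC D x
  let g ← residualC D π
  let n₁ ← blockSqC D.s g.1
  let n₂ ← blockSqC D.s g.2
  let first ← le n₂ n₁
  let η ← if first then uStepC D x else vStepC D x
  let a' ← rd 0 - rd a
  let ζ ← combineC 1 a' S.ζ g
  let new ← dualC D η
  let old ← dualC D x
  let target ← rd old - (rd n₁ + rd n₂) / (rd 2 * rd M)
  let success ← le new target
  if success then do
    let A ← rd S.L * (rd S.a * rd S.a)
    let A' ← rd M * (rd a * rd a)
    let xhat ← tab fun l => tab fun i => tab fun j =>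
      (rd a * rd (π l i j) + rd A * rd (S.x l i j)) / rd A'
    pure (Sum.inr ⟨M, a, η, ζ, xhat⟩)
  else do
    let M' ← rd 2 * rd M
    pure (Sum.inl M')

/-- `S 0, S 1, …` are the states of the accelerated Iterative Bregman Projections method for the
problem `D` with initial estimate `L₀`: in iteration `k` the inner loop starts with the trial
value `L_k / 2`. -/
def IsRun (D : RegData m N) (L₀ : ℝ) (S : ℕ → State m N) : Prop :=
  S 0 = initial m N L₀ ∧
    ∀ k, ∃ n, LoopsTo (pass D (S k)) ((S k).L / 2) (S (k + 1)) n

/-! ### Approximation of the non-regularized barycenter -/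

/-- Preparation: `γ = ε / (4 ln N)`, `ε' = ε / (8 max_l ‖C_l‖_∞)`, and the perturbed histograms
`(1 - ε' / 8) (p_l + ε' / (N (8 - ε')) 1)`, whose entries are positive. -/
def prepare (D : BaryData m N) (s : Fin m → ℝ) (ε : ℝ) : Counted (RegData m N) := do
  let γ ← rd ε / (rd 4 * log (rd N))
  let c ← maxAbs fun l => maxAbs fun i => maxAbs fun j => rd (D.C l i j)
  let ε' ← rd ε / (rd 8 * rd c)
  let p ← tab fun l => tab fun i =>
    (rd 1 - rd ε' / rd 8) * (rd (D.p l i) + rd ε' / (rd N * (rd 8 - rd ε')))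
  pure { w := D.w, p := p, C := D.C, γ := γ, s := s }

/-- Rounding of the positive matrices `X_l` to transport plans with marginals `p_l` and `q`
(Altschuler, Weed and Rigollet): scale down the rows, then the columns, that are too large, and
add a matrix of rank one. In the last line `e_l = ‖er_l‖₁`, and where it is zero the matrix of
rank one is zero. -/
def roundC (p : Blocks m N) (q : Fin N → ℝ) (X : Plans m N) : Counted (Plans m N) := do
  let r ← rowSumsC X
  let a ← tab fun l => tab fun i => min (rd (p l i) / rd (r l i)) (rd 1)
  let Y ← tab fun l => tab fun i => tab fun j => rd (a l i) * rd (X l i j)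
  let c ← colSumsC Y
  let b ← tab fun l => tab fun j => min (rd (q j) / rd (c l j)) (rd 1)
  let Z ← tab fun l => tab fun i => tab fun j => rd (Y l i j) * rd (b l j)
  let r' ← rowSumsC Z
  let c' ← colSumsC Z
  let er ← tab fun l => tab fun i => rd (p l i) - rd (r' l i)
  let ec ← tab fun l => tab fun j => rd (q j) - rd (c' l j)
  let e ← tab fun l => sum fun i => rd (er l i)
  tab fun l => tab fun i => tab fun j =>
    rd (Z l i j) + rd (er l i) * rd (ec l j) / rd (e l)

/-- The test made after each iteration: average the column sums of the matrices `x̂_l` to a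
histogram `q`, round `x̂_l` to a plan with marginals `p_l` and `q`, and accept if the rounding has
increased the cost by at most `ε / 6` and the duality gap is at most `ε / 6`. Here `D` is the
original problem and `D'` the prepared one. -/
def tryFinish (D : BaryData m N) (D' : RegData m N) (ε : ℝ) (S : State m N) :
    Counted (Option ((Fin N → ℝ) × Plans m N)) := do
  let c ← colSumsC S.x
  let q ← tab fun j => sum fun l => rd (D.w l) * rd (c l j)
  let π ← roundC D.p q S.x
  let incr ← sum fun l => rd (D.w l) *
    sum fun i => sum fun j => rd (D.C l i j) * (rd (π l i j) - rd (S.x l i j))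
  let f ← primalC D' S.x
  let φ ← dualC D' S.η
  let gap ← rd f + rd φ
  let δ ← rd ε / rd 6
  let ok₁ ← le incr δ
  let ok₂ ← le gap δ
  pure (if ok₁ && ok₂ then some (q, π) else none)

/-- The iterations of the accelerated method on the prepared problem `D'`, each followed by the
test `tryFinish`. The first component is the current state, the second the trial value of the
inner loop. -/
def solveBody (D : BaryData m N) (D' : RegData m N) (ε : ℝ) (c : State m N × ℝ) :
    Counted ((State m N × ℝ) ⊕ ((Fin N → ℝ) × Plans m N)) := do
  match ← pass D' c.1 c.2 with
  | Sum.inl M => pure (Sum.inl (c.1, M))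
  | Sum.inr S => do
    match ← tryFinish D D' ε S with
    | some out => pure (Sum.inr out)
    | none => do
      let M ← rd S.L / rd 2
      pure (Sum.inl (S, M))

/-- Approximating the barycenter of `D` to accuracy `ε` by the accelerated Iterative Bregman
Projections method, with inner product weights `s` and initial estimate `L₀`, terminates with the
histogram `q` and the transport plans `π` after `n` elementary operations. -/
def SolvesWith (D : BaryData m N) (s : Fin m → ℝ) (ε L₀ : ℝ)
    (q : Fin N → ℝ) (π : Plans m N) (n : ℕ) : Prop :=
  ∃ k, LoopsTo (solveBody D (prepare D s ε).val ε)
      (initial m N L₀, (rd L₀ / rd 2).val) (q, π) k ∧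
    n = (prepare D s ε).ops + (rd L₀ / rd 2).ops + k

/-- `max_l (w_l / s_l) · ∑ l, s_l`, which measures how far the inner product weights `s` are from
being proportional to the weights `w` (both positive, `∑ l, w_l = 1`). -/
def distortion (w s : Fin m → ℝ) : ℝ := ‖fun l => w l / s l‖ * ∑ l, s l

/-- No distortion for the inner product with weights `w`. -/
theorem distortion_self (w : Fin m → ℝ) (hw : ∀ l, 0 < w l) (hw1 : ∑ l, w l = 1) :
    distortion w w = 1 := by
  have h : (fun l => w l / w l) = fun _ : Fin m => (1 : ℝ) := by
    funext l
    exact div_self (hw l).ne'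
  have : Nonempty (Fin m) := by
    by_contra hne
    rw [not_nonempty_iff] at hne
    simp at hw1
  rw [distortion, h, hw1, pi_norm_const]
  simp

/-- No distortion for the Euclidean inner product if the weights are uniform. -/
theorem distortion_one (hm : 0 < m) :
    distortion (fun _ : Fin m => 1 / (m : ℝ)) (fun _ => 1) = 1 := by
  have : Nonempty (Fin m) := ⟨⟨0, hm⟩⟩
  have hm' : (0 : ℝ) < m := by exact_mod_cast hm
  rw [distortion, pi_norm_const, Real.norm_of_nonneg (by positivity)]
  simp [hm'.ne']

end

end WBary

open WBary

namespace WBary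

variable {m N : ℕ}

/-! ### Relative entropy -/

/-! Everything rests on one identity, `Regular.primal_add_dual`. Up to normalization, log x(z) is
affine in z, so for π with unit masses the gap f(π) + φ(z) - ⟨r(π), z⟩ is exactly γ times the
weighted relative entropy of π with respect to x(z). A Pinsker inequality (`sq_sum_abs_sub_le`)
turns it into γ/4 times squared ℓ1 distances. With π = x(y) this is the convexity inequality for φ
with a remainder in terms of plans (`Regular.dual_add_inner_grad_add_le`), which replaces any
Hessian computation.

An exact block update kills the gradient in its block, so the remainder alone bounds the decrease of
φ from below, and the ℓ1 distance of the plans dominates the old marginal error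
(`Regular.dual_uStep_add_le`, `Regular.dual_vStep_add_le`). The larger block carries at least half
of the squared gradient norm; hence the inner test succeeds as soon as the trial value is at least
2L (`Good.dual_trialDual_le`).

The accelerated method is an estimate sequence. With A = L_k a_k², the invariant `Good` says ζ = -A
r(x̂) and A(φ(η) + f(x̂)) + ‖ζ‖²/2 ≤ 0; `Good.trialState_good` propagates it. Combined with
Fenchel-Young at a dual solution of norm at most R, it bounds A times the residual, the gap and the
squared distance to the optimal plan (`Good.guarantees`). Since √A grows by at least 1/(2√M) per
iteration (`Good.sqrt_A_add_le`), A is of order k²/L.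

For the complexity, a dual solution of the prepared problem is bounded in sup norm by O(ln N ‖C‖/ε),
because block updates have small oscillation (`Regular.exists_bounded`). Consequently the residual,
and with it the cost of rounding, is small once √(A L_φ) reaches `Admissible.target`
(`Admissible.tryFinish_ne_none`). A potential combining the missing part of √(A L_φ) with the
distance of log₂(M/L_φ) from 2 drops by one in every pass, which counts the passes for arbitrary L₀
(`Admissible.solves`). Correctness of the output is independent of that count: weak duality against
a perturbed near-optimal plan, with entropy worth at most ε/2 (`Admissible.approximates`). -/

theorem sq_sqrt_sub_sqrt_le {x y : ℝ} (hx : 0 ≤ x) (hy : 0 < y) :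
    (√x - √y) ^ 2 ≤ x * (Real.log x - Real.log y) - x + y := by
  rcases hx.eq_or_lt with rfl | hx
  · simp [Real.sq_sqrt hy.le]
  have hsx := Real.sqrt_pos.2 hx
  have hsy := Real.sqrt_pos.2 hy
  -- Using ln t ≤ t - 1 at the ratio of square roots, then multiplying by 2x, produces the Hellinger
  -- term instead of mere nonnegativity.
  have h1 : Real.log (√y / √x) ≤ √y / √x - 1 := Real.log_le_sub_one_of_pos (by positivity)
  rw [Real.log_div hsy.ne' hsx.ne', Real.log_sqrt hy.le, Real.log_sqrt hx.le] at h1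
  have h2 : x * (√y / √x) = √x * √y := by
    field_simp
    rw [Real.sq_sqrt hx.le]
  have h3 := mul_le_mul_of_nonneg_left h1 hx.le
  nlinarith [Real.sq_sqrt hx.le, Real.sq_sqrt hy.le]

/-- A Pinsker inequality with the non-sharp constant 4: factor p - q = (√p - √q)(√p + √q) and apply
Cauchy-Schwarz. The first factor is the Hellinger distance, dominated by the relative entropy; the
second has squared sum at most 4. -/
theorem sq_sum_abs_sub_le {ι : Type*} [Fintype ι] (p q : ι → ℝ) (hp : ∀ i, 0 ≤ p i)
    (hq : ∀ i, 0 < q i) (hp1 : ∑ i, p i = 1) (hq1 : ∑ i, q i = 1) :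
    (∑ i, |p i - q i|) ^ 2 ≤ 4 * ∑ i, p i * (Real.log (p i) - Real.log (q i)) := by
  have e : ∀ i, |p i - q i| = |√(p i) - √(q i)| * (√(p i) + √(q i)) := fun i => by
    have : p i - q i = (√(p i) - √(q i)) * (√(p i) + √(q i)) := by
      ring_nf
      rw [Real.sq_sqrt (hp i), Real.sq_sqrt (hq i).le]
    rw [this, abs_mul, abs_of_nonneg (a := √(p i) + √(q i)) (by positivity)]
  simp only [e]
  refine (Finset.sum_mul_sq_le_sq_mul_sq _ _ _).trans ?_
  have h1 : ∑ i, |√(p i) - √(q i)| ^ 2 ≤ ∑ i, p i * (Real.log (p i) - Real.log (q i)) := by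
    calc _ ≤ ∑ i, (p i * (Real.log (p i) - Real.log (q i)) - p i + q i) :=
          Finset.sum_le_sum fun i _ => by
            rw [sq_abs]; exact sq_sqrt_sub_sqrt_le (hp i) (hq i)
      _ = _ := by rw [Finset.sum_add_distrib, Finset.sum_sub_distrib, hp1, hq1]; ring
  have h2 : ∑ i, (√(p i) + √(q i)) ^ 2 ≤ 4 := by
    calc _ ≤ ∑ i, (2 * p i + 2 * q i) := Finset.sum_le_sum fun i _ => by
          nlinarith [Real.sq_sqrt (hp i), Real.sq_sqrt (hq i).le, sq_nonneg (√(p i) - √(q i))]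
      _ = 4 := by rw [Finset.sum_add_distrib, ← Finset.mul_sum, ← Finset.mul_sum, hp1, hq1]; norm_num
  have h0 : 0 ≤ ∑ i, |√(p i) - √(q i)| ^ 2 := Finset.sum_nonneg fun i _ => by positivity
  nlinarith

/-! ### The space of dual points -/

theorem add_smul_mem_dualFeasible {D : BaryData m N} {x y : Dual m N} (a b : ℝ)
    (hx : x ∈ dualFeasible D) (hy : y ∈ dualFeasible D) : a • x + b • y ∈ dualFeasible D := by
  intro j
  have hx := hx j
  have hy := hy j
  calc ∑ l, D.w l * (a • x + b • y).2 l j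
      = a * ∑ l, D.w l * x.2 l j + b * ∑ l, D.w l * y.2 l j := by
        rw [Finset.mul_sum, Finset.mul_sum, ← Finset.sum_add_distrib]
        refine Finset.sum_congr rfl fun l _ => ?_
        simp only [Prod.snd_add, Prod.smul_snd, Pi.add_apply, Pi.smul_apply, smul_eq_mul]
        ring
    _ = 0 := by rw [hx, hy]; ring

theorem zero_mem_dualFeasible (D : BaryData m N) : (0 : Dual m N) ∈ dualFeasible D := by
  intro j
  simp

theorem dualInner_comm (s : Fin m → ℝ) (x y : Dual m N) : dualInner s x y = dualInner s y x := by
  simp only [dualInner, mul_comm]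

theorem dualInner_comb (s : Fin m → ℝ) (a b : ℝ) (x y z : Dual m N) :
    dualInner s (a • x + b • y) z = a * dualInner s x z + b * dualInner s y z := by
  simp only [dualInner, Finset.mul_sum, ← Finset.sum_add_distrib, Prod.fst_add, Prod.snd_add,
    Prod.smul_fst, Prod.smul_snd, Pi.add_apply, Pi.smul_apply, smul_eq_mul]
  refine Finset.sum_congr rfl fun l _ => ?_
  exact Finset.sum_congr rfl fun i _ => by ring

theorem dualInner_comb_right (s : Fin m → ℝ) (a b : ℝ) (x y z : Dual m N) :
    dualInner s z (a • x + b • y) = a * dualInner s z x + b * dualInner s z y := by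
  rw [dualInner_comm, dualInner_comb, dualInner_comm s x, dualInner_comm s y]

theorem dualInner_sub_right (s : Fin m → ℝ) (x y z : Dual m N) :
    dualInner s z (x - y) = dualInner s z x - dualInner s z y := by
  have := dualInner_comb_right s 1 (-1) x y z
  rw [one_smul, neg_smul, one_smul, ← sub_eq_add_neg] at this
  linarith

theorem dualInner_zero_right (s : Fin m → ℝ) (x : Dual m N) : dualInner s x 0 = 0 := by
  simp [dualInner]

theorem dualInner_self_nonneg {s : Fin m → ℝ} (hs : ∀ l, 0 < s l) (x : Dual m N) :
    0 ≤ dualInner s x x :=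
  Finset.sum_nonneg fun l _ => mul_nonneg (hs l).le (add_nonneg
    (Finset.sum_nonneg fun _ _ => mul_self_nonneg _)
    (Finset.sum_nonneg fun _ _ => mul_self_nonneg _))

theorem dualNorm_sq {s : Fin m → ℝ} (hs : ∀ l, 0 < s l) (x : Dual m N) :
    dualNorm s x ^ 2 = dualInner s x x :=
  Real.sq_sqrt (dualInner_self_nonneg hs x)

theorem dualNorm_nonneg (s : Fin m → ℝ) (x : Dual m N) : 0 ≤ dualNorm s x := Real.sqrt_nonneg _

/-- Cauchy-Schwarz, from the nonpositive discriminant of the quadratic t ↦ ‖t x + y‖². -/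
theorem abs_dualInner_le {s : Fin m → ℝ} (hs : ∀ l, 0 < s l) (x y : Dual m N) :
    |dualInner s x y| ≤ dualNorm s x * dualNorm s y := by
  have h := discrim_le_zero (a := dualInner s x x) (b := 2 * dualInner s x y)
    (c := dualInner s y y) fun t => by
      have := dualInner_self_nonneg hs (t • x + (1 : ℝ) • y)
      rw [dualInner_comb, dualInner_comb_right, dualInner_comb_right, dualInner_comm s y x] at this
      linarith
  refine abs_le_of_sq_le_sq ?_ (mul_nonneg (dualNorm_nonneg _ _) (dualNorm_nonneg _ _))
  rw [mul_pow, dualNorm_sq hs, dualNorm_sq hs]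
  unfold discrim at h
  linarith

/-! ### Regularized problems -/

/-- The standing assumptions on the data of a regularized problem. -/
structure Regular (D : RegData m N) : Prop where
  γ_pos : 0 < D.γ
  w_pos : ∀ l, 0 < D.w l
  w_sum : ∑ l, D.w l = 1
  s_pos : ∀ l, 0 < D.s l
  p_mem : ∀ l, D.p l ∈ stdSimplex ℝ (Fin N)
  p_pos : ∀ l i, 0 < D.p l i

namespace Regular

variable {D : RegData m N}

theorem nonempty_left (h : Regular D) : Nonempty (Fin m) := by
  by_contra hne
  rw [not_nonempty_iff] at hne
  simpa using h.w_sum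

theorem nonempty_right (h : Regular D) : Nonempty (Fin N) := by
  by_contra hne
  rw [not_nonempty_iff] at hne
  obtain ⟨l⟩ := h.nonempty_left
  simpa using (h.p_mem l).2

theorem mass_pos (h : Regular D) (x : Dual m N) (l : Fin m) : 0 < mass D x l := by
  have := h.nonempty_right
  exact Finset.sum_pos (fun i _ => Finset.sum_pos (fun j _ => Real.exp_pos _)
    Finset.univ_nonempty) Finset.univ_nonempty

theorem plan_pos (h : Regular D) (x : Dual m N) (l : Fin m) (i j : Fin N) : 0 < plan D x l i j :=
  div_pos (Real.exp_pos _) (h.mass_pos x l)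

theorem sum_plan (h : Regular D) (x : Dual m N) (l : Fin m) : ∑ i, ∑ j, plan D x l i j = 1 := by
  simp only [plan, ← Finset.sum_div]
  exact div_self (h.mass_pos x l).ne'

theorem log_plan (h : Regular D) (x : Dual m N) (l : Fin m) (i j : Fin N) :
    Real.log (plan D x l i j) =
      x.1 l i + x.2 l j - D.C l i j / D.γ - Real.log (mass D x l) := by
  rw [plan, scaling, Real.log_div (Real.exp_pos _).ne' (h.mass_pos x l).ne', Real.log_exp]

/-- The weights w²/s in the mean h are what makes this work: the sum over l of w_l (w_l/s_l)(column
sum - h) vanishes exactly for that mean. -/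
theorem constraintResidual_mem (h : Regular D) (π : Plans m N) :
    constraintResidual D π ∈ dualFeasible D.toBaryData := by
  intro j
  have := h.nonempty_left
  have hT : 0 < ∑ l, D.w l ^ 2 / D.s l :=
    Finset.sum_pos (fun l _ => div_pos (pow_pos (h.w_pos l) 2) (h.s_pos l)) Finset.univ_nonempty
  calc _ = D.γ * ((∑ l, D.w l ^ 2 / D.s l * ∑ i, π l i j) -
        (∑ l, D.w l ^ 2 / D.s l) * commonMarginal D π j) := by
        rw [Finset.sum_mul, ← Finset.sum_sub_distrib, Finset.mul_sum]
        exact Finset.sum_congr rfl fun l _ => by simp only [constraintResidual]; ring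
    _ = 0 := by rw [commonMarginal, mul_div_cancel₀ _ hT.ne', sub_self, mul_zero]

theorem inner_constraintResidual (h : Regular D) (π : Plans m N) {z : Dual m N}
    (hz : z ∈ dualFeasible D.toBaryData) :
    dualInner D.s (constraintResidual D π) z =
      D.γ * ∑ l, D.w l * ((∑ i, ∑ j, π l i j * (z.1 l i + z.2 l j)) -
        ∑ i, z.1 l i * D.p l i) := by
  have e : ∀ l, D.s l * ((∑ i, (constraintResidual D π).1 l i * z.1 l i) +
      ∑ j, (constraintResidual D π).2 l j * z.2 l j) =
      D.γ * (D.w l * ((∑ i, ∑ j, π l i j * (z.1 l i + z.2 l j)) - ∑ i, z.1 l i * D.p l i)) -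
      D.γ * ∑ j, commonMarginal D π j * (D.w l * z.2 l j) := fun l => by
    have h1 : ∑ i, ∑ j, π l i j * (z.1 l i + z.2 l j) =
        (∑ i, (∑ j, π l i j) * z.1 l i) + ∑ j, (∑ i, π l i j) * z.2 l j := by
      simp only [mul_add, Finset.sum_add_distrib, Finset.sum_mul]
      congr 1
      exact Finset.sum_comm
    have h2 : D.s l * (D.w l / D.s l) = D.w l := mul_div_cancel₀ _ (h.s_pos l).ne'
    have h3 : ∑ i, (constraintResidual D π).1 l i * z.1 l i = D.γ * (D.w l / D.s l) *
        ((∑ i, (∑ j, π l i j) * z.1 l i) - ∑ i, z.1 l i * D.p l i) := by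
      rw [← Finset.sum_sub_distrib, Finset.mul_sum]
      exact Finset.sum_congr rfl fun i _ => by simp only [constraintResidual]; ring
    have h4 : ∑ j, (constraintResidual D π).2 l j * z.2 l j = D.γ * (D.w l / D.s l) *
        ((∑ j, (∑ i, π l i j) * z.2 l j) - ∑ j, commonMarginal D π j * z.2 l j) := by
      rw [← Finset.sum_sub_distrib, Finset.mul_sum]
      exact Finset.sum_congr rfl fun i _ => by simp only [constraintResidual]; ring
    have h5 : ∑ j, commonMarginal D π j * (D.w l * z.2 l j) =
        D.w l * ∑ j, commonMarginal D π j * z.2 l j := by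
      rw [Finset.mul_sum]
      exact Finset.sum_congr rfl fun i _ => by ring
    rw [h1, h3, h4, h5]
    linear_combination (D.γ * ((∑ i, (∑ j, π l i j) * z.1 l i) - (∑ i, z.1 l i * D.p l i) +
      ((∑ j, (∑ i, π l i j) * z.2 l j) - ∑ j, commonMarginal D π j * z.2 l j))) * h2
  -- The vector h does not depend on l, so its contribution is annihilated by the constraint on z.
  have h0 : ∑ l, ∑ j, commonMarginal D π j * (D.w l * z.2 l j) = 0 := by
    rw [Finset.sum_comm]
    refine Finset.sum_eq_zero fun j _ => ?_
    rw [← Finset.mul_sum, hz j, mul_zero]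
  rw [dualInner, Finset.sum_congr rfl fun l _ => e l, Finset.sum_sub_distrib, ← Finset.mul_sum,
    ← Finset.mul_sum, h0, mul_zero, sub_zero]

/-- The gap in the Fenchel-Young inequality is a relative entropy. -/
theorem primal_add_dual (h : Regular D) {π : Plans m N} (hπ : ∀ l, ∑ i, ∑ j, π l i j = 1)
    {z : Dual m N} (hz : z ∈ dualFeasible D.toBaryData) :
    primal D π + dual D z - dualInner D.s (constraintResidual D π) z =
      D.γ * ∑ l, D.w l * ∑ i, ∑ j, π l i j *
        (Real.log (π l i j) - Real.log (plan D z l i j)) := by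
  -- Substituting the formula for log x(z) splits the relative entropy into cost, entropy, a term
  -- linear in z and the log-mass.
  have e : ∀ l, ∑ i, ∑ j, π l i j * (Real.log (π l i j) - Real.log (plan D z l i j)) =
      (∑ i, ∑ j, D.C l i j * π l i j) / D.γ + (∑ i, ∑ j, π l i j * (Real.log (π l i j) - 1)) + 1
        - (∑ i, ∑ j, π l i j * (z.1 l i + z.2 l j)) + Real.log (mass D z l) := fun l => by
    have := hπ l
    calc _ = ∑ i, ∑ j, (D.C l i j * π l i j / D.γ + π l i j * (Real.log (π l i j) - 1) + π l i j -
          π l i j * (z.1 l i + z.2 l j) + π l i j * Real.log (mass D z l)) :=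
          Finset.sum_congr rfl fun i _ => Finset.sum_congr rfl fun j _ => by
            rw [h.log_plan]; ring
      _ = _ := by
        simp only [Finset.sum_add_distrib, Finset.sum_sub_distrib, ← Finset.sum_div,
          ← Finset.sum_mul, this, one_mul]
  rw [h.inner_constraintResidual π hz, primal, dual]
  have hγ := h.γ_pos.ne'
  -- The additive γ of φ, spread over the weights, offsets the -1 inside the entropy of f.
  have hw : D.γ = D.γ * ∑ l, D.w l := by rw [h.w_sum, mul_one]
  calc _ = (∑ l, D.w l * ((∑ i, ∑ j, D.C l i j * π l i j) +
        D.γ * ∑ i, ∑ j, π l i j * (Real.log (π l i j) - 1))) +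
        D.γ * (∑ l, D.w l * (Real.log (mass D z l) - ∑ i, z.1 l i * D.p l i)) +
        D.γ * (∑ l, D.w l) - D.γ * ∑ l, D.w l * ((∑ i, ∑ j, π l i j * (z.1 l i + z.2 l j)) -
        ∑ i, z.1 l i * D.p l i) := by rw [← hw]; ring
    _ = _ := by
      simp only [e]
      rw [Finset.mul_sum, Finset.mul_sum, Finset.mul_sum, Finset.mul_sum,
        ← Finset.sum_add_distrib, ← Finset.sum_add_distrib, ← Finset.sum_sub_distrib]
      refine Finset.sum_congr rfl fun l _ => ?_
      field_simp
      ring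

theorem primal_plan (h : Regular D) {z : Dual m N} (hz : z ∈ dualFeasible D.toBaryData) :
    primal D (plan D z) + dual D z = dualInner D.s (grad D z) z := by
  have := h.primal_add_dual (h.sum_plan z) hz
  simp only [sub_self, mul_zero, Finset.sum_const_zero] at this
  rw [grad]
  linarith

/-- The Fenchel-Young inequality, with the strong convexity of the entropy. -/
theorem inner_add_le (h : Regular D) {π : Plans m N} (hπ0 : ∀ l i j, 0 ≤ π l i j)
    (hπ : ∀ l, ∑ i, ∑ j, π l i j = 1)
    {z : Dual m N} (hz : z ∈ dualFeasible D.toBaryData) :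
    dualInner D.s (constraintResidual D π) z +
      D.γ / 4 * ∑ l, D.w l * (∑ i, ∑ j, |π l i j - plan D z l i j|) ^ 2 ≤
      primal D π + dual D z := by
  have := h.primal_add_dual hπ hz
  have h2 : ∑ l, D.w l * (∑ i, ∑ j, |π l i j - plan D z l i j|) ^ 2 ≤
      4 * ∑ l, D.w l * ∑ i, ∑ j, π l i j * (Real.log (π l i j) - Real.log (plan D z l i j)) := by
    rw [Finset.mul_sum]
    refine Finset.sum_le_sum fun l _ => ?_
    have := sq_sum_abs_sub_le (fun a : Fin N × Fin N => π l a.1 a.2)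
      (fun a => plan D z l a.1 a.2) (fun a => hπ0 l _ _) (fun a => h.plan_pos z l _ _)
      (by rw [Fintype.sum_prod_type]; exact hπ l) (by rw [Fintype.sum_prod_type]; exact h.sum_plan z l)
    simp only [Fintype.sum_prod_type] at this
    nlinarith [mul_le_mul_of_nonneg_left this (h.w_pos l).le]
  have := mul_le_mul_of_nonneg_left h2 h.γ_pos.le
  linarith

theorem sum_w_sq_nonneg (h : Regular D) (f : Fin m → ℝ) : 0 ≤ ∑ l, D.w l * f l ^ 2 :=
  Finset.sum_nonneg fun l _ => mul_nonneg (h.w_pos l).le (sq_nonneg _)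

theorem inner_le (h : Regular D) {π : Plans m N} (hπ0 : ∀ l i j, 0 ≤ π l i j)
    (hπ : ∀ l, ∑ i, ∑ j, π l i j = 1) {z : Dual m N} (hz : z ∈ dualFeasible D.toBaryData) :
    dualInner D.s (constraintResidual D π) z ≤ primal D π + dual D z := by
  have := h.inner_add_le hπ0 hπ hz
  have := mul_nonneg (by linarith [h.γ_pos] : 0 ≤ D.γ / 4)
    (h.sum_w_sq_nonneg fun l => ∑ i, ∑ j, |π l i j - plan D z l i j|)
  linarith

/-- The gradient inequality for the dual objective, with a remainder. -/
theorem dual_add_inner_grad_add_le (h : Regular D) {y z : Dual m N}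
    (hy : y ∈ dualFeasible D.toBaryData) (hz : z ∈ dualFeasible D.toBaryData) :
    dual D y + dualInner D.s (grad D y) (z - y) +
      D.γ / 4 * ∑ l, D.w l * (∑ i, ∑ j, |plan D y l i j - plan D z l i j|) ^ 2 ≤ dual D z := by
  -- Fenchel-Young is an equality at π = x(y), z = y; comparing it with the inequality for the same
  -- π and another z leaves the remainder.
  have h1 := h.inner_add_le (fun l i j => (h.plan_pos y l i j).le) (h.sum_plan y) hz
  have h2 := h.primal_plan hy
  rw [dualInner_sub_right]
  rw [grad] at *
  linarith

theorem dual_add_inner_grad_le (h : Regular D) {y z : Dual m N}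
    (hy : y ∈ dualFeasible D.toBaryData) (hz : z ∈ dualFeasible D.toBaryData) :
    dual D y + dualInner D.s (grad D y) (z - y) ≤ dual D z := by
  have := h.dual_add_inner_grad_add_le hy hz
  have := mul_nonneg (by linarith [h.γ_pos] : 0 ≤ D.γ / 4)
    (h.sum_w_sq_nonneg fun l => ∑ i, ∑ j, |plan D y l i j - plan D z l i j|)
  linarith

end Regular

/-! ### Gradient of the dual objective. -/

namespace Regular

variable {D : RegData m N}

theorem hasDerivAt_dual (h : Regular D) (x : Dual m N) {d : Dual m N}
    (hd : d ∈ dualFeasible D.toBaryData) :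
    HasDerivAt (fun t : ℝ => dual D (x + t • d)) (dualInner D.s (grad D x) d) 0 := by
  have h1 : ∀ l i j, HasDerivAt (fun t : ℝ => scaling D (x + t • d) l i j)
      (scaling D x l i j * (d.1 l i + d.2 l j)) 0 := fun l i j => by
    have e : HasDerivAt (fun t : ℝ => x.1 l i + t * d.1 l i + (x.2 l j + t * d.2 l j) -
        D.C l i j / D.γ) (1 * d.1 l i + 1 * d.2 l j) 0 :=
      ((((hasDerivAt_id (0 : ℝ)).mul_const _).const_add _).add
        (((hasDerivAt_id (0 : ℝ)).mul_const _).const_add _)).sub_const _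
    have := e.exp
    simpa [scaling] using this
  have h2 : ∀ l, HasDerivAt (fun t : ℝ => mass D (x + t • d) l)
      (∑ i, ∑ j, scaling D x l i j * (d.1 l i + d.2 l j)) 0 := fun l =>
    HasDerivAt.fun_sum fun i _ => HasDerivAt.fun_sum fun j _ => h1 l i j
  have h3 : ∀ l, HasDerivAt (fun t : ℝ => D.w l * (Real.log (mass D (x + t • d) l) -
      ∑ i, (x + t • d).1 l i * D.p l i))
      (D.w l * ((∑ i, ∑ j, plan D x l i j * (d.1 l i + d.2 l j)) - ∑ i, d.1 l i * D.p l i)) 0 :=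
    fun l => by
    have hm := h.mass_pos x l
    have e1 := (h2 l).log (by simpa using hm.ne')
    have e2 : HasDerivAt (fun t : ℝ => ∑ i, (x + t • d).1 l i * D.p l i)
        (∑ i, d.1 l i * D.p l i) 0 := HasDerivAt.fun_sum fun i _ => by
      have : HasDerivAt (fun t : ℝ => (x.1 l i + t * d.1 l i) * D.p l i)
        (1 * d.1 l i * D.p l i) 0 :=
        (((hasDerivAt_id (0 : ℝ)).mul_const _).const_add _).mul_const _
      simpa using this
    have e3 : ∑ i, ∑ j, plan D x l i j * (d.1 l i + d.2 l j) =
        (∑ i, ∑ j, scaling D x l i j * (d.1 l i + d.2 l j)) / mass D (x + (0 : ℝ) • d) l := by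
      rw [zero_smul, add_zero]
      simp only [Finset.sum_div, plan]
      exact Finset.sum_congr rfl fun i _ => Finset.sum_congr rfl fun j _ => by ring
    rw [e3]
    exact (e1.sub e2).const_mul _
  rw [grad, h.inner_constraintResidual _ hd]
  exact ((HasDerivAt.fun_sum fun l _ => h3 l).const_mul _).add_const _

theorem dual_le_of_inner_eq_zero (h : Regular D) {y z : Dual m N}
    (hy : y ∈ dualFeasible D.toBaryData) (hz : z ∈ dualFeasible D.toBaryData)
    (h0 : dualInner D.s (grad D y) (z - y) = 0) : dual D y ≤ dual D z := by
  have := h.dual_add_inner_grad_le hy hz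
  linarith

/-! ### The two block updates -/

theorem rowSum_pos (h : Regular D) (x : Dual m N) (l : Fin m) (i : Fin N) :
    0 < ∑ j, scaling D x l i j := by
  have := h.nonempty_right
  exact Finset.sum_pos (fun j _ => Real.exp_pos _) Finset.univ_nonempty

theorem colSum_pos (h : Regular D) (x : Dual m N) (l : Fin m) (j : Fin N) :
    0 < ∑ i, scaling D x l i j := by
  have := h.nonempty_right
  exact Finset.sum_pos (fun j _ => Real.exp_pos _) Finset.univ_nonempty

theorem uStep_mem (x : Dual m N) (hx : x ∈ dualFeasible D.toBaryData) :
    uStep D x ∈ dualFeasible D.toBaryData := hx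

theorem vStep_mem (h : Regular D) (x : Dual m N) (hx : x ∈ dualFeasible D.toBaryData) :
    vStep D x ∈ dualFeasible D.toBaryData := by
  intro j
  simp only [vStep, mul_sub, mul_add, Finset.sum_sub_distrib, Finset.sum_add_distrib]
  rw [hx j, ← Finset.sum_mul, h.w_sum]
  ring

theorem rowSum_uStep (h : Regular D) (x : Dual m N) (l : Fin m) (i : Fin N) :
    ∑ j, scaling D (uStep D x) l i j = D.p l i := by
  have hr := h.rowSum_pos x l i
  have e : ∀ j, scaling D (uStep D x) l i j =
      D.p l i / (∑ j, scaling D x l i j) * scaling D x l i j := fun j => by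
    have : (uStep D x).1 l i + (uStep D x).2 l j - D.C l i j / D.γ =
        Real.log (D.p l i) - Real.log (∑ j, scaling D x l i j) +
          (x.1 l i + x.2 l j - D.C l i j / D.γ) := by simp only [uStep]; ring
    rw [scaling, this, Real.exp_add, Real.exp_sub, Real.exp_log (h.p_pos l i), Real.exp_log hr]
    rfl
  rw [Finset.sum_congr rfl fun j _ => e j, ← Finset.mul_sum, div_mul_cancel₀ _ hr.ne']

theorem mass_uStep (h : Regular D) (x : Dual m N) (l : Fin m) : mass D (uStep D x) l = 1 := by
  simp only [mass, h.rowSum_uStep]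
  exact (h.p_mem l).2

theorem rowSum_plan_uStep (h : Regular D) (x : Dual m N) (l : Fin m) (i : Fin N) :
    ∑ j, plan D (uStep D x) l i j = D.p l i := by
  simp only [plan, h.mass_uStep, div_one, h.rowSum_uStep]

/-- The update multiplies column j by (geometric mean of the column sums)/(own column sum), so the
new sum no longer depends on l. This common value is what makes the v-part of the gradient vanish.
-/
theorem colSum_vStep (h : Regular D) (x : Dual m N) (l : Fin m) (j : Fin N) :
    ∑ i, scaling D (vStep D x) l i j =
      Real.exp (∑ k, D.w k * Real.log (∑ i, scaling D x k i j)) := by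
  have hr := h.colSum_pos x l j
  have e : ∀ i, scaling D (vStep D x) l i j =
      Real.exp (∑ k, D.w k * Real.log (∑ i, scaling D x k i j)) / (∑ i, scaling D x l i j) *
        scaling D x l i j := fun i => by
    have : (vStep D x).1 l i + (vStep D x).2 l j - D.C l i j / D.γ =
        (∑ k, D.w k * Real.log (∑ i, scaling D x k i j)) - Real.log (∑ i, scaling D x l i j) +
          (x.1 l i + x.2 l j - D.C l i j / D.γ) := by simp only [vStep]; ring
    rw [scaling, this, Real.exp_add, Real.exp_sub, Real.exp_log hr]
    rfl
  rw [Finset.sum_congr rfl fun j _ => e j, ← Finset.mul_sum, div_mul_cancel₀ _ hr.ne']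

theorem exists_colSum_plan_vStep (h : Regular D) (x : Dual m N) :
    ∃ q : Fin N → ℝ, ∀ l j, ∑ i, plan D (vStep D x) l i j = q j := by
  refine ⟨fun j => Real.exp (∑ k, D.w k * Real.log (∑ i, scaling D x k i j)) /
    ∑ j, Real.exp (∑ k, D.w k * Real.log (∑ i, scaling D x k i j)), fun l j => ?_⟩
  simp only [plan, ← Finset.sum_div, h.colSum_vStep]
  congr 1
  rw [mass, Finset.sum_comm]
  exact Finset.sum_congr rfl fun j _ => h.colSum_vStep x l j

theorem grad_uStep_fst (h : Regular D) (x : Dual m N) : (grad D (uStep D x)).1 = 0 := by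
  funext l i
  simp only [grad, constraintResidual, h.rowSum_plan_uStep, sub_self, mul_zero, Pi.zero_apply]

theorem sum_ratio_pos (h : Regular D) : 0 < ∑ l, D.w l ^ 2 / D.s l := by
  have := h.nonempty_left
  exact Finset.sum_pos (fun l _ => div_pos (pow_pos (h.w_pos l) 2) (h.s_pos l))
    Finset.univ_nonempty

theorem commonMarginal_eq (h : Regular D) {π : Plans m N} {q : Fin N → ℝ}
    (hq : ∀ l j, ∑ i, π l i j = q j) (j : Fin N) : commonMarginal D π j = q j := by
  simp only [commonMarginal, hq, ← Finset.sum_mul]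
  exact mul_div_cancel_left₀ _ h.sum_ratio_pos.ne'

theorem grad_vStep_snd (h : Regular D) (x : Dual m N) : (grad D (vStep D x)).2 = 0 := by
  obtain ⟨q, hq⟩ := h.exists_colSum_plan_vStep x
  funext l j
  simp only [grad, constraintResidual, h.commonMarginal_eq hq, hq, sub_self, mul_zero,
    Pi.zero_apply]

theorem inner_eq_zero_of_snd {s : Fin m → ℝ} {g y z : Dual m N} (hg : g.1 = 0)
    (hyz : z.2 = y.2) : dualInner s g (z - y) = 0 := by
  simp [dualInner, hg, hyz]

theorem inner_eq_zero_of_fst {s : Fin m → ℝ} {g y z : Dual m N} (hg : g.2 = 0)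
    (hyz : z.1 = y.1) : dualInner s g (z - y) = 0 := by
  simp [dualInner, hg, hyz]

theorem isMinOn_uStep (h : Regular D) {x : Dual m N} (hx : x ∈ dualFeasible D.toBaryData) :
    IsMinOn (dual D) {y ∈ dualFeasible D.toBaryData | y.2 = x.2} (uStep D x) := fun _ hz =>
  h.dual_le_of_inner_eq_zero (uStep_mem x hx) hz.1 (inner_eq_zero_of_snd (h.grad_uStep_fst x) hz.2)

theorem isMinOn_vStep (h : Regular D) {x : Dual m N} (hx : x ∈ dualFeasible D.toBaryData) :
    IsMinOn (dual D) {y ∈ dualFeasible D.toBaryData | y.1 = x.1} (vStep D x) := fun _ hz =>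
  h.dual_le_of_inner_eq_zero (h.vStep_mem x hx) hz.1
    (inner_eq_zero_of_fst (h.grad_vStep_snd x) hz.2)

/-! ### The progress of the block updates -/

theorem sum_abs_sum_sub_le (a b : Fin N → Fin N → ℝ) :
    ∑ i, |(∑ j, a i j) - ∑ j, b i j| ≤ ∑ i, ∑ j, |a i j - b i j| :=
  Finset.sum_le_sum fun i _ => by
    rw [← Finset.sum_sub_distrib]
    exact Finset.abs_sum_le_sum_abs _ _

theorem sum_sq_sum_sub_le (a b : Fin N → Fin N → ℝ) :
    ∑ i, ((∑ j, a i j) - ∑ j, b i j) ^ 2 ≤ (∑ i, ∑ j, |a i j - b i j|) ^ 2 := by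
  calc _ = ∑ i, |(∑ j, a i j) - ∑ j, b i j| ^ 2 := by simp only [sq_abs]
    _ ≤ (∑ i, |(∑ j, a i j) - ∑ j, b i j|) ^ 2 :=
      Finset.sum_sq_le_sq_sum_of_nonneg fun i _ => abs_nonneg _
    _ ≤ _ := pow_le_pow_left₀ (Finset.sum_nonneg fun _ _ => abs_nonneg _)
      (sum_abs_sum_sub_le a b) 2

/-- A gradient block contributes s_l (γ w_l/s_l)² = γ² w_l²/s_l times a squared marginal error; this
trades that coefficient for the weight w_l of the remainder term. -/
theorem coeff_le (h : Regular D) {L : ℝ} (hL : ∀ l, 2 * D.γ * (D.w l / D.s l) ≤ L) (l : Fin m) :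
    D.γ ^ 2 * (D.w l ^ 2 / D.s l) ≤ D.γ * L / 2 * D.w l := by
  have := mul_le_mul_of_nonneg_left (hL l) (mul_nonneg h.γ_pos.le (h.w_pos l).le)
  have e : D.γ ^ 2 * (D.w l ^ 2 / D.s l) = D.γ * D.w l * (2 * D.γ * (D.w l / D.s l)) / 2 := by
    ring
  rw [e]
  linarith

/-- Expand φ around the updated point: the linear term vanishes, as the gradient there has no u-part
and the displacement has no v-part. The decrease is thus at least the Pinsker remainder, and since
the updated plan has rows p_l, the ℓ1 distance of the plans bounds the ℓ2 row error at the old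
point. -/
theorem dual_uStep_add_le (h : Regular D) {L : ℝ} (hL : ∀ l, 2 * D.γ * (D.w l / D.s l) ≤ L)
    {x : Dual m N} (hx : x ∈ dualFeasible D.toBaryData) :
    ∑ l, D.s l * ∑ i, (grad D x).1 l i ^ 2 ≤ 2 * L * (dual D x - dual D (uStep D x)) := by
  have hL0 : 0 ≤ L := by
    obtain ⟨l⟩ := h.nonempty_left
    have := mul_pos (mul_pos two_pos h.γ_pos) (div_pos (h.w_pos l) (h.s_pos l))
    exact this.le.trans (hL l)
  have h1 := h.dual_add_inner_grad_add_le (uStep_mem x hx) hx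
  rw [inner_eq_zero_of_snd (y := uStep D x) (z := x) (h.grad_uStep_fst x) rfl] at h1
  have h2 : ∑ l, D.s l * ∑ i, (grad D x).1 l i ^ 2 ≤
      ∑ l, D.γ * L / 2 * (D.w l * (∑ i, ∑ j, |plan D (uStep D x) l i j - plan D x l i j|) ^ 2) := by
    refine Finset.sum_le_sum fun l _ => ?_
    have e : D.s l * ∑ i, (grad D x).1 l i ^ 2 = D.γ ^ 2 * (D.w l ^ 2 / D.s l) *
        ∑ i, ((∑ j, plan D (uStep D x) l i j) - ∑ j, plan D x l i j) ^ 2 := by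
      rw [Finset.mul_sum, Finset.mul_sum]
      refine Finset.sum_congr rfl fun i _ => ?_
      have := (h.s_pos l).ne'
      rw [h.rowSum_plan_uStep]
      simp only [grad, constraintResidual]
      field_simp
      ring
    rw [e, ← mul_assoc]
    exact mul_le_mul (h.coeff_le hL l) (sum_sq_sum_sub_le _ _)
      (Finset.sum_nonneg fun _ _ => sq_nonneg _)
      (mul_nonneg (div_nonneg (mul_nonneg h.γ_pos.le hL0) zero_le_two) (h.w_pos l).le)
  rw [← Finset.mul_sum] at h2
  nlinarith

/-- A weighted mean minimizes the weighted sum of squares. It permits replacing h by the common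
marginal of the updated plan. -/
theorem sum_sq_commonMarginal_le (h : Regular D) (π : Plans m N) (j : Fin N) (q : ℝ) :
    ∑ l, D.w l ^ 2 / D.s l * ((∑ i, π l i j) - commonMarginal D π j) ^ 2 ≤
      ∑ l, D.w l ^ 2 / D.s l * (q - ∑ i, π l i j) ^ 2 := by
  have hT := h.sum_ratio_pos
  have hc : ∑ l, D.w l ^ 2 / D.s l * ∑ i, π l i j =
      (∑ l, D.w l ^ 2 / D.s l) * commonMarginal D π j := by
    rw [commonMarginal, mul_div_cancel₀ _ hT.ne']
  have e : ∀ l, D.w l ^ 2 / D.s l * (q - ∑ i, π l i j) ^ 2 =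
      D.w l ^ 2 / D.s l * ((∑ i, π l i j) - commonMarginal D π j) ^ 2 +
      D.w l ^ 2 / D.s l * (q - commonMarginal D π j) ^ 2 - 2 * (q - commonMarginal D π j) *
        (D.w l ^ 2 / D.s l * (∑ i, π l i j) - D.w l ^ 2 / D.s l * commonMarginal D π j) :=
    fun l => by ring
  rw [Finset.sum_congr rfl fun l _ => e l, Finset.sum_sub_distrib, Finset.sum_add_distrib,
    ← Finset.mul_sum, Finset.sum_sub_distrib, hc, ← Finset.sum_mul, ← Finset.sum_mul, sub_self]
  have := mul_nonneg hT.le (sq_nonneg (q - commonMarginal D π j))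
  linarith

/-- As for u, except that the column error in the gradient refers to h while the updated plan has
columns q; h being the best centre, passing to q only enlarges the sum. -/
theorem dual_vStep_add_le (h : Regular D) {L : ℝ} (hL : ∀ l, 2 * D.γ * (D.w l / D.s l) ≤ L)
    {x : Dual m N} (hx : x ∈ dualFeasible D.toBaryData) :
    ∑ l, D.s l * ∑ j, (grad D x).2 l j ^ 2 ≤ 2 * L * (dual D x - dual D (vStep D x)) := by
  have hL0 : 0 ≤ L := by
    obtain ⟨l⟩ := h.nonempty_left
    have := mul_pos (mul_pos two_pos h.γ_pos) (div_pos (h.w_pos l) (h.s_pos l))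
    exact this.le.trans (hL l)
  have h1 := h.dual_add_inner_grad_add_le (h.vStep_mem x hx) hx
  rw [inner_eq_zero_of_fst (y := vStep D x) (z := x) (h.grad_vStep_snd x) rfl] at h1
  obtain ⟨q, hq⟩ := h.exists_colSum_plan_vStep x
  have h0 : ∑ l, D.s l * ∑ j, (grad D x).2 l j ^ 2 ≤
      ∑ l, D.γ ^ 2 * (D.w l ^ 2 / D.s l) * ∑ j, (q j - ∑ i, plan D x l i j) ^ 2 := by
    have e : ∀ l j, D.s l * (grad D x).2 l j ^ 2 = D.γ ^ 2 * (D.w l ^ 2 / D.s l *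
        ((∑ i, plan D x l i j) - commonMarginal D (plan D x) j) ^ 2) := fun l j => by
      have := (h.s_pos l).ne'
      simp only [grad, constraintResidual]
      field_simp
    simp only [Finset.mul_sum, e]
    rw [Finset.sum_comm, Finset.sum_comm (γ := Fin m)]
    refine Finset.sum_le_sum fun j _ => ?_
    have := mul_le_mul_of_nonneg_left (h.sum_sq_commonMarginal_le (plan D x) j (q j))
      (sq_nonneg D.γ)
    simpa only [Finset.mul_sum, mul_assoc] using this
  have h2 : ∑ l, D.s l * ∑ j, (grad D x).2 l j ^ 2 ≤
      ∑ l, D.γ * L / 2 * (D.w l * (∑ i, ∑ j, |plan D (vStep D x) l i j - plan D x l i j|) ^ 2) := by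
    refine h0.trans (Finset.sum_le_sum fun l _ => ?_)
    have := sum_sq_sum_sub_le (fun j i => plan D (vStep D x) l i j) (fun j i => plan D x l i j)
    simp only [hq] at this
    rw [Finset.sum_comm] at this
    rw [← mul_assoc]
    exact mul_le_mul (h.coeff_le hL l) this
      (Finset.sum_nonneg fun _ _ => sq_nonneg _)
      (mul_nonneg (div_nonneg (mul_nonneg h.γ_pos.le hL0) zero_le_two) (h.w_pos l).le)
  rw [← Finset.mul_sum] at h2
  nlinarith

end Regular

/-! ### Boundedness and existence of dual solutions. -/

theorem log_sum_exp_le {ι : Type*} [Fintype ι] [Nonempty ι] {a b : ι → ℝ} {δ : ℝ}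
    (h : ∀ i, a i ≤ b i + δ) :
    Real.log (∑ i, Real.exp (a i)) ≤ Real.log (∑ i, Real.exp (b i)) + δ := by
  have hb : 0 < ∑ i, Real.exp (b i) :=
    Finset.sum_pos (fun i _ => Real.exp_pos _) Finset.univ_nonempty
  have ha : 0 < ∑ i, Real.exp (a i) :=
    Finset.sum_pos (fun i _ => Real.exp_pos _) Finset.univ_nonempty
  rw [Real.log_le_iff_le_exp ha, Real.exp_add, Real.exp_log hb, Finset.sum_mul]
  exact Finset.sum_le_sum fun i _ => by
    rw [← Real.exp_add]
    exact Real.exp_le_exp.2 (h i)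

theorem abs_le_norm_plans (C : Plans m N) (l : Fin m) (i j : Fin N) : |C l i j| ≤ ‖C‖ :=
  ((norm_le_pi_norm (C l i) j).trans (norm_le_pi_norm (C l) i)).trans (norm_le_pi_norm C l)

/-- The dual objective does not change if constants are added to the vectors `u_l` and `v_l`. -/
theorem Regular.dual_shift {D : RegData m N} (h : Regular D) (x : Dual m N) (α β : Fin m → ℝ)
    (hβ : ∑ l, D.w l * β l = 0) :
    dual D (fun l i => x.1 l i + α l, fun l j => x.2 l j + β l) = dual D x := by
  have e : ∀ l, D.w l * (Real.log (mass D (fun l i => x.1 l i + α l, fun l j => x.2 l j + β l) l) -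
      ∑ i, (x.1 l i + α l) * D.p l i) =
      D.w l * (Real.log (mass D x l) - ∑ i, x.1 l i * D.p l i) + D.w l * β l := fun l => by
    have h1 : mass D (fun l i => x.1 l i + α l, fun l j => x.2 l j + β l) l =
        mass D x l * Real.exp (α l + β l) := by
      simp only [mass, Finset.sum_mul]
      refine Finset.sum_congr rfl fun i _ => Finset.sum_congr rfl fun j _ => ?_
      simp only [scaling]
      rw [← Real.exp_add]
      congr 1
      ring
    have h2 : ∑ i, (x.1 l i + α l) * D.p l i = (∑ i, x.1 l i * D.p l i) + α l := by
      simp only [add_mul, Finset.sum_add_distrib, ← Finset.mul_sum, (h.p_mem l).2, mul_one]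
    rw [h1, h2, Real.log_mul (h.mass_pos x l).ne' (Real.exp_pos _).ne', Real.log_exp]
    ring
  simp only [dual]
  rw [Finset.sum_congr rfl fun l _ => e l, Finset.sum_add_distrib, hβ, add_zero]

theorem log_colSum_scaling {D : RegData m N} (h : Regular D) (x : Dual m N) (l : Fin m)
    (j : Fin N) : Real.log (∑ i, scaling D x l i j) =
      x.2 l j + Real.log (∑ i, Real.exp (x.1 l i - D.C l i j / D.γ)) := by
  have := h.nonempty_right
  have hb : 0 < ∑ i, Real.exp (x.1 l i - D.C l i j / D.γ) :=
    Finset.sum_pos (fun i _ => Real.exp_pos _) Finset.univ_nonempty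
  rw [← Real.log_exp (x.2 l j), ← Real.log_mul (Real.exp_pos _).ne' hb.ne', Finset.mul_sum]
  congr 1
  refine Finset.sum_congr rfl fun i _ => ?_
  rw [scaling, ← Real.exp_add]
  congr 1
  ring

theorem log_rowSum_scaling {D : RegData m N} (h : Regular D) (x : Dual m N) (l : Fin m)
    (i : Fin N) : Real.log (∑ j, scaling D x l i j) =
      x.1 l i + Real.log (∑ j, Real.exp (x.2 l j - D.C l i j / D.γ)) := by
  have := h.nonempty_right
  have hb : 0 < ∑ j, Real.exp (x.2 l j - D.C l i j / D.γ) :=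
    Finset.sum_pos (fun i _ => Real.exp_pos _) Finset.univ_nonempty
  rw [← Real.log_exp (x.1 l i), ← Real.log_mul (Real.exp_pos _).ne' hb.ne', Finset.mul_sum]
  congr 1
  refine Finset.sum_congr rfl fun j _ => ?_
  rw [scaling, ← Real.exp_add]
  congr 1
  ring

/-- Every dual point can be improved to one in a bounded set. -/
theorem Regular.exists_bounded {D : RegData m N} (h : Regular D) {b : ℝ}
    (hb : ∀ l i, -b ≤ Real.log (D.p l i)) {x : Dual m N} (hx : x ∈ dualFeasible D.toBaryData) :
    ∃ y ∈ dualFeasible D.toBaryData, dual D y ≤ dual D x ∧ ‖y‖ ≤ 4 * (‖D.C‖ / D.γ) + b := by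
  have := h.nonempty_right
  obtain ⟨i₀⟩ := h.nonempty_right
  have hb0 : 0 ≤ b := by
    obtain ⟨l⟩ := h.nonempty_left
    have hp : D.p l i₀ ≤ 1 := by
      rw [← (h.p_mem l).2]
      exact Finset.single_le_sum (fun i _ => (h.p_pos l i).le) (Finset.mem_univ i₀)
    have := hb l i₀
    have := Real.log_nonpos (h.p_pos l i₀).le hp
    linarith
  have hc0 : 0 ≤ ‖D.C‖ / D.γ := div_nonneg (norm_nonneg _) h.γ_pos.le
  set c := ‖D.C‖ / D.γ with hc
  have hC : ∀ l i j, |D.C l i j / D.γ| ≤ c := fun l i j => by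
    rw [abs_div, abs_of_pos h.γ_pos]
    exact div_le_div_of_nonneg_right (abs_le_norm_plans _ _ _ _) h.γ_pos.le
  have hCC : ∀ l i j i' j', D.C l i j / D.γ ≤ D.C l i' j' / D.γ + 2 * c := fun l i j i' j' => by
    have := (abs_le.1 (hC l i j)).2
    have := (abs_le.1 (hC l i' j')).1
    linarith
  -- One v-update followed by one u-update does not increase φ, and its output consists of
  -- log-sum-exp terms. Log-sum-exp is monotone and commutes with constants, so varying one index of
  -- the cost moves it by at most 2c, whatever x was.
  set y := vStep D x with hy
  set z := uStep D y with hz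
  have hyV : y ∈ dualFeasible D.toBaryData := h.vStep_mem x hx
  set S : Fin m → Fin N → ℝ := fun l j => Real.log (∑ i, Real.exp (x.1 l i - D.C l i j / D.γ))
    with hS
  have hS' : ∀ l j j', S l j ≤ S l j' + 2 * c := fun l j j' =>
    log_sum_exp_le fun i => by have := hCC l i j' i j; linarith
  have hyv : ∀ l j, y.2 l j = (∑ k, D.w k * S k j) - S l j := fun l j => by
    simp only [hy, vStep, log_colSum_scaling h, mul_add, Finset.sum_add_distrib]
    rw [hx j]
    ring
  have hT : ∀ j j', ∑ k, D.w k * S k j ≤ (∑ k, D.w k * S k j') + 2 * c := fun j j' => by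
    calc _ ≤ ∑ k, D.w k * (S k j' + 2 * c) := Finset.sum_le_sum fun k _ =>
          mul_le_mul_of_nonneg_left (hS' k j j') (h.w_pos k).le
      _ = _ := by
        simp only [mul_add, Finset.sum_add_distrib, ← Finset.sum_mul, h.w_sum, one_mul]
  have hyb : ∀ l j j', y.2 l j - y.2 l j' ≤ 4 * c := fun l j j' => by
    rw [hyv, hyv]
    have := hS' l j' j
    have := hT j j'
    linarith
  set U : Fin m → Fin N → ℝ := fun l i => Real.log (∑ j, Real.exp (y.2 l j - D.C l i j / D.γ))
  have hU : ∀ l i i', U l i ≤ U l i' + 2 * c := fun l i i' =>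
    log_sum_exp_le fun j => by have := hCC l i' j i j; linarith
  have hzu : ∀ l i, z.1 l i = Real.log (D.p l i) - U l i := fun l i => by
    simp only [hz, uStep, log_rowSum_scaling h]
    ring
  have hlog : ∀ l i, Real.log (D.p l i) ≤ 0 := fun l i => by
    refine Real.log_nonpos (h.p_pos l i).le ?_
    rw [← (h.p_mem l).2]
    exact Finset.single_le_sum (fun i _ => (h.p_pos l i).le) (Finset.mem_univ i)
  have hzb : ∀ l i i', z.1 l i - z.1 l i' ≤ 2 * c + b := fun l i i' => by
    rw [hzu, hzu]
    have := hU l i' i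
    have := hb l i'
    have := hlog l i
    linarith
  have h0 : ∑ l, D.w l * -z.2 l i₀ = 0 := by
    have := hyV i₀
    simp only [mul_neg, Finset.sum_neg_distrib, neg_eq_zero]
    exact this
  -- Small oscillation becomes a small sup norm after subtracting the entry at i₀. This leaves φ
  -- unchanged, and the shifts of v satisfy the weighted constraint because v itself does at the
  -- index i₀.
  refine ⟨(fun l i => z.1 l i + -z.1 l i₀, fun l j => z.2 l j + -z.2 l i₀), ?_, ?_, ?_⟩
  · intro j
    simp only [mul_add, Finset.sum_add_distrib]
    rw [h0, add_zero]
    exact hyV j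
  · rw [h.dual_shift z _ _ h0]
    exact (h.isMinOn_uStep hyV ⟨hyV, rfl⟩).trans (h.isMinOn_vStep hx ⟨hx, rfl⟩)
  · have hβ : 0 ≤ 4 * c + b := by positivity
    refine max_le ?_ ?_
    · refine (pi_norm_le_iff_of_nonneg hβ).2 fun l => (pi_norm_le_iff_of_nonneg hβ).2 fun i => ?_
      have h1 := hzb l i i₀
      have h2 := hzb l i₀ i
      exact abs_le.2 ⟨by linarith, by linarith⟩
    · refine (pi_norm_le_iff_of_nonneg hβ).2 fun l => (pi_norm_le_iff_of_nonneg hβ).2 fun i => ?_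
      have h1 := hyb l i i₀
      have h2 := hyb l i₀ i
      have h3 : ∀ j, z.2 l j = y.2 l j := fun _ => rfl
      simp only [h3]
      exact abs_le.2 ⟨by linarith, by linarith⟩

theorem isClosed_dualFeasible (D : BaryData m N) : IsClosed (dualFeasible D) := by
  simp only [dualFeasible, Set.ofPred_forall]
  exact isClosed_iInter fun j => isClosed_eq (by fun_prop) continuous_const

theorem Regular.continuous_dual {D : RegData m N} (h : Regular D) : Continuous (dual D) := by
  have hm : ∀ l, Continuous fun x => mass D x l := fun l => by
    unfold mass scaling
    fun_prop
  have hl : ∀ l, Continuous fun x => Real.log (mass D x l) := fun l =>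
    (hm l).log fun x => (h.mass_pos x l).ne'
  unfold dual
  fun_prop

/-- Every dual point is dominated by one in a fixed ball, so a minimizer over the compact feasible
part of that ball is a global one. -/
theorem Regular.exists_isDualSolution_norm_le {D : RegData m N} (h : Regular D) {b : ℝ}
    (hb : ∀ l i, -b ≤ Real.log (D.p l i)) :
    ∃ x, IsDualSolution D x ∧ ‖x‖ ≤ 4 * (‖D.C‖ / D.γ) + b := by
  set K := dualFeasible D.toBaryData ∩ Metric.closedBall 0 (4 * (‖D.C‖ / D.γ) + b) with hK
  have hmem : ∀ x ∈ dualFeasible D.toBaryData, ∃ y ∈ K, dual D y ≤ dual D x := fun x hx => by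
    obtain ⟨y, hy, h1, h2⟩ := h.exists_bounded hb hx
    exact ⟨y, ⟨hy, mem_closedBall_zero_iff.2 h2⟩, h1⟩
  have hcomp : IsCompact K := (isCompact_closedBall _ _).inter_left (isClosed_dualFeasible _)
  obtain ⟨y₀, hy₀, -⟩ := hmem 0 (zero_mem_dualFeasible _)
  obtain ⟨x, hx, hmin⟩ := hcomp.exists_isMinOn ⟨y₀, hy₀⟩ h.continuous_dual.continuousOn
  refine ⟨x, ⟨hx.1, fun z hz => ?_⟩, mem_closedBall_zero_iff.1 hx.2⟩
  obtain ⟨y, hy, hle⟩ := hmem z hz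
  exact (hmin hy).trans hle

theorem Regular.exists_isDualSolution {D : RegData m N} (h : Regular D) :
    ∃ x, IsDualSolution D x := by
  obtain ⟨b, hb⟩ := (Set.finite_range fun a : Fin m × Fin N => -Real.log (D.p a.1 a.2)).bddAbove
  obtain ⟨x, hx, -⟩ := h.exists_isDualSolution_norm_le (b := b) fun l i =>
    neg_le.1 (hb ⟨(l, i), rfl⟩)
  exact ⟨x, hx⟩

/-! ### Values and operation counts of programs -/

namespace Counted

variable {α β : Type} {n : ℕ}

@[simp] theorem val_bind (x : Counted α) (f : α → Counted β) : (x >>= f).val = (f x.val).val := rfl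
@[simp] theorem ops_bind (x : Counted α) (f : α → Counted β) :
    (x >>= f).ops = x.ops + (f x.val).ops := rfl
@[simp] theorem val_pure (x : α) : (pure x : Counted α).val = x := rfl
@[simp] theorem ops_pure (x : α) : (pure x : Counted α).ops = 0 := rfl
@[simp] theorem val_rd (x : ℝ) : (rd x).val = x := rfl
@[simp] theorem ops_rd (x : ℝ) : (rd x).ops = 0 := rfl
@[simp] theorem val_add (x y : Counted ℝ) : (x + y).val = x.val + y.val := rfl
@[simp] theorem ops_add (x y : Counted ℝ) : (x + y).ops = x.ops + y.ops + 1 := rfl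
@[simp] theorem val_sub (x y : Counted ℝ) : (x - y).val = x.val - y.val := rfl
@[simp] theorem ops_sub (x y : Counted ℝ) : (x - y).ops = x.ops + y.ops + 1 := rfl
@[simp] theorem val_mul (x y : Counted ℝ) : (x * y).val = x.val * y.val := rfl
@[simp] theorem ops_mul (x y : Counted ℝ) : (x * y).ops = x.ops + y.ops + 1 := rfl
@[simp] theorem val_div (x y : Counted ℝ) : (x / y).val = x.val / y.val := rfl
@[simp] theorem ops_div (x y : Counted ℝ) : (x / y).ops = x.ops + y.ops + 1 := rfl
@[simp] theorem ops_exp (x : Counted ℝ) : (exp x).ops = x.ops + 1 := rfl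
@[simp] theorem ops_log (x : Counted ℝ) : (log x).ops = x.ops + 1 := rfl
@[simp] theorem ops_sqrt (x : Counted ℝ) : (sqrt x).ops = x.ops + 1 := rfl
@[simp] theorem ops_min (x y : Counted ℝ) : (min x y).ops = x.ops + y.ops + 1 := rfl
@[simp] theorem val_le (x y : ℝ) : (le x y).val = decide (x ≤ y) := rfl
@[simp] theorem ops_le (x y : ℝ) : (le x y).ops = 1 := rfl
@[simp] theorem val_tab (f : Fin n → Counted α) : (tab f).val = fun i => (f i).val := rfl
@[simp] theorem ops_tab (f : Fin n → Counted α) : (tab f).ops = ∑ i, (f i).ops := rfl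
@[simp] theorem ops_sum (f : Fin n → Counted ℝ) : (sum f).ops = (∑ i, (f i).ops) + n := rfl
@[simp] theorem ops_maxAbs (f : Fin n → Counted ℝ) :
    (maxAbs f).ops = (∑ i, (f i).ops) + 2 * n := rfl

end Counted

open Counted

theorem scalingC_ops (D : RegData m N) (x : Dual m N) :
    (scalingC D x).ops = 4 * (m * N * N) := by
  simp [scalingC]
  ring

theorem massC_ops (B : Plans m N) : (massC B).ops = m * N * N + m * N := by
  simp [massC]
  ring

theorem planC_ops (D : RegData m N) (x : Dual m N) :
    (planC D x).ops = 6 * (m * N * N) + m * N := by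
  simp [planC, scalingC_ops, massC_ops]
  ring

theorem dualC_ops (D : RegData m N) (x : Dual m N) :
    (dualC D x).ops = 5 * (m * N * N) + 3 * (m * N) + 4 * m + 2 := by
  simp [dualC, scalingC_ops, massC_ops]
  ring

theorem primalC_ops (D : RegData m N) (π : Plans m N) :
    (primalC D π).ops = 6 * (m * N * N) + 2 * (m * N) + 4 * m := by
  simp [primalC]
  ring

theorem rowSumsC_ops (π : Plans m N) : (rowSumsC π).ops = m * N * N := by
  simp [rowSumsC]
  ring

theorem colSumsC_ops (π : Plans m N) : (colSumsC π).ops = m * N * N := by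
  simp [colSumsC]
  ring

theorem residualC_ops (D : RegData m N) (π : Plans m N) :
    (residualC D π).ops = 2 * (m * N * N) + 10 * (m * N) + 3 * m + N := by
  simp [residualC, rowSumsC_ops, colSumsC_ops]
  ring

theorem blockSqC_ops (s : Fin m → ℝ) (g : Blocks m N) :
    (blockSqC s g).ops = 2 * (m * N) + 2 * m := by
  simp [blockSqC]
  ring

theorem uStepC_ops (D : RegData m N) (x : Dual m N) :
    (uStepC D x).ops = 5 * (m * N * N) + 4 * (m * N) := by
  simp [uStepC, scalingC_ops, rowSumsC_ops]
  ring

theorem vStepC_ops (D : RegData m N) (x : Dual m N) :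
    (vStepC D x).ops = 5 * (m * N * N) + 6 * (m * N) := by
  simp [vStepC, scalingC_ops, colSumsC_ops]
  ring

theorem combineC_ops (a b : ℝ) (x y : Dual m N) : (combineC a b x y).ops = 6 * (m * N) := by
  simp [combineC]
  ring

/-! ### One pass of the inner loop -/

/-- The squared norm of a block of a dual point. -/
def blockSq (s : Fin m → ℝ) (g : Blocks m N) : ℝ := ∑ l, s l * ∑ i, g l i * g l i

/-- The trial value of `a_{k+1}`. -/
noncomputable def trialStep (S : State m N) (M : ℝ) : ℝ :=
  1 / (2 * M) + √(1 / (4 * (M * M)) + S.a * S.a * (S.L / M))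

/-- The trial value of `λ^k`. -/
noncomputable def trialPoint (S : State m N) (M : ℝ) : Dual m N :=
  (1 / (trialStep S M * M)) • S.ζ + (1 - 1 / (trialStep S M * M)) • S.η

open scoped Classical in
/-- The trial value of `η^{k+1}`. -/
noncomputable def trialDual (D : RegData m N) (x : Dual m N) : Dual m N :=
  if blockSq D.s (grad D x).2 ≤ blockSq D.s (grad D x).1 then uStep D x else vStep D x

/-- The state after a successful pass. -/
noncomputable def trialState (D : RegData m N) (S : State m N) (M : ℝ) : State m N where
  L := M
  a := trialStep S M
  η := trialDual D (trialPoint S M)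
  ζ := (1 : ℝ) • S.ζ + (0 - trialStep S M) • grad D (trialPoint S M)
  x := fun l i j => (trialStep S M * plan D (trialPoint S M) l i j +
    S.L * (S.a * S.a) * S.x l i j) / (M * (trialStep S M * trialStep S M))

open scoped Classical in
theorem pass_val (D : RegData m N) (S : State m N) (M : ℝ) :
    (pass D S M).val =
      if dual D (trialDual D (trialPoint S M)) ≤ dual D (trialPoint S M) -
        (blockSq D.s (grad D (trialPoint S M)).1 + blockSq D.s (grad D (trialPoint S M)).2) / (2 * M)
      then Sum.inr (trialState D S M) else Sum.inl (2 * M) := by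
  have ha : (rd 1 / (rd 2 * rd M) +
      sqrt (rd 1 / (rd 4 * (rd M * rd M)) + rd S.a * rd S.a * (rd S.L / rd M))).val =
      trialStep S M := rfl
  have hx : (rd 1 / (rd (trialStep S M) * rd M)).val • S.ζ +
      (rd 1 - rd (rd 1 / (rd (trialStep S M) * rd M)).val).val • S.η = trialPoint S M := rfl
  have hg : constraintResidual D (plan D (trialPoint S M)) = grad D (trialPoint S M) := rfl
  have hb : ∀ s (g : Blocks m N), (blockSqC s g).val = blockSq s g := fun _ _ => rfl
  simp only [pass, val_bind, ha, combineC_val, hx, planC_val, residualC_val, hb, val_le, hg]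
  unfold trialState trialDual
  by_cases h1 : blockSq D.s (grad D (trialPoint S M)).2 ≤ blockSq D.s (grad D (trialPoint S M)).1
  · simp only [h1, decide_true, if_true, val_bind, uStepC_val, combineC_val, dualC_val, val_le,
      decide_eq_true_eq, apply_ite val, val_sub, val_add, val_mul, val_div, val_rd, val_pure, val_tab]
  · simp only [h1, decide_false, if_false, val_bind, vStepC_val, combineC_val, dualC_val, val_le,
      decide_eq_true_eq, apply_ite val, val_sub, val_add, val_mul, val_div, val_rd, val_pure, val_tab,
      Bool.false_eq_true]

theorem pass_ops_le (D : RegData m N) (S : State m N) (M : ℝ) (hm : 1 ≤ m) (hN : 1 ≤ N) :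
    (pass D S M).ops ≤ 120 * (m * N * N) := by
  have h1 : m * N ≤ m * N * N := Nat.le_mul_of_pos_right _ hN
  have h2 : m ≤ m * N := Nat.le_mul_of_pos_right _ hN
  have h3 : N ≤ m * N := Nat.le_mul_of_pos_left _ hm
  simp only [pass, ops_bind, ops_rd, ops_add, ops_sub, ops_mul, ops_div, ops_sqrt, combineC_ops,
    planC_ops, residualC_ops, blockSqC_ops, ops_le, apply_ite ops, uStepC_ops, vStepC_ops,
    dualC_ops, ops_pure, ops_tab, Finset.sum_const, Finset.card_univ, Fintype.card_fin, smul_eq_mul]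
  split_ifs <;> linarith

/-! ### Loops -/

theorem LoopsTo.of_invariant {σ ο : Type} {body : σ → Counted (σ ⊕ ο)} (inv : σ → Prop)
    (post : ο → Prop) (hnext : ∀ x y, inv x → (body x).val = Sum.inl y → inv y)
    (hdone : ∀ x o, inv x → (body x).val = Sum.inr o → post o) {x : σ} {o : ο} {n : ℕ}
    (h : LoopsTo body x o n) (hx : inv x) : post o := by
  induction h with
  | done hb => exact hdone _ _ hx (by rw [hb])
  | next hb _ ih => exact ih (hnext _ _ hx (by rw [hb]))

/-- A nonnegative potential that drops by one in each unfinished pass allows at most P x such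
passes; the extra 1 pays for the final pass. -/
theorem exists_loopsTo {σ ο : Type} {body : σ → Counted (σ ⊕ ο)} (inv : σ → Prop) (P : σ → ℝ)
    (c : ℕ) (hops : ∀ x, inv x → (body x).ops ≤ c) (hP : ∀ x, inv x → 0 ≤ P x)
    (hnext : ∀ x y, inv x → (body x).val = Sum.inl y → inv y ∧ P y ≤ P x - 1) (x : σ) (hx : inv x) :
    ∃ o n, LoopsTo body x o n ∧ (n : ℝ) ≤ c * (P x + 1) := by
  obtain ⟨k, hk⟩ := exists_nat_gt (P x)
  induction k generalizing x with
  | zero => exact absurd hk (by simpa using hP x hx)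
  | succ k ih =>
    have hc : ((body x).ops : ℝ) ≤ c := by exact_mod_cast hops x hx
    rcases hb : (body x).val with y | o
    · obtain ⟨hy, hPy⟩ := hnext x y hx hb
      push_cast at hk
      obtain ⟨o, n, hl, hn⟩ := ih y hy (by linarith)
      refine ⟨o, (body x).ops + n, LoopsTo.next (by rw [← hb]) hl, ?_⟩
      push_cast
      nlinarith [(Nat.cast_nonneg c : (0 : ℝ) ≤ c)]
    · refine ⟨o, (body x).ops, LoopsTo.done (by rw [← hb]), ?_⟩
      nlinarith [(Nat.cast_nonneg c : (0 : ℝ) ≤ c), hP x hx]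

/-! ### The invariant of the method -/

/-- The sum `A_k = L_k a_k²` of the step sizes. -/
def State.A (S : State m N) : ℝ := S.L * (S.a * S.a)

/-- Jensen for t ln t with the denominator cleared. Only the sum of the weights must be positive,
which covers the first iteration, where the old weight A is zero. -/
theorem mul_log_comb_le {a b s t : ℝ} (ha : 0 ≤ a) (hb : 0 ≤ b) (hab : 0 < a + b) (hs : 0 ≤ s)
    (ht : 0 ≤ t) : (a * s + b * t) * Real.log ((a * s + b * t) / (a + b)) ≤
      a * (s * Real.log s) + b * (t * Real.log t) := by
  have h := Real.convexOn_mul_log.2 (Set.mem_Ici.2 hs) (Set.mem_Ici.2 ht)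
    (div_nonneg ha hab.le) (div_nonneg hb hab.le) (by field_simp)
  simp only [smul_eq_mul] at h
  have e : a / (a + b) * s + b / (a + b) * t = (a * s + b * t) / (a + b) := by ring
  rw [e] at h
  have h := mul_le_mul_of_nonneg_left h hab.le
  have e1 : (a + b) * ((a * s + b * t) / (a + b) * Real.log ((a * s + b * t) / (a + b))) =
      (a * s + b * t) * Real.log ((a * s + b * t) / (a + b)) := by field_simp
  have e2 : (a + b) * (a / (a + b) * (s * Real.log s) + b / (a + b) * (t * Real.log t)) =
      a * (s * Real.log s) + b * (t * Real.log t) := by field_simp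
  linarith

theorem Regular.primal_comb_le {D : RegData m N} (h : Regular D) {a b : ℝ} (ha : 0 ≤ a) (hb : 0 ≤ b)
    (hab : 0 < a + b) {π ρ : Plans m N} (hπ : ∀ l i j, 0 ≤ π l i j) (hρ : ∀ l i j, 0 ≤ ρ l i j) :
    (a + b) * primal D (fun l i j => (a * π l i j + b * ρ l i j) / (a + b)) ≤
      a * primal D π + b * primal D ρ := by
  simp only [primal, Finset.mul_sum]
  rw [← Finset.sum_add_distrib]
  simp only [← Finset.sum_add_distrib, Finset.mul_sum]
  refine Finset.sum_le_sum fun l _ => Finset.sum_le_sum fun i _ => Finset.sum_le_sum fun j _ => ?_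
  have h1 := mul_le_mul_of_nonneg_left (mul_log_comb_le ha hb hab (hπ l i j) (hρ l i j))
    (mul_nonneg (h.w_pos l).le h.γ_pos.le)
  have e : (a + b) * ((a * π l i j + b * ρ l i j) / (a + b)) = a * π l i j + b * ρ l i j := by
    field_simp
  set X := (a * π l i j + b * ρ l i j) / (a + b)
  have e2 : (a + b) * (D.w l * (D.C l i j * X + D.γ * (X * (Real.log X - 1)))) =
      D.w l * (D.C l i j * (a * π l i j + b * ρ l i j) + D.γ * ((a * π l i j + b * ρ l i j) *
        (Real.log X - 1))) := by
    rw [← e]; ring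
  rw [e2]
  linarith

theorem constraintResidual_comb {D : RegData m N} {a b : ℝ} (hab : a + b ≠ 0) (π ρ : Plans m N) :
    (a + b) • constraintResidual D (fun l i j => (a * π l i j + b * ρ l i j) / (a + b)) =
      a • constraintResidual D π + b • constraintResidual D ρ := by
  have hr : ∀ f g : Fin N → ℝ, (a + b) * ∑ j, (a * f j + b * g j) / (a + b) =
      a * ∑ j, f j + b * ∑ j, g j := fun f g => by
    rw [← Finset.sum_div, mul_div_cancel₀ _ hab, Finset.sum_add_distrib, Finset.mul_sum,
      Finset.mul_sum]
  have hc : ∀ j, (a + b) * commonMarginal D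
      (fun l i j => (a * π l i j + b * ρ l i j) / (a + b)) j =
      a * commonMarginal D π j + b * commonMarginal D ρ j := fun j => by
    simp only [commonMarginal, mul_div_assoc']
    rw [← add_div]
    congr 1
    simp only [Finset.mul_sum (Finset.univ : Finset (Fin m)), ← Finset.sum_add_distrib]
    refine Finset.sum_congr rfl fun l _ => ?_
    rw [mul_left_comm, hr]
    ring
  ext l i
  · simp only [constraintResidual, Prod.smul_fst, Prod.fst_add, Pi.smul_apply, Pi.add_apply,
      smul_eq_mul]
    linear_combination D.γ * (D.w l / D.s l) * hr (π l i) (ρ l i)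
  · simp only [constraintResidual, Prod.smul_snd, Prod.snd_add, Pi.smul_apply, Pi.add_apply,
      smul_eq_mul]
    linear_combination D.γ * (D.w l / D.s l) * (hr (fun j => π l j i) (fun j => ρ l j i) - hc i)

theorem dualInner_self_eq (s : Fin m → ℝ) (g : Dual m N) :
    dualInner s g g = blockSq s g.1 + blockSq s g.2 := by
  simp only [dualInner, blockSq, mul_add, Finset.sum_add_distrib]

/-- The invariant of the accelerated method. -/
structure Good (D : RegData m N) (S : State m N) : Prop where
  L_pos : 0 < S.L
  a_nonneg : 0 ≤ S.a
  η_mem : S.η ∈ dualFeasible D.toBaryData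
  ζ_mem : S.ζ ∈ dualFeasible D.toBaryData
  x_nonneg : ∀ l i j, 0 ≤ S.x l i j
  -- The initial x̂ is the zero array, not a plan, so positivity and unit mass are claimed only
  -- after a step, when a > 0.
  x_pos : 0 < S.a → ∀ l i j, 0 < S.x l i j
  x_sum : 0 < S.a → ∀ l, ∑ i, ∑ j, S.x l i j = 1
  ζ_eq : S.ζ = (-S.A) • constraintResidual D S.x
  -- This is the estimate-sequence inequality: the quadratic term is kept because it controls the
  -- residual through the formula for ζ.
  estimate : S.A * (dual D S.η + primal D S.x) + dualInner D.s S.ζ S.ζ / 2 ≤ 0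

namespace Good

variable {D : RegData m N} {S : State m N} {M : ℝ}

theorem initial (D : RegData m N) {L₀ : ℝ} (hL : 0 < L₀) : Good D (initial m N L₀) where
  L_pos := hL
  a_nonneg := le_rfl
  η_mem := zero_mem_dualFeasible _
  ζ_mem := zero_mem_dualFeasible _
  x_nonneg _ _ _ := le_rfl
  x_pos h := absurd h (lt_irrefl _)
  x_sum h := absurd h (lt_irrefl _)
  ζ_eq := by simp [WBary.initial, State.A]
  estimate := by simp [WBary.initial, State.A, dualInner]

theorem A_nonneg (hS : Good D S) : 0 ≤ S.A := mul_nonneg hS.L_pos.le (mul_self_nonneg _)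

theorem trialStep_ge (S : State m N) (M : ℝ) : 1 / (2 * M) ≤ trialStep S M :=
  le_add_of_nonneg_right (Real.sqrt_nonneg _)

theorem trialStep_pos (hM : 0 < M) : 0 < trialStep S M :=
  lt_of_lt_of_le (by positivity) (trialStep_ge S M)

/-- The trial step is the positive root of M a² = a + A, so the accumulated weight grows by exactly
a. -/
theorem trialStep_eq (hS : Good D S) (hM : 0 < M) :
    M * (trialStep S M * trialStep S M) = trialStep S M + S.A := by
  have h0 : 0 ≤ 1 / (4 * (M * M)) + S.a * S.a * (S.L / M) :=
    add_nonneg (by positivity) (mul_nonneg (mul_self_nonneg _) (div_nonneg hS.L_pos.le hM.le))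
  have h1 := Real.mul_self_sqrt h0
  rw [State.A, trialStep]
  set q := √(1 / (4 * (M * M)) + S.a * S.a * (S.L / M))
  have e : M * ((1 / (2 * M) + q) * (1 / (2 * M) + q)) = 1 / (4 * M) + q + M * (q * q) := by
    field_simp
    ring
  rw [e, h1]
  field_simp
  ring

theorem trialPoint_mem (hS : Good D S) : trialPoint S M ∈ dualFeasible D.toBaryData :=
  add_smul_mem_dualFeasible _ _ hS.ζ_mem hS.η_mem

theorem trialDual_mem (h : Regular D) {x : Dual m N} (hx : x ∈ dualFeasible D.toBaryData) :
    trialDual D x ∈ dualFeasible D.toBaryData := by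
  unfold trialDual
  split_ifs
  · exact Regular.uStep_mem x hx
  · exact h.vStep_mem x hx

/-- A pass succeeds if the trial value is large enough. -/
theorem dual_trialDual_le (h : Regular D) {L : ℝ} (hL : ∀ l, 2 * D.γ * (D.w l / D.s l) ≤ L)
    (hM : 2 * L ≤ M) {x : Dual m N} (hx : x ∈ dualFeasible D.toBaryData) :
    dual D (trialDual D x) ≤ dual D x -
      (blockSq D.s (grad D x).1 + blockSq D.s (grad D x).2) / (2 * M) := by
  have hL0 : 0 < L := by
    obtain ⟨l⟩ := h.nonempty_left
    have := mul_pos (mul_pos two_pos h.γ_pos) (div_pos (h.w_pos l) (h.s_pos l))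
    exact this.trans_le (hL l)
  have h1 := h.dual_uStep_add_le hL hx
  have h2 := h.dual_vStep_add_le hL hx
  simp only [sq] at h1 h2
  change blockSq D.s (grad D x).1 ≤ _ at h1
  change blockSq D.s (grad D x).2 ≤ _ at h2
  have hn1 : 0 ≤ blockSq D.s (grad D x).1 := Finset.sum_nonneg fun l _ => mul_nonneg (h.s_pos l).le
    (Finset.sum_nonneg fun _ _ => mul_self_nonneg _)
  have hn2 : 0 ≤ blockSq D.s (grad D x).2 := Finset.sum_nonneg fun l _ => mul_nonneg (h.s_pos l).le
    (Finset.sum_nonneg fun _ _ => mul_self_nonneg _)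
  -- The larger block has at least half of the squared gradient norm, so its update yields ‖g‖² ≤ 4L
  -- times the decrease; this meets the test because 2L ≤ M.
  have key : ∀ y, blockSq D.s (grad D x).1 + blockSq D.s (grad D x).2 ≤
      2 * (2 * L * (dual D x - dual D y)) → dual D y ≤ dual D x -
      (blockSq D.s (grad D x).1 + blockSq D.s (grad D x).2) / (2 * M) := fun y hy => by
    have h3 : 0 ≤ dual D x - dual D y := by
      by_contra hneg
      push Not at hneg
      nlinarith
    rw [le_sub_comm, div_le_iff₀ (by linarith)]
    nlinarith
  unfold trialDual
  split_ifs with hc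
  · exact key _ (by linarith)
  · exact key _ (by linarith)

/-- Add convexity of f, the accepted decrease of φ, and the expansion of ‖ζ - a g‖². The terms
a²‖g‖²/2 cancel because M a² = a + A, and the choice of λ reduces the linear terms to A⟨g, η - λ⟩,
which the gradient inequality at η absorbs. -/
theorem trialState_good (h : Regular D) (hS : Good D S) (hM : 0 < M)
    (hsucc : dual D (trialDual D (trialPoint S M)) ≤ dual D (trialPoint S M) -
      (blockSq D.s (grad D (trialPoint S M)).1 + blockSq D.s (grad D (trialPoint S M)).2) /
        (2 * M)) : Good D (trialState D S M) := by
  have ha := trialStep_pos (S := S) hM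
  have hA := hS.A_nonneg
  have heq := hS.trialStep_eq hM
  have hxV := hS.trialPoint_mem (M := M)
  set a := trialStep S M with ha_def
  set x := trialPoint S M with hx_def
  set g := grad D x with hg_def
  have hpos : 0 < a + S.A := by linarith
  have hA' : (trialState D S M).A = a + S.A := heq
  have hx' : (trialState D S M).x =
      fun l i j => (a * plan D x l i j + S.A * S.x l i j) / (a + S.A) := by
    simp only [trialState, ← ha_def, heq, State.A]
    rfl
  have hζ' : (trialState D S M).ζ = (1 : ℝ) • S.ζ + (-a) • g := by
    simp only [trialState, zero_sub]
    rfl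
  have hnum : ∀ l i j, 0 < a * plan D x l i j + S.A * S.x l i j := fun l i j =>
    add_pos_of_pos_of_nonneg (mul_pos ha (h.plan_pos x l i j)) (mul_nonneg hA (hS.x_nonneg l i j))
  have hxpos : ∀ l i j, 0 < (trialState D S M).x l i j := fun l i j => by
    rw [hx']; exact div_pos (hnum l i j) hpos
  refine ⟨hM, ha.le, trialDual_mem h hxV, ?_, fun l i j => (hxpos l i j).le, fun _ => hxpos, ?_, ?_, ?_⟩
  · rw [hζ']
    exact add_smul_mem_dualFeasible _ _ hS.ζ_mem (h.constraintResidual_mem _)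
  · intro _ l
    have : S.A * ∑ i, ∑ j, S.x l i j = S.A := by
      rcases hS.a_nonneg.eq_or_lt with h0 | h0
      · simp [State.A, ← h0]
      · rw [hS.x_sum h0, mul_one]
    simp only [hx', ← Finset.sum_div, Finset.sum_add_distrib, ← Finset.mul_sum, h.sum_plan, this,
      mul_one]
    exact div_self hpos.ne'
  · rw [hζ', hA', hx', neg_smul (a + S.A), constraintResidual_comb hpos.ne', hS.ζ_eq, hg_def, grad]
    module
  · have hf : (a + S.A) * primal D (trialState D S M).x ≤ a * primal D (plan D x) +
        S.A * primal D S.x := by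
      rw [hx']
      exact h.primal_comb_le ha.le hA hpos (fun l i j => (h.plan_pos x l i j).le) hS.x_nonneg
    have hφ : (a + S.A) * dual D (trialState D S M).η ≤ (a + S.A) * dual D x -
        a * a * dualInner D.s g g / 2 := by
      have e : (a + S.A) * (dualInner D.s g g / (2 * M)) = a * a * dualInner D.s g g / 2 := by
        rw [← heq]
        field_simp
      rw [← e, ← mul_sub, dualInner_self_eq]
      exact mul_le_mul_of_nonneg_left hsucc hpos.le
    have hζζ : dualInner D.s (trialState D S M).ζ (trialState D S M).ζ = dualInner D.s S.ζ S.ζ -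
        2 * a * dualInner D.s g S.ζ + a * a * dualInner D.s g g := by
      rw [hζ', dualInner_comb, dualInner_comb_right, dualInner_comb_right, dualInner_comm D.s S.ζ g]
      ring
    have hfx := h.primal_plan hxV
    -- With τ = 1/(aM), multiplying by a + A = M a² turns the convex combination defining λ into aζ
    -- + Aη.
    have hlin : (a + S.A) * dualInner D.s g x = a * dualInner D.s g S.ζ +
        S.A * dualInner D.s g S.η := by
      rw [hx_def, trialPoint, dualInner_comb_right, ← ha_def]
      have hτ : (a + S.A) * (1 / (a * M)) = a := by
        rw [← heq]; field_simp
      have hτ' : (a + S.A) * (1 - 1 / (a * M)) = S.A := by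
        rw [mul_sub, hτ]; ring
      linear_combination dualInner D.s g S.ζ * hτ + dualInner D.s g S.η * hτ'
    have hgrad := mul_le_mul_of_nonneg_left (h.dual_add_inner_grad_le hxV hS.η_mem) hA
    rw [dualInner_sub_right] at hgrad
    have := hS.estimate
    rw [hA', hζζ]
    have e1 : a * primal D (plan D x) = a * dualInner D.s g x - a * dual D x := by
      rw [hg_def, ← hfx]; ring
    rw [← hg_def] at hgrad
    linarith

/-- Completing the square in M a² - a = A gives (√M a - 1/(2√M))² = A + 1/(4M), and √M a is the new
√A. -/
theorem sqrt_A_add_le (hS : Good D S) (hM : 0 < M) :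
    √S.A + 1 / (2 * √M) ≤ √(trialState D S M).A := by
  have ha := trialStep_pos (S := S) hM
  have heq := hS.trialStep_eq hM
  have hA' : (trialState D S M).A = M * (trialStep S M * trialStep S M) := rfl
  have hsM := Real.sqrt_pos.2 hM
  have hMM := Real.mul_self_sqrt hM.le
  rw [hA', Real.sqrt_mul hM.le, Real.sqrt_mul_self ha.le, ← le_sub_iff_add_le]
  have hge := trialStep_ge S M
  set a := trialStep S M
  refine Real.sqrt_le_iff.2 ⟨?_, ?_⟩
  · have := mul_le_mul_of_nonneg_left hge hsM.le
    have e : √M * (1 / (2 * M)) = 1 / (2 * √M) := by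
      rw [← hMM]; field_simp; simp
    linarith
  · have e : (√M * a - 1 / (2 * √M)) ^ 2 = √M * √M * (a * a) - a + 1 / (4 * (√M * √M)) := by
      field_simp
      ring
    rw [e, hMM, heq]
    have : 0 < 1 / (4 * M) := by positivity
    linarith

end Good

section

variable {D : RegData m N} {S : State m N} {M L : ℝ}

theorem pass_inl (h : Regular D) (hS : Good D S) (hL : ∀ l, 2 * D.γ * (D.w l / D.s l) ≤ L)
    {y : ℝ} (hy : (pass D S M).val = Sum.inl y) : y = 2 * M ∧ M < 2 * L := by
  classical
  rw [pass_val] at hy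
  split_ifs at hy with hc
  refine ⟨(Sum.inl.inj hy).symm, ?_⟩
  by_contra hM
  exact hc (Good.dual_trialDual_le h hL (not_lt.1 hM) hS.trialPoint_mem)

theorem pass_inr (h : Regular D) (hS : Good D S) (hM : 0 < M)
    {S' : State m N} (hy : (pass D S M).val = Sum.inr S') :
    Good D S' ∧ 0 < S'.a ∧ S'.L = M ∧ √S.A + 1 / (2 * √M) ≤ √S'.A := by
  classical
  rw [pass_val] at hy
  split_ifs at hy with hc
  rw [← Sum.inr.inj hy]
  exact ⟨hS.trialState_good h hM hc, Good.trialStep_pos hM, rfl, hS.sqrt_A_add_le hM⟩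

/-- The Lipschitz constant `L_φ` of the gradient. -/
noncomputable def smoothness (D : RegData m N) : ℝ := 2 * D.γ * ‖fun l => D.w l / D.s l‖

theorem Regular.le_smoothness (h : Regular D) (l : Fin m) :
    2 * D.γ * (D.w l / D.s l) ≤ smoothness D :=
  mul_le_mul_of_nonneg_left ((le_abs_self _).trans (norm_le_pi_norm (fun l => D.w l / D.s l) l))
    (mul_nonneg zero_le_two h.γ_pos.le)

theorem Regular.pos_of_le (h : Regular D) (hL : ∀ l, 2 * D.γ * (D.w l / D.s l) ≤ L) : 0 < L := by
  obtain ⟨l⟩ := h.nonempty_left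
  have := mul_pos (mul_pos two_pos h.γ_pos) (div_pos (h.w_pos l) (h.s_pos l))
  exact this.trans_le (hL l)

/-- A failed trial has M < 2L, so even the doubled value has log₂(M/L) below 2; doubling moves it
one unit towards 2. -/
theorem abs_logb_double_le (hM : 0 < M) (hL : 0 < L) (h : M < 2 * L) :
    |Real.logb 2 (2 * M / L) - 2| ≤ |Real.logb 2 (M / L) - 2| - 1 := by
  have h1 : Real.logb 2 (2 * M / L) = 1 + Real.logb 2 (M / L) := by
    rw [mul_div_assoc, Real.logb_mul two_ne_zero (by positivity), Real.logb_self_eq_one one_lt_two]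
  have h2 : Real.logb 2 (M / L) < 1 := by
    rw [Real.logb_lt_iff_lt_rpow one_lt_two (by positivity), Real.rpow_one, div_lt_iff₀ hL]
    exact h
  rw [h1, abs_of_neg (by linarith), abs_of_neg (by linarith)]
  linarith

/-! ### Runs -/

theorem exists_next (h : Regular D) (hS : Good D S) :
    ∃ S' n, LoopsTo (pass D S) (S.L / 2) S' n ∧ Good D S' := by
  have hl := h.pos_of_le h.le_smoothness
  obtain ⟨l⟩ := h.nonempty_left
  obtain ⟨i⟩ := h.nonempty_right
  obtain ⟨S', n, hn, -⟩ := exists_loopsTo (body := pass D S) (fun M => 0 < M)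
    (fun M => |Real.logb 2 (M / smoothness D) - 2|) _
    (fun M _ => pass_ops_le D S M (Fin.pos l) (Fin.pos i)) (fun _ _ => abs_nonneg _)
    (fun M y hM hy => by
      obtain ⟨rfl, hlt⟩ := pass_inl h hS h.le_smoothness hy
      exact ⟨by positivity, abs_logb_double_le hM hl hlt⟩) (S.L / 2) (half_pos hS.L_pos)
  exact ⟨S', n, hn, hn.of_invariant (fun M => 0 < M) (Good D)
    (fun M y hM hy => by
      obtain ⟨rfl, hlt⟩ := pass_inl h hS h.le_smoothness hy
      positivity) (fun M S' hM hy => (pass_inr h hS hM hy).1) (half_pos hS.L_pos)⟩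

theorem exists_isRun (h : Regular D) {L₀ : ℝ} (hL₀ : 0 < L₀) : ∃ S, IsRun D L₀ S := by
  have hn : ∀ S : {S // Good D S}, ∃ S' : {S // Good D S}, ∃ n,
      LoopsTo (pass D S.1) (S.1.L / 2) S'.1 n := fun S => by
    obtain ⟨S', n, hl, hg⟩ := exists_next h S.2
    exact ⟨⟨S', hg⟩, n, hl⟩
  choose f hf using hn
  refine ⟨fun k => (f^[k] ⟨_, Good.initial D hL₀⟩).1, rfl, fun k => ?_⟩
  simp only [Function.iterate_succ_apply']
  exact hf _

/-- Trial values never exceed 4L: they start at half of L_k ≤ 8L, and only values below 2L are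
doubled. So each iteration adds at least 1/(2√(4L)) = 1/(4√L) to √A. -/
theorem IsRun.bounds (h : Regular D) (hL : ∀ l, 2 * D.γ * (D.w l / D.s l) ≤ L) {L₀ : ℝ}
    (hL₀ : 0 < L₀) (hL₀L : L₀ ≤ 8 * L) {S : ℕ → State m N} (hS : IsRun D L₀ S) (k : ℕ) :
    Good D (S k) ∧ (S k).L ≤ 8 * L ∧ k / (4 * √L) ≤ √(S k).A ∧ (1 ≤ k → 0 < (S k).a) := by
  have hl := h.pos_of_le hL
  induction k with
  | zero => simpa [hS.1] using ⟨Good.initial D hL₀, hL₀L⟩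
  | succ k ih =>
    obtain ⟨hg, hk8, hkA, -⟩ := ih
    obtain ⟨n, hn⟩ := hS.2 k
    refine hn.of_invariant (fun M => 0 < M ∧ M ≤ 4 * L) (fun S' => Good D S' ∧ S'.L ≤ 8 * L ∧
      ((k + 1 : ℕ) : ℝ) / (4 * √L) ≤ √S'.A ∧ (1 ≤ k + 1 → 0 < S'.a)) (fun M y hM hy => ?_)
      (fun M S' hM hy => ?_) ⟨half_pos hg.L_pos, by linarith⟩
    · obtain ⟨rfl, hlt⟩ := pass_inl h hg hL hy
      exact ⟨by linarith, by linarith⟩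
    · obtain ⟨h1, h2, h3, h4⟩ := pass_inr h hg hM.1 hy
      refine ⟨h1, by linarith, le_trans ?_ h4, fun _ => h2⟩
      have hsM : √M ≤ 2 * √L := by
        calc √M ≤ √(4 * L) := Real.sqrt_le_sqrt hM.2
          _ = 2 * √L := by
            rw [Real.sqrt_mul (by norm_num), show (4 : ℝ) = 2 ^ 2 by norm_num,
              Real.sqrt_sq zero_le_two]
      have : 1 / (4 * √L) ≤ 1 / (2 * √M) :=
        one_div_le_one_div_of_le (mul_pos two_pos (Real.sqrt_pos.2 hM.1)) (by linarith)
      push_cast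
      rw [add_div]
      linarith

/-! ### The primal-dual guarantees -/

theorem blockSq_eq_zero {s : Fin m → ℝ} (hs : ∀ l, 0 < s l) {g : Blocks m N}
    (hg : blockSq s g ≤ 0) (l : Fin m) (i : Fin N) : g l i = 0 := by
  have h1 : ∀ l ∈ Finset.univ, 0 ≤ s l * ∑ i, g l i * g l i := fun l _ =>
    mul_nonneg (hs l).le (Finset.sum_nonneg fun _ _ => mul_self_nonneg _)
  have h2 := (Finset.sum_eq_zero_iff_of_nonneg h1).1 (le_antisymm hg (Finset.sum_nonneg h1)) l
    (Finset.mem_univ l)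
  have h3 := (mul_eq_zero.1 h2).resolve_left (hs l).ne'
  exact mul_self_eq_zero.1 ((Finset.sum_eq_zero_iff_of_nonneg fun _ _ => mul_self_nonneg _).1 h3 i
    (Finset.mem_univ i))

/-- At a minimizer neither block update can decrease φ, so the sufficient-decrease bounds force both
gradient blocks to vanish. -/
theorem IsDualSolution.grad_eq_zero (h : Regular D) {x : Dual m N} (hx : IsDualSolution D x) :
    grad D x = 0 := by
  have hl := h.pos_of_le h.le_smoothness
  have h1 := h.dual_uStep_add_le h.le_smoothness hx.1
  have h2 := h.dual_vStep_add_le h.le_smoothness hx.1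
  have h3 : dual D x ≤ dual D (uStep D x) := hx.2 (Regular.uStep_mem x hx.1)
  have h4 : dual D x ≤ dual D (vStep D x) := hx.2 (h.vStep_mem x hx.1)
  simp only [sq] at h1 h2
  ext l i
  · exact blockSq_eq_zero h.s_pos (h1.trans (by nlinarith)) l i
  · exact blockSq_eq_zero h.s_pos (h2.trans (by nlinarith)) l i

theorem Regular.constraintResidual_eq_zero (h : Regular D) {π : Plans m N}
    (hπ : π ∈ primalFeasible D.toBaryData) : constraintResidual D π = 0 := by
  obtain ⟨q, -, hq⟩ := hπ
  ext l i
  · simp [constraintResidual, (hq l).2.1 i]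
  · simp [constraintResidual, (hq l).2.2 i, h.commonMarginal_eq fun l j => (hq l).2.2 j]

theorem Regular.plan_mem_primalFeasible (h : Regular D) {x : Dual m N} (hx : grad D x = 0) :
    plan D x ∈ primalFeasible D.toBaryData := by
  have hc : ∀ l, D.γ * (D.w l / D.s l) ≠ 0 := fun l =>
    (mul_pos h.γ_pos (div_pos (h.w_pos l) (h.s_pos l))).ne'
  have hr : ∀ l i, ∑ j, plan D x l i j = D.p l i := fun l i => by
    have : (grad D x).1 l i = 0 := by rw [hx]; rfl
    exact sub_eq_zero.1 ((mul_eq_zero.1 this).resolve_left (hc l))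
  have hcol : ∀ l j, ∑ i, plan D x l i j = commonMarginal D (plan D x) j := fun l i => by
    have : (grad D x).2 l i = 0 := by rw [hx]; rfl
    exact sub_eq_zero.1 ((mul_eq_zero.1 this).resolve_left (hc l))
  obtain ⟨l⟩ := h.nonempty_left
  refine ⟨commonMarginal D (plan D x), ⟨fun j => ?_, ?_⟩, fun l =>
    ⟨fun i j => (h.plan_pos x l i j).le, hr l, hcol l⟩⟩
  · rw [← hcol l]
    exact Finset.sum_nonneg fun i _ => (h.plan_pos x l i j).le
  · rw [← h.sum_plan x l, Finset.sum_comm]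
    exact Finset.sum_congr rfl fun j _ => (hcol l j).symm

theorem sum_of_mem_couplings {p q : Fin N → ℝ} {π : Fin N → Fin N → ℝ} (hp : p ∈ stdSimplex ℝ (Fin N))
    (hπ : π ∈ couplings p q) : ∑ i, ∑ j, π i j = 1 := by
  simp only [hπ.2.1, hp.2]

theorem dualInner_zero_left (s : Fin m → ℝ) (x : Dual m N) : dualInner s 0 x = 0 := by
  rw [dualInner_comm, dualInner_zero_right]

/-- The solution of the regularized problem is unique. -/
theorem eq_plan_of_isMinOn (h : Regular D) {x : Dual m N} (hx : IsDualSolution D x) {π : Plans m N}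
    (hπ : π ∈ primalFeasible D.toBaryData)
    (hmin : IsMinOn (primal D) (primalFeasible D.toBaryData) π) : π = plan D x := by
  have hg := hx.grad_eq_zero h
  have h1 := h.primal_plan hx.1
  rw [hg, dualInner_zero_left] at h1
  have h2 : primal D π ≤ primal D (plan D x) := hmin (h.plan_mem_primalFeasible hg)
  have hres := h.constraintResidual_eq_zero hπ
  obtain ⟨q, -, hq⟩ := hπ
  -- The residual of π is zero and strong duality holds at x(x), so the squared distance is bounded
  -- by f(π) - f(x(x)) ≤ 0.
  have h3 := h.inner_add_le (fun l => (hq l).1) (fun l => sum_of_mem_couplings (h.p_mem l) (hq l))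
    hx.1
  rw [hres, dualInner_zero_left] at h3
  have h4 : ∑ l, D.w l * (∑ i, ∑ j, |π l i j - plan D x l i j|) ^ 2 ≤ 0 := by
    have := h.γ_pos
    nlinarith
  have h5 := (Finset.sum_eq_zero_iff_of_nonneg fun l _ =>
    mul_nonneg (h.w_pos l).le (sq_nonneg (∑ i, ∑ j, |π l i j - plan D x l i j|))).1
    (le_antisymm h4 (h.sum_w_sq_nonneg _))
  funext l i j
  have h6 := pow_eq_zero_iff two_ne_zero |>.1 ((mul_eq_zero.1 (h5 l (Finset.mem_univ l))).resolve_left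
    (h.w_pos l).ne')
  have h7 := (Finset.sum_eq_zero_iff_of_nonneg fun i _ =>
    Finset.sum_nonneg fun j _ => abs_nonneg _).1 h6 i (Finset.mem_univ i)
  have h8 := (Finset.sum_eq_zero_iff_of_nonneg fun j _ => abs_nonneg _).1 h7 j (Finset.mem_univ j)
  exact sub_eq_zero.1 (abs_eq_zero.1 h8)

theorem Good.gap_nonpos (hS : Good D S) (h : Regular D) (ha : 0 < S.a) :
    dual D S.η + primal D S.x ≤ 0 := by
  have hA : 0 < S.A := mul_pos hS.L_pos (mul_pos ha ha)
  have := hS.estimate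
  have := dualInner_self_nonneg h.s_pos S.ζ
  by_contra hneg
  push Not at hneg
  nlinarith [mul_pos hA hneg]

/-- Write G for the gap φ(η) + f(x̂), r for the residual norm, E for γ times the squared distance.
The invariant gives G + A r²/2 ≤ 0; Fenchel-Young at the dual solution together with its optimality
gives E/4 ≤ G + rR. All three bounds follow by eliminating G or dropping E. -/
theorem Good.guarantees (hS : Good D S) (h : Regular D) (ha : 0 < S.a) {x : Dual m N}
    (hx : IsDualSolution D x) {R : ℝ} (hR : dualNorm D.s x ≤ R) :
    S.A * dualNorm D.s (constraintResidual D S.x) ≤ 2 * R ∧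
    S.A * |dual D S.η + primal D S.x| ≤ 2 * R ^ 2 ∧
    S.A * (D.γ * ∑ l, D.w l * (∑ i, ∑ j, |S.x l i j - plan D x l i j|) ^ 2) ≤ 2 * R ^ 2 := by
  have hA : 0 < S.A := mul_pos hS.L_pos (mul_pos ha ha)
  have hgap := hS.gap_nonpos h ha
  have h1 := h.inner_add_le hS.x_nonneg (hS.x_sum ha) hx.1
  have h2 : dual D x ≤ dual D S.η := hx.2 hS.η_mem
  have h3 := (abs_le.1 (abs_dualInner_le h.s_pos (constraintResidual D S.x) x)).1
  have h4 := hS.estimate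
  have h5 : dualInner D.s S.ζ S.ζ = S.A ^ 2 * dualNorm D.s (constraintResidual D S.x) ^ 2 := by
    have e : S.ζ = (-S.A) • constraintResidual D S.x + (0 : ℝ) • 0 := by
      rw [smul_zero, add_zero]; exact hS.ζ_eq
    rw [e, dualInner_comb, dualInner_comb_right, dualInner_zero_left, dualNorm_sq h.s_pos,
      dualInner_zero_right]
    ring
  have h6 : 0 ≤ dualNorm D.s (constraintResidual D S.x) := dualNorm_nonneg _ _
  have h7 := mul_nonneg h.γ_pos.le
    (h.sum_w_sq_nonneg fun l => ∑ i, ∑ j, |S.x l i j - plan D x l i j|)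
  have hR0 : 0 ≤ R := (dualNorm_nonneg _ _).trans hR
  have h8 := mul_le_mul_of_nonneg_left hR h6
  set r := dualNorm D.s (constraintResidual D S.x)
  set E := D.γ * ∑ l, D.w l * (∑ i, ∑ j, |S.x l i j - plan D x l i j|) ^ 2
  set G := dual D S.η + primal D S.x
  have h9 : E / 4 ≤ G + r * R := by
    have : E / 4 = D.γ / 4 * ∑ l, D.w l * (∑ i, ∑ j, |S.x l i j - plan D x l i j|) ^ 2 := by
      simp only [E]; ring
    linarith
  have h10 : S.A * (G + S.A * r ^ 2 / 2) ≤ 0 := by rw [h5] at h4; linarith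
  have h11 : G + S.A * r ^ 2 / 2 ≤ 0 := by
    by_contra hneg
    push Not at hneg
    linarith [mul_pos hA hneg]
  have hr : S.A * r ≤ 2 * R := by
    rcases h6.eq_or_lt with h0 | h0
    · rw [← h0]; linarith
    · have : r * (S.A * r) ≤ r * (2 * R) := by nlinarith
      exact le_of_mul_le_mul_left this h0
  refine ⟨hr, ?_, ?_⟩
  · rw [abs_of_nonpos hgap]
    nlinarith [mul_le_mul_of_nonneg_right hr hR0]
  -- After multiplication by A, the right side is R(Ar) - (Ar)²/2, a concave quadratic in Ar with
  -- maximum R²/2.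
  · have h12 : E / 4 ≤ r * R - S.A * r ^ 2 / 2 := by linarith
    have h13 := mul_le_mul_of_nonneg_left h12 hA.le
    nlinarith [sq_nonneg (S.A * r - R)]

theorem primal_dual_guarantees (h : Regular D) (hL : ∀ l, 2 * D.γ * (D.w l / D.s l) ≤ L) {L₀ : ℝ}
    (hL₀ : 0 < L₀) (hL₀L : L₀ ≤ 8 * L) {S : ℕ → State m N} (hS : IsRun D L₀ S) {x : Dual m N}
    (hx : IsDualSolution D x) {R : ℝ} (hR : dualNorm D.s x ≤ R) {k : ℕ} (hk : 1 ≤ k) :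
    dualNorm D.s (constraintResidual D (S k).x) ≤ 32 * L * R / (k : ℝ) ^ 2 ∧
    |dual D (S k).η + primal D (S k).x| ≤ 32 * L * R ^ 2 / (k : ℝ) ^ 2 ∧
    ∀ πopt ∈ primalFeasible D.toBaryData,
      IsMinOn (primal D) (primalFeasible D.toBaryData) πopt →
      Real.sqrt (∑ l, D.w l * (∑ i, ∑ j, |(S k).x l i j - πopt l i j|) ^ 2) ≤
        8 * Real.sqrt (2 * L / D.γ) * R / k := by
  obtain ⟨hg, -, hA, ha⟩ := hS.bounds h hL hL₀ hL₀L k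
  have hl := h.pos_of_le hL
  obtain ⟨g1, g2, g3⟩ := hg.guarantees h (ha hk) hx hR
  have hk0 : (0 : ℝ) < k := by exact_mod_cast hk
  have hA2 : (k : ℝ) ^ 2 / (16 * L) ≤ (S k).A := by
    have := pow_le_pow_left₀ (by positivity) hA 2
    rw [Real.sq_sqrt hg.A_nonneg, div_pow, mul_pow, Real.sq_sqrt hl.le] at this
    norm_num at this
    exact this
  have hR0 : 0 ≤ R := (dualNorm_nonneg _ _).trans hR
  have key : ∀ {y c : ℝ}, 0 ≤ y → (S k).A * y ≤ 2 * c → y ≤ 32 * L * c / (k : ℝ) ^ 2 :=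
    fun {y c} hy hc => by
      have := (mul_le_mul_of_nonneg_right hA2 hy).trans hc
      rw [div_mul_eq_mul_div, div_le_iff₀ (by positivity)] at this
      rw [le_div_iff₀ (by positivity)]
      linarith
  refine ⟨key (dualNorm_nonneg _ _) g1, key (abs_nonneg _) g2, fun π hπ hmin => ?_⟩
  rw [eq_plan_of_isMinOn h hx hπ hmin]
  have hγ := h.γ_pos
  refine Real.sqrt_le_iff.2 ⟨by positivity, ?_⟩
  have h1 := key (mul_nonneg hγ.le (h.sum_w_sq_nonneg _)) g3
  -- The squared claim is four times what the previous bound provides, so this estimate has room to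
  -- spare.
  have h2 : (8 * √(2 * L / D.γ) * R / k) ^ 2 = 4 * (32 * L * R ^ 2 / (k : ℝ) ^ 2) / D.γ := by
    rw [div_pow, mul_pow, mul_pow, Real.sq_sqrt (by positivity)]
    ring
  rw [h2, le_div_iff₀ hγ]
  have h3 : 0 ≤ 32 * L * R ^ 2 / (k : ℝ) ^ 2 := by positivity
  linarith

end

/-! ### Rounding -/

/-- Scaling down the rows of `X` whose sum is larger than the entry of `p`. -/
noncomputable def scaleRows (p : Fin N → ℝ) (X : Fin N → Fin N → ℝ) : Fin N → Fin N → ℝ :=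
  fun i j => min (p i / ∑ j, X i j) 1 * X i j

/-- Scaling down the columns of `X` whose sum is larger than the entry of `q`. -/
noncomputable def scaleCols (q : Fin N → ℝ) (X : Fin N → Fin N → ℝ) : Fin N → Fin N → ℝ :=
  fun i j => X i j * min (q j / ∑ i, X i j) 1

/-- The case r = 0 is included: there division by zero is harmless because the factor multiplies an
empty row or column. -/
theorem min_div_one_mul {a r : ℝ} (ha : 0 ≤ a) (hr : 0 ≤ r) : min (a / r) 1 * r = min a r := by
  rcases hr.eq_or_lt with rfl | hr
  · simp [ha]
  · rw [min_mul_of_nonneg _ _ hr.le, div_mul_cancel₀ _ hr.ne', one_mul]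

theorem sum_scaleRows {p : Fin N → ℝ} {X : Fin N → Fin N → ℝ} (hp : ∀ i, 0 ≤ p i)
    (hX : ∀ i j, 0 ≤ X i j) (i : Fin N) :
    ∑ j, scaleRows p X i j = min (p i) (∑ j, X i j) := by
  simp only [scaleRows, ← Finset.mul_sum]
  exact min_div_one_mul (hp i) (Finset.sum_nonneg fun j _ => hX i j)

theorem sum_scaleCols {q : Fin N → ℝ} {X : Fin N → Fin N → ℝ} (hq : ∀ i, 0 ≤ q i)
    (hX : ∀ i j, 0 ≤ X i j) (j : Fin N) :
    ∑ i, scaleCols q X i j = min (q j) (∑ i, X i j) := by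
  simp only [scaleCols, ← Finset.sum_mul]
  rw [mul_comm]
  exact min_div_one_mul (hq j) (Finset.sum_nonneg fun i _ => hX i j)

theorem scaleRows_mem {p : Fin N → ℝ} {X : Fin N → Fin N → ℝ} (hp : ∀ i, 0 ≤ p i)
    (hX : ∀ i j, 0 ≤ X i j) (i j : Fin N) : 0 ≤ scaleRows p X i j ∧ scaleRows p X i j ≤ X i j :=
  ⟨mul_nonneg (le_min (div_nonneg (hp i) (Finset.sum_nonneg fun j _ => hX i j)) zero_le_one)
    (hX i j), mul_le_of_le_one_left (hX i j) (min_le_right _ _)⟩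

theorem scaleCols_mem {q : Fin N → ℝ} {X : Fin N → Fin N → ℝ} (hq : ∀ i, 0 ≤ q i)
    (hX : ∀ i j, 0 ≤ X i j) (i j : Fin N) : 0 ≤ scaleCols q X i j ∧ scaleCols q X i j ≤ X i j :=
  ⟨mul_nonneg (hX i j) (le_min (div_nonneg (hq j) (Finset.sum_nonneg fun i _ => hX i j))
    zero_le_one), mul_le_of_le_one_right (hX i j) (min_le_right _ _)⟩

/-- Adding a matrix of rank one to correct the marginals. -/
theorem correct_mem_couplings {p q : Fin N → ℝ} (hp : p ∈ stdSimplex ℝ (Fin N))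
    (hq : q ∈ stdSimplex ℝ (Fin N)) {Z : Fin N → Fin N → ℝ} (hZ : ∀ i j, 0 ≤ Z i j)
    (hr : ∀ i, ∑ j, Z i j ≤ p i) (hc : ∀ j, ∑ i, Z i j ≤ q j) :
    (fun i j => Z i j + (p i - ∑ j, Z i j) * (q j - ∑ i, Z i j) / ∑ i, (p i - ∑ j, Z i j)) ∈
      couplings p q ∧
    ∑ i, ∑ j, (p i - ∑ j, Z i j) * (q j - ∑ i, Z i j) / ∑ i, (p i - ∑ j, Z i j) =
      1 - ∑ i, ∑ j, Z i j := by
  have he : ∑ i, (p i - ∑ j, Z i j) = 1 - ∑ i, ∑ j, Z i j := by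
    rw [Finset.sum_sub_distrib, hp.2]
  have he' : ∑ j, (q j - ∑ i, Z i j) = 1 - ∑ i, ∑ j, Z i j := by
    rw [Finset.sum_sub_distrib, hq.2, Finset.sum_comm]
  have h0 : 0 ≤ 1 - ∑ i, ∑ j, Z i j := by
    rw [← he]; exact Finset.sum_nonneg fun i _ => sub_nonneg.2 (hr i)
  rw [he]
  have hrow : ∀ i, ∑ j, (p i - ∑ j, Z i j) * (q j - ∑ i, Z i j) / (1 - ∑ i, ∑ j, Z i j) =
      p i - ∑ j, Z i j := fun i => by
    rw [← Finset.sum_div, ← Finset.mul_sum, he']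
    -- If no mass is missing, all row errors are zero, so the rank-one correction, a division by
    -- zero with value 0, is still right.
    rcases h0.eq_or_lt with h | h
    · rw [← h] at he ⊢
      rw [(Finset.sum_eq_zero_iff_of_nonneg fun i _ => sub_nonneg.2 (hr i)).1 he i
        (Finset.mem_univ i)]
      simp
    · exact mul_div_cancel_right₀ _ h.ne'
  have hcol : ∀ j, ∑ i, (p i - ∑ j, Z i j) * (q j - ∑ i, Z i j) / (1 - ∑ i, ∑ j, Z i j) =
      q j - ∑ i, Z i j := fun j => by
    rw [← Finset.sum_div, ← Finset.sum_mul, he]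
    rcases h0.eq_or_lt with h | h
    · rw [← h] at he' ⊢
      rw [(Finset.sum_eq_zero_iff_of_nonneg fun i _ => sub_nonneg.2 (hc i)).1 he' j
        (Finset.mem_univ j)]
      simp
    · exact mul_div_cancel_left₀ _ h.ne'
  refine ⟨⟨fun i j => ?_, fun i => ?_, fun j => ?_⟩, ?_⟩
  · exact add_nonneg (hZ i j)
      (div_nonneg (mul_nonneg (sub_nonneg.2 (hr i)) (sub_nonneg.2 (hc j))) h0)
  · rw [Finset.sum_add_distrib, hrow]; ring
  · rw [Finset.sum_add_distrib, hcol]; ring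
  · simp only [hrow, he]

theorem sum_sum_abs_sub_of_le {a b : Fin N → Fin N → ℝ} (h : ∀ i j, a i j ≤ b i j) :
    ∑ i, ∑ j, |a i j - b i j| = (∑ i, ∑ j, b i j) - ∑ i, ∑ j, a i j := by
  simp only [← Finset.sum_sub_distrib]
  refine Finset.sum_congr rfl fun i _ => Finset.sum_congr rfl fun j _ => ?_
  rw [abs_sub_comm, abs_of_nonneg (sub_nonneg.2 (h i j))]

/-- The rounding algorithm of Altschuler, Weed and Rigollet. -/
theorem roundC_spec {p : Blocks m N} {q : Fin N → ℝ} {X : Plans m N} {l : Fin m}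
    (hp : p l ∈ stdSimplex ℝ (Fin N)) (hq : q ∈ stdSimplex ℝ (Fin N)) (hX : ∀ i j, 0 ≤ X l i j)
    (hX1 : ∑ i, ∑ j, X l i j = 1) :
    (roundC p q X).val l ∈ couplings (p l) q ∧
    ∑ i, ∑ j, |(roundC p q X).val l i j - X l i j| ≤
      2 * ((∑ i, |(∑ j, X l i j) - p l i|) + ∑ j, |(∑ i, X l i j) - q j|) := by
  have hY := scaleRows_mem hp.1 hX
  set Y := scaleRows (p l) (X l) with hY_def
  have hZ := scaleCols_mem hq.1 fun i j => (hY i j).1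
  set Z := scaleCols q Y with hZ_def
  have hZr : ∀ i, ∑ j, Z i j ≤ p l i := fun i =>
    (Finset.sum_le_sum fun j _ => (hZ i j).2).trans
      ((sum_scaleRows hp.1 hX i).trans_le (min_le_left _ _))
  have hZc : ∀ j, ∑ i, Z i j ≤ q j := fun j =>
    (sum_scaleCols hq.1 (fun i j => (hY i j).1) j).trans_le (min_le_left _ _)
  obtain ⟨h1, h2⟩ := correct_mem_couplings hp hq (fun i j => (hZ i j).1) hZr hZc
  refine ⟨h1, ?_⟩
  have hval : ∀ i j, (roundC p q X).val l i j = Z i j +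
      (p l i - ∑ j, Z i j) * (q j - ∑ i, Z i j) / ∑ i, (p l i - ∑ j, Z i j) := fun i j => rfl
  have hnn : ∀ i j, 0 ≤ (p l i - ∑ j, Z i j) * (q j - ∑ i, Z i j) /
      ∑ i, (p l i - ∑ j, Z i j) := fun i j =>
    div_nonneg (mul_nonneg (sub_nonneg.2 (hZr i)) (sub_nonneg.2 (hZc j)))
      (Finset.sum_nonneg fun i _ => sub_nonneg.2 (hZr i))
  -- The mass removed by the two scalings equals the mass added back, so the ℓ1 change is at most
  -- twice the removed mass; row scaling removes at most the row error and column scaling at most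
  -- the column error.
  have h3 : ∑ i, ∑ j, |(roundC p q X).val l i j - X l i j| ≤
      (∑ i, ∑ j, |Z i j - X l i j|) + (1 - ∑ i, ∑ j, Z i j) := by
    rw [← h2, ← Finset.sum_add_distrib]
    refine Finset.sum_le_sum fun i _ => ?_
    rw [← Finset.sum_add_distrib]
    refine Finset.sum_le_sum fun j _ => ?_
    rw [hval, add_sub_right_comm]
    refine (abs_add_le _ _).trans ?_
    rw [abs_of_nonneg (hnn i j)]
  rw [sum_sum_abs_sub_of_le fun i j => (hZ i j).2.trans (hY i j).2, hX1] at h3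
  have h4 : 1 - ∑ i, ∑ j, Y i j ≤ ∑ i, |(∑ j, X l i j) - p l i| := by
    rw [← hX1, ← Finset.sum_sub_distrib]
    refine Finset.sum_le_sum fun i _ => ?_
    rw [hY_def, sum_scaleRows hp.1 hX]
    rcases min_cases (p l i) (∑ j, X l i j) with ⟨e, -⟩ | ⟨e, -⟩ <;> rw [e]
    · exact le_abs_self _
    · rw [sub_self]; exact abs_nonneg _
  have h5 : (∑ i, ∑ j, Y i j) - ∑ i, ∑ j, Z i j ≤ ∑ j, |(∑ i, X l i j) - q j| := by
    rw [Finset.sum_comm, Finset.sum_comm (f := fun i j => Z i j), ← Finset.sum_sub_distrib]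
    refine Finset.sum_le_sum fun j _ => ?_
    rw [hZ_def, sum_scaleCols hq.1 fun i j => (hY i j).1]
    -- Row scaling only lowers the columns, so the excess over q is bounded by the error of the
    -- original columns.
    have h6 : ∑ i, Y i j ≤ ∑ i, X l i j := Finset.sum_le_sum fun i _ => (hY i j).2
    rcases min_cases (q j) (∑ i, Y i j) with ⟨e, -⟩ | ⟨e, -⟩ <;> rw [e]
    · exact (sub_le_sub_right h6 _).trans (le_abs_self _)
    · rw [sub_self]; exact abs_nonneg _
  linarith

/-! ### Costs and entropies -/

theorem sum_cost_le (C : Plans m N) (l : Fin m) (a : Fin N → Fin N → ℝ) :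
    |∑ i, ∑ j, C l i j * a i j| ≤ ‖C‖ * ∑ i, ∑ j, |a i j| := by
  simp only [Finset.mul_sum]
  refine (Finset.abs_sum_le_sum_abs _ _).trans (Finset.sum_le_sum fun i _ => ?_)
  refine (Finset.abs_sum_le_sum_abs _ _).trans (Finset.sum_le_sum fun j _ => ?_)
  rw [abs_mul]
  exact mul_le_mul_of_nonneg_right (abs_le_norm_plans C l i j) (abs_nonneg _)

theorem abs_planCost_le {D : BaryData m N} (hw : ∀ l, 0 < D.w l) (hw1 : ∑ l, D.w l = 1)
    {π : Plans m N} (h0 : ∀ l i j, 0 ≤ π l i j) (h1 : ∀ l, ∑ i, ∑ j, π l i j = 1) :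
    |planCost D π| ≤ ‖D.C‖ := by
  calc |planCost D π| ≤ ∑ l, D.w l * ‖D.C‖ := by
        refine (Finset.abs_sum_le_sum_abs _ _).trans (Finset.sum_le_sum fun l _ => ?_)
        rw [abs_mul, abs_of_pos (hw l)]
        refine mul_le_mul_of_nonneg_left ((sum_cost_le D.C l (π l)).trans ?_) (hw l).le
        simp only [abs_of_nonneg (h0 l _ _), h1, mul_one, le_refl]
    _ = ‖D.C‖ := by rw [← Finset.sum_mul, hw1, one_mul]

theorem entropy_nonpos {a : Fin N → Fin N → ℝ} (h0 : ∀ i j, 0 ≤ a i j)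
    (h1 : ∑ i, ∑ j, a i j = 1) : ∑ i, ∑ j, a i j * Real.log (a i j) ≤ 0 := by
  refine Finset.sum_nonpos fun i _ => Finset.sum_nonpos fun j _ =>
    mul_nonpos_of_nonneg_of_nonpos (h0 i j) (Real.log_nonpos (h0 i j) ?_)
  rw [← h1]
  exact (Finset.single_le_sum (f := fun j => a i j) (fun j _ => h0 i j) (Finset.mem_univ j)).trans
    (Finset.single_le_sum (f := fun i => ∑ j, a i j)
      (fun i _ => Finset.sum_nonneg fun j _ => h0 i j) (Finset.mem_univ i))

/-- Nonnegativity of the relative entropy with respect to the uniform distribution on the N²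
entries. -/
theorem entropy_ge (hN : 0 < N) {a : Fin N → Fin N → ℝ} (h0 : ∀ i j, 0 ≤ a i j)
    (h1 : ∑ i, ∑ j, a i j = 1) : -(2 * Real.log N) ≤ ∑ i, ∑ j, a i j * Real.log (a i j) := by
  have hN' : (0 : ℝ) < N := by exact_mod_cast hN
  have h := sq_sum_abs_sub_le (fun b : Fin N × Fin N => a b.1 b.2)
    (fun _ => ((N : ℝ) * N)⁻¹) (fun b => h0 _ _) (fun _ => by positivity)
    (by rw [Fintype.sum_prod_type]; exact h1)
    (by simp only [Finset.sum_const, Finset.card_univ, Fintype.card_prod, Fintype.card_fin,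
          nsmul_eq_mul, Nat.cast_mul]; field_simp)
  simp only [Fintype.sum_prod_type, mul_sub, Finset.sum_sub_distrib, ← Finset.sum_mul, h1,
    Real.log_inv, Real.log_mul hN'.ne' hN'.ne'] at h
  nlinarith [sq_nonneg (∑ i, ∑ j, |a i j - ((N : ℝ) * N)⁻¹|)]

theorem primal_eq {D : RegData m N} (hw1 : ∑ l, D.w l = 1) {π : Plans m N}
    (h1 : ∀ l, ∑ i, ∑ j, π l i j = 1) :
    primal D π = planCost D.toBaryData π +
      D.γ * (∑ l, D.w l * ∑ i, ∑ j, π l i j * Real.log (π l i j)) - D.γ := by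
  have e : D.γ = ∑ l, D.w l * D.γ := by rw [← Finset.sum_mul, hw1, one_mul]
  have e2 : ∀ l, ∑ i, ∑ j, π l i j * (Real.log (π l i j) - 1) =
      (∑ i, ∑ j, π l i j * Real.log (π l i j)) - 1 := fun l => by
    simp only [mul_sub, mul_one, Finset.sum_sub_distrib, h1]
  rw [primal, planCost, Finset.mul_sum]
  simp only [e2]
  calc _ = ∑ l, (D.w l * (∑ i, ∑ j, D.C l i j * π l i j) +
        D.γ * (D.w l * ∑ i, ∑ j, π l i j * Real.log (π l i j)) - D.w l * D.γ) :=
        Finset.sum_congr rfl fun l _ => by ring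
    _ = _ := by rw [Finset.sum_sub_distrib, Finset.sum_add_distrib, ← e]

theorem weighted_entropy_bounds (hN : 0 < N) {w : Fin m → ℝ} (hw : ∀ l, 0 < w l)
    (hw1 : ∑ l, w l = 1) {π : Plans m N} (h0 : ∀ l i j, 0 ≤ π l i j)
    (h1 : ∀ l, ∑ i, ∑ j, π l i j = 1) :
    -(2 * Real.log N) ≤ ∑ l, w l * ∑ i, ∑ j, π l i j * Real.log (π l i j) ∧
    ∑ l, w l * ∑ i, ∑ j, π l i j * Real.log (π l i j) ≤ 0 := by
  constructor
  · calc -(2 * Real.log N) = ∑ l, w l * -(2 * Real.log N) := by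
          rw [← Finset.sum_mul, hw1, one_mul]
      _ ≤ _ := Finset.sum_le_sum fun l _ =>
          mul_le_mul_of_nonneg_left (entropy_ge hN (h0 l) (h1 l)) (hw l).le
  · exact Finset.sum_nonpos fun l _ =>
      mul_nonpos_of_nonneg_of_nonpos (hw l).le (entropy_nonpos (h0 l) (h1 l))

theorem prod_mem_couplings {p q : Fin N → ℝ} (hp : p ∈ stdSimplex ℝ (Fin N))
    (hq : q ∈ stdSimplex ℝ (Fin N)) : (fun i j => p i * q j) ∈ couplings p q :=
  ⟨fun i j => mul_nonneg (hp.1 i) (hq.1 j), fun i => by rw [← Finset.mul_sum, hq.2, mul_one],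
    fun j => by rw [← Finset.sum_mul, hp.2, one_mul]⟩

theorem bddBelow_costs (D : BaryData m N) (hp : ∀ l, D.p l ∈ stdSimplex ℝ (Fin N)) (l : Fin m)
    (q : Fin N → ℝ) : BddBelow ((fun π : Fin N → Fin N → ℝ => ∑ i, ∑ j, D.C l i j * π i j) ''
      couplings (D.p l) q) := by
  refine ⟨-‖D.C‖, ?_⟩
  rintro _ ⟨π, hπ, rfl⟩
  have h := (abs_le.1 (sum_cost_le D.C l π)).1
  simpa only [abs_of_nonneg (hπ.1 _ _), sum_of_mem_couplings (hp l) hπ, mul_one] using h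

theorem baryObjective_le_planCost {D : BaryData m N} (hw : ∀ l, 0 < D.w l)
    (hp : ∀ l, D.p l ∈ stdSimplex ℝ (Fin N)) {q : Fin N → ℝ} {π : Plans m N}
    (hπ : ∀ l, π l ∈ couplings (D.p l) q) : baryObjective D q ≤ planCost D π :=
  Finset.sum_le_sum fun l _ => mul_le_mul_of_nonneg_left
    (csInf_le (bddBelow_costs D hp l q) ⟨π l, hπ l, rfl⟩) (hw l).le

/-- Near-optimal plans suffice for the comparison, so attainment of the transport minimum is never
needed; the product coupling shows that the infimum is over a nonempty set. -/
theorem exists_planCost_lt {D : BaryData m N} (hw : ∀ l, 0 < D.w l) (hw1 : ∑ l, D.w l = 1)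
    (hp : ∀ l, D.p l ∈ stdSimplex ℝ (Fin N)) {q : Fin N → ℝ} (hq : q ∈ stdSimplex ℝ (Fin N))
    {δ : ℝ} (hδ : 0 < δ) :
    ∃ π : Plans m N, (∀ l, π l ∈ couplings (D.p l) q) ∧ planCost D π ≤ baryObjective D q + δ := by
  have h : ∀ l, ∃ π ∈ couplings (D.p l) q,
      ∑ i, ∑ j, D.C l i j * π i j < transportCost (D.C l) (D.p l) q + δ := fun l => by
    obtain ⟨_, ⟨π, hπ, rfl⟩, hlt⟩ := exists_lt_of_csInf_lt
      (Set.Nonempty.image (fun π : Fin N → Fin N → ℝ => ∑ i, ∑ j, D.C l i j * π i j)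
        ⟨_, prod_mem_couplings (hp l) hq⟩)
      (lt_add_of_pos_right (transportCost (D.C l) (D.p l) q) hδ)
    exact ⟨π, hπ, hlt⟩
  choose π hπ hlt using h
  refine ⟨π, hπ, ?_⟩
  calc planCost D π ≤ ∑ l, D.w l * (transportCost (D.C l) (D.p l) q + δ) :=
        Finset.sum_le_sum fun l _ => mul_le_mul_of_nonneg_left (hlt l).le (hw l).le
    _ = _ := by
        simp only [mul_add, Finset.sum_add_distrib, ← Finset.sum_mul, hw1, one_mul]
        rfl

/-! ### The prepared problem -/

theorem pi_norm_norm {n : ℕ} {E : Type*} [SeminormedAddCommGroup E] (f : Fin n → E) :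
    ‖fun i => ‖f i‖‖ = ‖f‖ := by
  simp [Pi.norm_def]

section

variable {D : BaryData m N} {s : Fin m → ℝ} {ε : ℝ}

theorem prepare_p (D : BaryData m N) (s : Fin m → ℝ) (ε : ℝ) (l : Fin m) (i : Fin N) :
    (prepare D s ε).val.p l i = (1 - ε / (8 * ‖D.C‖) / 8) *
      (D.p l i + ε / (8 * ‖D.C‖) / (N * (8 - ε / (8 * ‖D.C‖)))) := by
  have h : ‖fun l => ‖fun i => ‖fun j => D.C l i j‖‖‖ = ‖D.C‖ := by
    simp only [pi_norm_norm]
  rw [← h]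
  rfl

/-- The assumptions on the data of the algorithm. -/
structure Admissible (D : BaryData m N) (s : Fin m → ℝ) (ε : ℝ) : Prop where
  N_ge : 2 ≤ N
  w_pos : ∀ l, 0 < D.w l
  w_sum : ∑ l, D.w l = 1
  s_pos : ∀ l, 0 < s l
  p_mem : ∀ l, D.p l ∈ stdSimplex ℝ (Fin N)
  ε_pos : 0 < ε
  ε_le : ε ≤ ‖D.C‖

namespace Admissible

theorem nonempty_left (h : Admissible D s ε) : Nonempty (Fin m) := by
  by_contra hne
  rw [not_nonempty_iff] at hne
  simpa using h.w_sum

theorem m_pos (h : Admissible D s ε) : 1 ≤ m := by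
  obtain ⟨l⟩ := h.nonempty_left
  exact Fin.pos l

theorem N_pos (h : Admissible D s ε) : (0 : ℝ) < N := by
  have := h.N_ge
  exact_mod_cast (by omega : 0 < N)

theorem half_le_log (h : Admissible D s ε) : 1 / 2 ≤ Real.log N := by
  have h1 : Real.log 2 ≤ Real.log N :=
    Real.log_le_log two_pos (by exact_mod_cast h.N_ge)
  have := Real.log_two_gt_d9
  linarith

theorem log_pos (h : Admissible D s ε) : 0 < Real.log N := by
  have := h.half_le_log
  linarith

theorem C_pos (h : Admissible D s ε) : 0 < ‖D.C‖ := h.ε_pos.trans_le h.ε_le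

theorem one_le_ratio (h : Admissible D s ε) : 1 ≤ ‖D.C‖ / ε := (one_le_div h.ε_pos).2 h.ε_le

/-- The perturbed histogram is a mixture of p_l and the uniform vector with weight ε/(64‖C‖) = ε'/8.
-/
theorem prepare_p_eq (h : Admissible D s ε) (l : Fin m) (i : Fin N) :
    (prepare D s ε).val.p l i =
      (1 - ε / (64 * ‖D.C‖)) * D.p l i + ε / (64 * ‖D.C‖) * (1 / N) := by
  have hC := h.C_pos
  have hε := h.ε_le
  have hN := h.N_pos
  have h8 : 8 - ε / (8 * ‖D.C‖) ≠ 0 := by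
    have : ε / (8 * ‖D.C‖) ≤ 1 := by
      rw [div_le_one (by positivity)]; linarith
    linarith
  rw [prepare_p]
  have e : 1 - ε / (8 * ‖D.C‖) / 8 = (8 - ε / (8 * ‖D.C‖)) / 8 := by ring
  have e2 : ε / (64 * ‖D.C‖) = ε / (8 * ‖D.C‖) / 8 := by
    rw [div_div]; ring_nf
  rw [e2, mul_add, add_right_inj, e]
  generalize ε / (8 * ‖D.C‖) = t at h8
  field_simp

theorem δ_bounds (h : Admissible D s ε) :
    0 < ε / (64 * ‖D.C‖) ∧ ε / (64 * ‖D.C‖) ≤ 1 / 64 := by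
  have hC := h.C_pos
  have hε := h.ε_pos
  refine ⟨by positivity, ?_⟩
  rw [div_le_div_iff₀ (by positivity) (by norm_num)]
  linarith [h.ε_le]

theorem regular (h : Admissible D s ε) : Regular (prepare D s ε).val := by
  have hN := h.N_pos
  have hlog := h.log_pos
  obtain ⟨hδ, hδ1⟩ := h.δ_bounds
  have hpos : ∀ l i, 0 < (prepare D s ε).val.p l i := fun l i => by
    rw [h.prepare_p_eq]
    exact add_pos_of_nonneg_of_pos (mul_nonneg (by linarith) ((h.p_mem l).1 i)) (by positivity)
  refine ⟨?_, h.w_pos, h.w_sum, h.s_pos, fun l => ⟨fun i => (hpos l i).le, ?_⟩, hpos⟩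
  · have : 0 < ε / (4 * Real.log N) := div_pos h.ε_pos (by positivity)
    exact this
  · simp only [h.prepare_p_eq, Finset.sum_add_distrib, ← Finset.mul_sum, (h.p_mem l).2,
      Finset.sum_const, Finset.card_univ, Fintype.card_fin, nsmul_eq_mul]
    field_simp
    ring

theorem sum_abs_prepare_p_sub_le (h : Admissible D s ε) (l : Fin m) :
    ∑ i, |(prepare D s ε).val.p l i - D.p l i| ≤ 2 * (ε / (64 * ‖D.C‖)) := by
  obtain ⟨hδ, -⟩ := h.δ_bounds
  have hN := h.N_pos
  calc _ ≤ ∑ i, (ε / (64 * ‖D.C‖) * D.p l i + ε / (64 * ‖D.C‖) * (1 / N)) := by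
        refine Finset.sum_le_sum fun i _ => ?_
        have h1 := mul_nonneg hδ.le ((h.p_mem l).1 i)
        have h2 : 0 ≤ ε / (64 * ‖D.C‖) * (1 / (N : ℝ)) := by positivity
        rw [h.prepare_p_eq]
        exact abs_le.2 ⟨by linarith, by linarith⟩
    _ = _ := by
      simp only [Finset.sum_add_distrib, ← Finset.mul_sum, (h.p_mem l).2, Finset.sum_const,
        Finset.card_univ, Fintype.card_fin, nsmul_eq_mul]
      field_simp
      ring

theorem log_prepare_p_ge (h : Admissible D s ε) (l : Fin m) (i : Fin N) :
    -Real.log (64 * N * (‖D.C‖ / ε)) ≤ Real.log ((prepare D s ε).val.p l i) := by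
  obtain ⟨hδ, hδ1⟩ := h.δ_bounds
  have hN := h.N_pos
  have hC := h.C_pos
  have hε := h.ε_pos
  rw [← Real.log_inv]
  refine Real.log_le_log (by positivity) ?_
  rw [h.prepare_p_eq]
  have e : (64 * N * (‖D.C‖ / ε))⁻¹ = ε / (64 * ‖D.C‖) * (1 / N) := by field_simp
  rw [e]
  exact le_add_of_nonneg_left (mul_nonneg (by linarith) ((h.p_mem l).1 i))

/-- A solution of the dual of the prepared problem is bounded. -/
theorem exists_isDualSolution_norm_le (h : Admissible D s ε) :
    ∃ x, IsDualSolution (prepare D s ε).val x ∧ ‖x‖ ≤ 25 * (Real.log N * (‖D.C‖ / ε)) := by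
  obtain ⟨x, hx, hle⟩ := h.regular.exists_isDualSolution_norm_le h.log_prepare_p_ge
  refine ⟨x, hx, hle.trans ?_⟩
  have hε := h.ε_pos
  have hlog := h.log_pos
  have hN := h.N_pos
  have hy := h.one_le_ratio
  have e1 : ‖(prepare D s ε).val.C‖ / (prepare D s ε).val.γ = 4 * (Real.log N * (‖D.C‖ / ε)) := by
    change ‖D.C‖ / (ε / (4 * Real.log N)) = _
    field_simp
  have e2 : Real.log (64 * N * (‖D.C‖ / ε)) = 6 * Real.log 2 + Real.log N + Real.log (‖D.C‖ / ε) := by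
    rw [Real.log_mul (by positivity) (by positivity), Real.log_mul (by norm_num) (by positivity),
      show (64 : ℝ) = 2 ^ 6 by norm_num, Real.log_pow]
    norm_num
  have h1 : Real.log 2 ≤ Real.log N :=
    Real.log_le_log two_pos (by exact_mod_cast h.N_ge)
  -- Where 25 comes from: 16 from 4‖C‖/γ, 6 + 1 from ln 64 and ln N, and 2 from ln(‖C‖/ε) ≤ ‖C‖/ε ≤
  -- 2 ln N · ‖C‖/ε.
  have h2 := Real.log_le_sub_one_of_pos (lt_of_lt_of_le one_pos hy)
  have h3 := h.half_le_log
  rw [e1, e2]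
  nlinarith

/-! ### Correctness of the output -/

/-- Mixing in the product of the uniform vector and q perturbs the rows exactly as the preparation
does and keeps the common column marginal q. -/
theorem perturb_mem_primalFeasible (h : Admissible D s ε) {q : Fin N → ℝ}
    (hq : q ∈ stdSimplex ℝ (Fin N)) {π : Plans m N} (hπ : ∀ l, π l ∈ couplings (D.p l) q) :
    (fun l i j => (1 - ε / (64 * ‖D.C‖)) * π l i j + ε / (64 * ‖D.C‖) * (1 / N * q j)) ∈
      primalFeasible (prepare D s ε).val.toBaryData := by
  obtain ⟨hδ, hδ1⟩ := h.δ_bounds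
  have hN := h.N_pos
  refine ⟨q, hq, fun l => ⟨fun i j => ?_, fun i => ?_, fun j => ?_⟩⟩
  · exact add_nonneg (mul_nonneg (by linarith) ((hπ l).1 i j))
      (mul_nonneg hδ.le (mul_nonneg (by positivity) (hq.1 j)))
  · simp only [Finset.sum_add_distrib, ← Finset.mul_sum, (hπ l).2.1, hq.2, mul_one]
    exact (h.prepare_p_eq l i).symm
  · simp only [Finset.sum_add_distrib, ← Finset.mul_sum, (hπ l).2.2, Finset.sum_const,
      Finset.card_univ, Fintype.card_fin, nsmul_eq_mul]
    field_simp
    ring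

theorem planCost_perturb_le (h : Admissible D s ε) {q : Fin N → ℝ}
    (hq : q ∈ stdSimplex ℝ (Fin N)) {π : Plans m N} (hπ : ∀ l, π l ∈ couplings (D.p l) q) :
    planCost D (fun l i j => (1 - ε / (64 * ‖D.C‖)) * π l i j +
      ε / (64 * ‖D.C‖) * (1 / N * q j)) ≤ planCost D π + ε / 32 := by
  obtain ⟨hδ, -⟩ := h.δ_bounds
  have hN := h.N_pos
  have e : planCost D (fun l i j => (1 - ε / (64 * ‖D.C‖)) * π l i j +
      ε / (64 * ‖D.C‖) * (1 / N * q j)) = (1 - ε / (64 * ‖D.C‖)) * planCost D π +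
      ε / (64 * ‖D.C‖) * planCost D (fun _ _ j => 1 / N * q j) := by
    simp only [planCost, Finset.mul_sum]
    simp only [← Finset.sum_add_distrib]
    exact Finset.sum_congr rfl fun l _ => Finset.sum_congr rfl fun i _ =>
      Finset.sum_congr rfl fun j _ => by ring
  have h1 := (abs_le.1 (abs_planCost_le (D := D) h.w_pos h.w_sum (fun l => (hπ l).1)
    fun l => sum_of_mem_couplings (h.p_mem l) (hπ l))).1
  have h2 := (abs_le.1 (abs_planCost_le (D := D) h.w_pos h.w_sum (π := fun _ _ j => 1 / N * q j)
    (fun l i j => mul_nonneg (by positivity) (hq.1 j)) fun l => by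
      simp only [← Finset.mul_sum, hq.2, Finset.sum_const, Finset.card_univ, Fintype.card_fin,
        nsmul_eq_mul]
      field_simp)).2
  have e3 : ε / (64 * ‖D.C‖) * (2 * ‖D.C‖) = ε / 32 := by
    have := h.C_pos
    field_simp
    ring
  rw [e]
  nlinarith

/-- Weak duality compares x̂ with the perturbed near-optimal plan. The losses are ε/6 for rounding,
γ · 2 ln N = ε/2 for the entropy and ε/32 for the perturbation, in total less than ε. The duality
gap costs nothing, being nonpositive by the invariant. -/
theorem approximates (h : Admissible D s ε) {S : State m N} (hS : Good (prepare D s ε).val S)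
    (ha : 0 < S.a) {π : Plans m N} (hincr : planCost D π ≤ planCost D S.x + ε / 6)
    {q : Fin N → ℝ} (hq : q ∈ stdSimplex ℝ (Fin N)) : planCost D π ≤ baryObjective D q + ε := by
  refine le_of_forall_pos_le_add fun δ hδ => ?_
  obtain ⟨ρ, hρ, hρle⟩ := exists_planCost_lt (D := D) h.w_pos h.w_sum h.p_mem hq hδ
  have hr := h.regular
  have hN : 0 < N := by have := h.N_ge; omega
  have hf := h.perturb_mem_primalFeasible hq hρ
  have hcost := h.planCost_perturb_le hq hρ
  set ρ' : Plans m N := fun l i j => (1 - ε / (64 * ‖D.C‖)) * ρ l i j +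
    ε / (64 * ‖D.C‖) * (1 / N * q j)
  have hres := hr.constraintResidual_eq_zero hf
  obtain ⟨q', -, hq'⟩ := hf
  have h0 : ∀ l i j, 0 ≤ ρ' l i j := fun l => (hq' l).1
  have h1 : ∀ l, ∑ i, ∑ j, ρ' l i j = 1 := fun l => sum_of_mem_couplings (hr.p_mem l) (hq' l)
  have hweak := hr.inner_le h0 h1 hS.η_mem
  rw [hres, dualInner_zero_left] at hweak
  have hgap := hS.gap_nonpos hr ha
  rw [primal_eq hr.w_sum h1] at hweak
  rw [primal_eq hr.w_sum (hS.x_sum ha)] at hgap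
  have e1 := (weighted_entropy_bounds hN hr.w_pos hr.w_sum hS.x_nonneg (hS.x_sum ha)).1
  have e2 := (weighted_entropy_bounds hN hr.w_pos hr.w_sum h0 h1).2
  have e3 := mul_le_mul_of_nonneg_left e1 hr.γ_pos.le
  have e4 := mul_nonpos_of_nonneg_of_nonpos hr.γ_pos.le e2
  have e5 : (prepare D s ε).val.γ * -(2 * Real.log N) = -(ε / 2) := by
    change ε / (4 * Real.log N) * _ = _
    have := h.log_pos
    field_simp
    norm_num
  have e6 : ∀ π, planCost (prepare D s ε).val.toBaryData π = planCost D π := fun _ => rfl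
  rw [e6] at hweak hgap
  have := h.ε_pos
  linarith

/-! ### The stopping test -/

end Admissible

/-- The histogram that is put out by the algorithm. -/
def averageMarginal (D : BaryData m N) (X : Plans m N) : Fin N → ℝ :=
  fun j => ∑ l, D.w l * ∑ i, X l i j

open scoped Classical in
theorem tryFinish_val (D : BaryData m N) (D' : RegData m N) (ε : ℝ) (S : State m N) :
    (tryFinish D D' ε S).val =
      if (∑ l, D.w l * ∑ i, ∑ j, D.C l i j *
        ((roundC D.p (averageMarginal D S.x) S.x).val l i j - S.x l i j)) ≤ ε / 6 ∧
        primal D' S.x + dual D' S.η ≤ ε / 6 then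
      some (averageMarginal D S.x, (roundC D.p (averageMarginal D S.x) S.x).val) else none := by
  have e : (tryFinish D D' ε S).val =
      if (decide ((∑ l, D.w l * ∑ i, ∑ j, D.C l i j *
        ((roundC D.p (averageMarginal D S.x) S.x).val l i j - S.x l i j)) ≤ ε / 6) &&
        decide (primal D' S.x + dual D' S.η ≤ ε / 6)) = true then
      some (averageMarginal D S.x, (roundC D.p (averageMarginal D S.x) S.x).val) else none := rfl
  rw [e]
  simp only [Bool.and_eq_true, decide_eq_true_eq]

theorem averageMarginal_mem (hw : ∀ l, 0 < D.w l) (hw1 : ∑ l, D.w l = 1) {X : Plans m N}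
    (h0 : ∀ l i j, 0 ≤ X l i j) (h1 : ∀ l, ∑ i, ∑ j, X l i j = 1) :
    averageMarginal D X ∈ stdSimplex ℝ (Fin N) := by
  refine ⟨fun j => Finset.sum_nonneg fun l _ =>
    mul_nonneg (hw l).le (Finset.sum_nonneg fun i _ => h0 l i j), ?_⟩
  have h2 : ∀ l, ∑ j, ∑ i, X l i j = 1 := fun l => by rw [Finset.sum_comm, h1]
  simp only [averageMarginal]
  rw [Finset.sum_comm]
  simp only [← Finset.mul_sum, h2, mul_one, hw1]

theorem incr_eq (D : BaryData m N) (π X : Plans m N) :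
    ∑ l, D.w l * ∑ i, ∑ j, D.C l i j * (π l i j - X l i j) = planCost D π - planCost D X := by
  simp only [planCost, mul_sub, Finset.sum_sub_distrib]

/-- What the output of the algorithm satisfies. -/
def IsApproximation (D : BaryData m N) (ε : ℝ) (o : (Fin N → ℝ) × Plans m N) : Prop :=
  o.1 ∈ stdSimplex ℝ (Fin N) ∧ (∀ l, o.2 l ∈ couplings (D.p l) o.1) ∧
    ∀ q' ∈ stdSimplex ℝ (Fin N), baryObjective D o.1 ≤ planCost D o.2 ∧
      planCost D o.2 ≤ baryObjective D q' + ε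

theorem Admissible.isApproximation (h : Admissible D s ε) {S : State m N}
    (hS : Good (prepare D s ε).val S) (ha : 0 < S.a) {o : (Fin N → ℝ) × Plans m N}
    (ho : (tryFinish D (prepare D s ε).val ε S).val = some o) : IsApproximation D ε o := by
  classical
  rw [tryFinish_val] at ho
  split_ifs at ho with hc
  rw [← Option.some.inj ho]
  have hq := averageMarginal_mem (D := D) h.w_pos h.w_sum hS.x_nonneg (hS.x_sum ha)
  have hπ : ∀ l, (roundC D.p (averageMarginal D S.x) S.x).val l ∈
      couplings (D.p l) (averageMarginal D S.x) := fun l =>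
    (roundC_spec (h.p_mem l) hq (hS.x_nonneg l) (hS.x_sum ha l)).1
  have hincr := hc.1
  rw [incr_eq] at hincr
  exact ⟨hq, hπ, fun q' hq' => ⟨baryObjective_le_planCost h.w_pos h.p_mem hπ,
    h.approximates hS ha (by linarith) hq'⟩⟩

end

/-! ### From the dual norm of the residual to ℓ1 marginal errors. -/

theorem sq_weighted_sum_abs_le {s : Fin m → ℝ} (hs : ∀ l, 0 < s l) (x : Dual m N) :
    (∑ l, s l * ((∑ i, |x.1 l i|) + ∑ j, |x.2 l j|)) ^ 2 ≤
      2 * N * (∑ l, s l) * dualInner s x x := by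
  have h1 : ∀ l, s l * ((∑ i, |x.1 l i|) + ∑ j, |x.2 l j|) =
      √(s l) * (√(s l) * ((∑ i, |x.1 l i|) + ∑ j, |x.2 l j|)) := fun l => by
    rw [← mul_assoc, Real.mul_self_sqrt (hs l).le]
  have h2 : ∀ y : Fin N → ℝ, (∑ i, |y i|) ^ 2 ≤ N * ∑ i, y i * y i := fun y => by
    have := sq_sum_le_card_mul_sum_sq (s := Finset.univ) (f := fun i => |y i|)
    simpa only [sq_abs, Finset.card_univ, Fintype.card_fin, ← sq] using this
  rw [Finset.sum_congr rfl fun l _ => h1 l]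
  refine (Finset.sum_mul_sq_le_sq_mul_sq _ _ _).trans ?_
  simp only [mul_pow, Real.sq_sqrt (hs _).le]
  have h3 : ∑ l, s l * ((∑ i, |x.1 l i|) + ∑ j, |x.2 l j|) ^ 2 ≤ 2 * N * dualInner s x x := by
    rw [dualInner, Finset.mul_sum]
    refine Finset.sum_le_sum fun l _ => ?_
    have h4 : ((∑ i, |x.1 l i|) + ∑ j, |x.2 l j|) ^ 2 ≤
        2 * N * ((∑ i, x.1 l i * x.1 l i) + ∑ j, x.2 l j * x.2 l j) := by
      linarith [h2 (x.1 l), h2 (x.2 l), add_sq_le (a := ∑ i, |x.1 l i|) (b := ∑ j, |x.2 l j|)]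
    have := mul_le_mul_of_nonneg_left h4 (hs l).le
    linarith
  have := mul_le_mul_of_nonneg_left h3 (Finset.sum_nonneg fun l _ => (hs l).le : 0 ≤ ∑ l, s l)
  linarith

theorem dualNorm_le {s : Fin m → ℝ} (hs : ∀ l, 0 < s l) (x : Dual m N) :
    dualNorm s x ≤ √(2 * N * ∑ l, s l) * ‖x‖ := by
  have h0 : (0 : ℝ) ≤ 2 * N * ∑ l, s l :=
    mul_nonneg (by positivity) (Finset.sum_nonneg fun l _ => (hs l).le)
  refine Real.sqrt_le_iff.2 ⟨by positivity, ?_⟩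
  rw [mul_pow, Real.sq_sqrt h0]
  have h1 : ∀ y : Blocks m N, ‖y‖ ≤ ‖x‖ → ∀ l, ∑ i, y l i * y l i ≤ N * ‖x‖ ^ 2 := fun y hy l => by
    calc _ ≤ ∑ i : Fin N, ‖x‖ ^ 2 := Finset.sum_le_sum fun i _ => by
          rw [← sq, ← sq_abs]
          exact pow_le_pow_left₀ (abs_nonneg _)
            (((norm_le_pi_norm (y l) i).trans (norm_le_pi_norm y l)).trans hy) 2
      _ = _ := by simp
  calc _ ≤ ∑ l, s l * (N * ‖x‖ ^ 2 + N * ‖x‖ ^ 2) := Finset.sum_le_sum fun l _ =>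
        mul_le_mul_of_nonneg_left
          (add_le_add (h1 x.1 (norm_fst_le x) l) (h1 x.2 (norm_snd_le x) l)) (hs l).le
    _ = _ := by rw [← Finset.sum_mul]; ring

theorem Regular.sum_abs_residual {D : RegData m N} (h : Regular D) (π : Plans m N) :
    D.γ * ∑ l, D.w l * ((∑ i, |(∑ j, π l i j) - D.p l i|) +
      ∑ j, |(∑ i, π l i j) - commonMarginal D π j|) =
    ∑ l, D.s l * ((∑ i, |(constraintResidual D π).1 l i|) +
      ∑ j, |(constraintResidual D π).2 l j|) := by
  rw [Finset.mul_sum]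
  refine Finset.sum_congr rfl fun l _ => ?_
  have hc := mul_pos h.γ_pos (div_pos (h.w_pos l) (h.s_pos l))
  simp only [constraintResidual, abs_mul (D.γ * (D.w l / D.s l)), abs_of_pos hc, ← Finset.mul_sum]
  have := (h.s_pos l).ne'
  field_simp

/-- The averaged marginal is within the weighted mean error of any reference q, so the triangle
inequality costs a factor 2. Applied with q = h, it links the output histogram to the residual. -/
theorem sum_abs_col_sub_averageMarginal_le {D : BaryData m N} (hw : ∀ l, 0 < D.w l)
    (hw1 : ∑ l, D.w l = 1) (X : Plans m N) (q : Fin N → ℝ) :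
    ∑ l, D.w l * ∑ j, |(∑ i, X l i j) - averageMarginal D X j| ≤
      2 * ∑ l, D.w l * ∑ j, |(∑ i, X l i j) - q j| := by
  have h1 : ∑ j, |q j - averageMarginal D X j| ≤ ∑ l, D.w l * ∑ j, |(∑ i, X l i j) - q j| := by
    simp only [Finset.mul_sum]
    rw [Finset.sum_comm]
    refine Finset.sum_le_sum fun j _ => ?_
    have e : q j - averageMarginal D X j = ∑ l, -(D.w l * ((∑ i, X l i j) - q j)) := by
      rw [Finset.sum_neg_distrib]
      simp only [mul_sub, Finset.sum_sub_distrib, ← Finset.sum_mul, hw1, averageMarginal]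
      ring
    rw [e]
    refine (Finset.abs_sum_le_sum_abs _ _).trans (Finset.sum_le_sum fun l _ => ?_)
    rw [abs_neg, abs_mul, abs_of_pos (hw l)]
  calc _ ≤ ∑ l, D.w l * ((∑ j, |(∑ i, X l i j) - q j|) + ∑ j, |q j - averageMarginal D X j|) := by
        refine Finset.sum_le_sum fun l _ => mul_le_mul_of_nonneg_left ?_ (hw l).le
        rw [← Finset.sum_add_distrib]
        exact Finset.sum_le_sum fun j _ => abs_sub_le _ _ _
    _ = (∑ l, D.w l * ∑ j, |(∑ i, X l i j) - q j|) + ∑ j, |q j - averageMarginal D X j| := by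
        simp only [mul_add, Finset.sum_add_distrib, ← Finset.sum_mul, hw1, one_mul]
    _ ≤ _ := by linarith

namespace Admissible

variable {D : BaryData m N} {s : Fin m → ℝ} {ε : ℝ}

/-- The value of `√(A L_φ)` at which the algorithm stops. -/
noncomputable def target (D : BaryData m N) (s : Fin m → ℝ) (ε : ℝ) : ℝ :=
  88 * √(N * distortion D.w s * Real.log N) * (‖D.C‖ / ε)

/-- 1 is the sum of (w_l/s_l) s_l, and each ratio is at most the maximum. -/
theorem one_le_distortion (h : Admissible D s ε) : 1 ≤ distortion D.w s := by
  rw [distortion, Finset.mul_sum, ← h.w_sum]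
  refine Finset.sum_le_sum fun l _ => ?_
  have h1 := (le_abs_self _).trans (norm_le_pi_norm (fun l => D.w l / s l) l)
  have h2 := mul_le_mul_of_nonneg_right h1 (h.s_pos l).le
  rwa [div_mul_cancel₀ _ (h.s_pos l).ne'] at h2

theorem one_le_sqrt (h : Admissible D s ε) : 1 ≤ √(N * distortion D.w s * Real.log N) := by
  rw [Real.one_le_sqrt]
  have h1 := h.one_le_distortion
  have h2 := h.half_le_log
  have h3 : (2 : ℝ) ≤ N := by exact_mod_cast h.N_ge
  have h4 : 2 ≤ N * distortion D.w s := by nlinarith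
  nlinarith

theorem one_le_target (h : Admissible D s ε) : 1 ≤ target D s ε := by
  have h1 := h.one_le_sqrt
  have h2 := h.one_le_ratio
  rw [target]
  nlinarith

/-- Rounding costs 2‖C‖ times the marginal errors, and replacing h by the average marginal doubles
the column part, whence 4‖C‖. Returning from the perturbed to the original histograms costs 4‖C‖ ·
ε/(64‖C‖) = ε/16. -/
theorem incr_le (h : Admissible D s ε) {S : State m N} (hS : Good (prepare D s ε).val S)
    (ha : 0 < S.a) :
    ∑ l, D.w l * ∑ i, ∑ j, D.C l i j *
      ((roundC D.p (averageMarginal D S.x) S.x).val l i j - S.x l i j) ≤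
    4 * ‖D.C‖ * (∑ l, D.w l * ((∑ i, |(∑ j, S.x l i j) - (prepare D s ε).val.p l i|) +
      ∑ j, |(∑ i, S.x l i j) - commonMarginal (prepare D s ε).val S.x j|)) + ε / 16 := by
  have hq := averageMarginal_mem (D := D) h.w_pos h.w_sum hS.x_nonneg (hS.x_sum ha)
  have hC := h.C_pos
  set ρ : Fin m → ℝ := fun l => ∑ i, |(∑ j, S.x l i j) - (prepare D s ε).val.p l i| with hρ
  set χ : Fin m → ℝ := fun l =>
    ∑ j, |(∑ i, S.x l i j) - commonMarginal (prepare D s ε).val S.x j| with hχ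
  set χ' : Fin m → ℝ := fun l => ∑ j, |(∑ i, S.x l i j) - averageMarginal D S.x j| with hχ'
  have h1 : ∀ l, ∑ i, ∑ j, D.C l i j *
      ((roundC D.p (averageMarginal D S.x) S.x).val l i j - S.x l i j) ≤
      ‖D.C‖ * (2 * (ρ l + 2 * (ε / (64 * ‖D.C‖)) + χ' l)) := fun l => by
    refine (le_abs_self _).trans ((sum_cost_le D.C l _).trans ?_)
    refine mul_le_mul_of_nonneg_left ?_ hC.le
    refine (roundC_spec (h.p_mem l) hq (hS.x_nonneg l) (hS.x_sum ha l)).2.trans ?_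
    have h2 : ∑ i, |(∑ j, S.x l i j) - D.p l i| ≤ ρ l +
        ∑ i, |(prepare D s ε).val.p l i - D.p l i| := by
      simp only [hρ, ← Finset.sum_add_distrib]
      exact Finset.sum_le_sum fun i _ => abs_sub_le _ _ _
    have h3 := h.sum_abs_prepare_p_sub_le l
    simp only [hχ']
    linarith
  have h4 : ∑ l, D.w l * χ' l ≤ 2 * ∑ l, D.w l * χ l :=
    sum_abs_col_sub_averageMarginal_le h.w_pos h.w_sum S.x _
  have h5 : 0 ≤ ∑ l, D.w l * ρ l := Finset.sum_nonneg fun l _ =>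
    mul_nonneg (h.w_pos l).le (Finset.sum_nonneg fun _ _ => abs_nonneg _)
  calc _ ≤ ∑ l, D.w l * (‖D.C‖ * (2 * (ρ l + 2 * (ε / (64 * ‖D.C‖)) + χ' l))) :=
        Finset.sum_le_sum fun l _ => mul_le_mul_of_nonneg_left (h1 l) (h.w_pos l).le
    _ = 2 * ‖D.C‖ * ((∑ l, D.w l * ρ l) + ∑ l, D.w l * χ' l) +
        (∑ l, D.w l) * (4 * (‖D.C‖ * (ε / (64 * ‖D.C‖)))) := by
      rw [← Finset.sum_add_distrib, Finset.mul_sum, Finset.sum_mul, ← Finset.sum_add_distrib]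
      exact Finset.sum_congr rfl fun l _ => by ring
    _ ≤ 2 * ‖D.C‖ * (2 * (∑ l, D.w l * ρ l) + 2 * ∑ l, D.w l * χ l) + ε / 16 := by
      have e : 4 * (‖D.C‖ * (ε / (64 * ‖D.C‖))) = ε / 16 := by
        field_simp
        ring
      rw [h.w_sum, one_mul, e]
      have := mul_le_mul_of_nonneg_left (by linarith : (∑ l, D.w l * ρ l) + ∑ l, D.w l * χ' l ≤
        2 * (∑ l, D.w l * ρ l) + 2 * ∑ l, D.w l * χ l) (by positivity : 0 ≤ 2 * ‖D.C‖)
      linarith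
    _ = _ := by
      simp only [mul_add, Finset.sum_add_distrib]
      ring

/-- The gap test holds automatically. For the rounding test, Cauchy-Schwarz bounds γE by √Q times
the residual norm, and the residual by 2√Qβ/A; dividing by the assumed lower bound on A L_φ
eliminates γ. -/
theorem tryFinish_ne_none (h : Admissible D s ε) {S : State m N}
    (hS : Good (prepare D s ε).val S) (ha : 0 < S.a)
    (hA : target D s ε ≤ √S.A * √(smoothness (prepare D s ε).val)) :
    (tryFinish D (prepare D s ε).val ε S).val ≠ none := by
  classical
  have hr := h.regular
  have hC := h.C_pos
  have hε := h.ε_pos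
  have hN := h.N_pos
  have hlog := h.log_pos
  have hγ := hr.γ_pos
  have hy := h.one_le_ratio
  have hκ := h.one_le_distortion
  have hgap := hS.gap_nonpos hr ha
  have hincr := h.incr_le hS ha
  obtain ⟨x, hx, hxle⟩ := h.exists_isDualSolution_norm_le
  set D' := (prepare D s ε).val with hD'
  set E := ∑ l, D.w l * ((∑ i, |(∑ j, S.x l i j) - D'.p l i|) +
      ∑ j, |(∑ i, S.x l i j) - commonMarginal D' S.x j|) with hE
  have hE0 : 0 ≤ E := Finset.sum_nonneg fun l _ => mul_nonneg (h.w_pos l).le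
    (add_nonneg (Finset.sum_nonneg fun _ _ => abs_nonneg _)
      (Finset.sum_nonneg fun _ _ => abs_nonneg _))
  set β := 25 * (Real.log N * (‖D.C‖ / ε)) with hβ
  set Q := 2 * N * ∑ l, s l with hQ
  have hs0 : 0 ≤ ∑ l, s l := Finset.sum_nonneg fun l _ => (h.s_pos l).le
  have hQ0 : 0 ≤ Q := mul_nonneg (by positivity) hs0
  have hnorm : dualNorm D'.s x ≤ √Q * β := (dualNorm_le h.s_pos x).trans
    (mul_le_mul_of_nonneg_left hxle (Real.sqrt_nonneg _))
  have hres := (hS.guarantees hr ha hx hnorm).1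
  have h1 : D'.γ * E ≤ √Q * dualNorm D'.s (constraintResidual D' S.x) := by
    have h2 := sq_weighted_sum_abs_le h.s_pos (constraintResidual D' S.x)
    have h3 := hr.sum_abs_residual S.x
    change D'.γ * E = ∑ l, s l * ((∑ i, |(constraintResidual D' S.x).1 l i|) +
      ∑ j, |(constraintResidual D' S.x).2 l j|) at h3
    rw [← h3] at h2
    rw [dualNorm, ← Real.sqrt_mul hQ0]
    exact Real.le_sqrt_of_sq_le h2
  have hA0 := hS.A_nonneg
  have h4 : S.A * (D'.γ * E) ≤ 2 * Q * β := by
    have h5 := mul_le_mul_of_nonneg_left h1 hA0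
    have h6 := mul_le_mul_of_nonneg_left hres (Real.sqrt_nonneg Q)
    have h7 : √Q * (2 * (√Q * β)) = 2 * Q * β := by
      rw [show √Q * (2 * (√Q * β)) = 2 * (√Q * √Q) * β by ring, Real.mul_self_sqrt hQ0]
    linarith
  have hT : 7744 * (N * distortion D.w s * Real.log N) * (‖D.C‖ / ε) ^ 2 ≤
      S.A * (2 * D'.γ * ‖fun l => D.w l / s l‖) := by
    have hs1 : 0 ≤ smoothness D' := (hr.pos_of_le hr.le_smoothness).le
    have h8 := pow_le_pow_left₀ (zero_le_one.trans h.one_le_target) hA 2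
    rw [mul_pow, Real.sq_sqrt hA0, Real.sq_sqrt hs1, target, mul_pow, mul_pow,
      Real.sq_sqrt (by positivity)] at h8
    norm_num at h8
    exact h8
  have h9 : 7744 * (N * distortion D.w s * Real.log N) * (‖D.C‖ / ε) ^ 2 * E ≤
      200 * (N * distortion D.w s * Real.log N) * (‖D.C‖ / ε) := by
    have h10 := mul_le_mul_of_nonneg_right hT hE0
    have h11 := mul_le_mul_of_nonneg_left h4
      (mul_nonneg zero_le_two (norm_nonneg fun l => D.w l / s l))
    have h12 : 2 * ‖fun l => D.w l / s l‖ * (2 * Q * β) =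
        200 * (N * distortion D.w s * Real.log N) * (‖D.C‖ / ε) := by
      rw [hQ, hβ, distortion]
      ring
    linarith
  -- The constant 88 in the target is chosen here: 200/88² ≤ 5/192, and 4 · 5/192 + 1/16 = 1/6 meets
  -- the test exactly.
  have h13 : ‖D.C‖ / ε * E ≤ 5 / 192 := by
    have hZ : 0 < (N * distortion D.w s * Real.log N) * (‖D.C‖ / ε) := by positivity
    by_contra hneg
    push Not at hneg
    nlinarith [mul_lt_mul_of_pos_left hneg hZ]
  have h14 : ‖D.C‖ * E ≤ 5 / 192 * ε := by
    rw [div_mul_eq_mul_div, div_le_iff₀ hε] at h13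
    exact h13
  rw [tryFinish_val, if_pos ⟨by linarith, by linarith⟩]
  exact Option.some_ne_none _

/-! ### Operation counts -/

theorem prepare_ops_le (h : Admissible D s ε) : (prepare D s ε).ops ≤ 30 * (m * N * N) := by
  have hm := h.m_pos
  have hN : 1 ≤ N := by have := h.N_ge; omega
  have h1 : m * N ≤ m * N * N := Nat.le_mul_of_pos_right _ hN
  have h2 : m ≤ m * N := Nat.le_mul_of_pos_right _ hN
  simp only [prepare, ops_bind, ops_rd, ops_add, ops_sub, ops_mul, ops_div, ops_log, ops_maxAbs,
    ops_pure, ops_tab, Finset.sum_const, Finset.card_univ, Fintype.card_fin, smul_eq_mul]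
  nlinarith

end Admissible

theorem roundC_ops (p : Blocks m N) (q : Fin N → ℝ) (X : Plans m N) :
    (roundC p q X).ops = 9 * (m * N * N) + 7 * (m * N) := by
  simp [roundC, rowSumsC_ops, colSumsC_ops]
  ring

theorem tryFinish_ops_le (D : BaryData m N) (D' : RegData m N) (ε : ℝ) (S : State m N)
    (hm : 1 ≤ m) (hN : 1 ≤ N) : (tryFinish D D' ε S).ops ≤ 70 * (m * N * N) := by
  have h1 : m * N ≤ m * N * N := Nat.le_mul_of_pos_right _ hN
  have h2 : m ≤ m * N := Nat.le_mul_of_pos_right _ hN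
  have h3 : N ≤ m * N := Nat.le_mul_of_pos_left _ hm
  simp only [tryFinish, ops_bind, ops_rd, ops_add, ops_sub, ops_mul, ops_div, colSumsC_ops,
    roundC_ops, primalC_ops, dualC_ops, ops_le, ops_sum,
    ops_pure, ops_tab, Finset.sum_const, Finset.card_univ, Fintype.card_fin, smul_eq_mul]
  nlinarith

theorem solveBody_ops_le (D : BaryData m N) (D' : RegData m N) (ε : ℝ) (c : State m N × ℝ)
    (hm : 1 ≤ m) (hN : 1 ≤ N) : (solveBody D D' ε c).ops ≤ 191 * (m * N * N) := by
  have h1 := pass_ops_le D' c.1 c.2 hm hN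
  -- The 1 in 191 = 120 + 70 + 1 pays for halving the trial value after an unsuccessful stopping
  -- test.
  have h2 : 1 ≤ m * N * N := Nat.mul_pos (Nat.mul_pos hm hN) hN
  simp only [solveBody, ops_bind]
  rcases (pass D' c.1 c.2).val with M | S
  · simp only [ops_pure]
    omega
  · have h3 := tryFinish_ops_le D D' ε S hm hN
    simp only [ops_bind]
    rcases (tryFinish D D' ε S).val with _ | o
    · simp only [ops_bind, ops_div, ops_rd, ops_pure]
      omega
    · simp only [ops_pure]
      omega

theorem solveBody_inl {D : BaryData m N} {D' : RegData m N} {ε : ℝ} {c c' : State m N × ℝ}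
    (hc : (solveBody D D' ε c).val = Sum.inl c') :
    (∃ M, (pass D' c.1 c.2).val = Sum.inl M ∧ c' = (c.1, M)) ∨
    ∃ S, (pass D' c.1 c.2).val = Sum.inr S ∧ (tryFinish D D' ε S).val = none ∧
      c' = (S, S.L / 2) := by
  simp only [solveBody, val_bind] at hc
  rcases hp : (pass D' c.1 c.2).val with M | S
  · rw [hp] at hc
    exact Or.inl ⟨M, rfl, (Sum.inl.inj hc).symm⟩
  · rw [hp] at hc
    simp only [val_bind] at hc
    rcases ht : (tryFinish D D' ε S).val with _ | o
    · rw [ht] at hc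
      exact Or.inr ⟨S, rfl, ht, (Sum.inl.inj hc).symm⟩
    · rw [ht] at hc
      cases hc

theorem solveBody_inr {D : BaryData m N} {D' : RegData m N} {ε : ℝ} {c : State m N × ℝ}
    {o : (Fin N → ℝ) × Plans m N} (hc : (solveBody D D' ε c).val = Sum.inr o) :
    ∃ S, (pass D' c.1 c.2).val = Sum.inr S ∧ (tryFinish D D' ε S).val = some o := by
  simp only [solveBody, val_bind] at hc
  rcases hp : (pass D' c.1 c.2).val with M | S
  · rw [hp] at hc
    cases hc
  · rw [hp] at hc
    simp only [val_bind] at hc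
    rcases ht : (tryFinish D D' ε S).val with _ | o'
    · rw [ht] at hc
      cases hc
    · rw [ht] at hc
      exact ⟨S, rfl, ht.trans (congrArg some (Sum.inr.inj hc))⟩

/-! ### The complexity -/

/-- The amortization of halving. If M ≥ 8L, halving moves the logarithm one unit towards 2 by
itself. Otherwise √M ≤ 4√L, so the guaranteed growth of √(A L), weighted by 16, is at least 2:
enough to pay for a move of one unit away and for the pass. -/
theorem abs_logb_half_le {M L : ℝ} (hM : 0 < M) (hL : 0 < L) :
    |Real.logb 2 (M / 2 / L) - 2| + 1 ≤ |Real.logb 2 (M / L) - 2| + 16 * (1 / (2 * √M) * √L) := by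
  have h1 : Real.logb 2 (M / 2 / L) = Real.logb 2 (M / L) - 1 := by
    rw [div_right_comm, Real.logb_div (by positivity) two_ne_zero,
      Real.logb_self_eq_one one_lt_two]
  have hsM := Real.sqrt_pos.2 hM
  have hsL := Real.sqrt_pos.2 hL
  have h0 : 0 ≤ 16 * (1 / (2 * √M) * √L) := by positivity
  rw [h1]
  rcases le_or_gt 3 (Real.logb 2 (M / L)) with h | h
  · rw [abs_of_nonneg (by linarith), abs_of_nonneg (by linarith)]
    linarith
  · rw [Real.logb_lt_iff_lt_rpow one_lt_two (by positivity), div_lt_iff₀ hL] at h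
    have h2 : √M ≤ 4 * √L := by
      refine Real.sqrt_le_iff.2 ⟨by positivity, ?_⟩
      rw [mul_pow, Real.sq_sqrt hL.le]
      norm_num at h
      linarith
    have h3 : 2 ≤ 16 * (1 / (2 * √M) * √L) := by
      have e : 16 * (1 / (2 * √M) * √L) = 8 * √L / √M := by
        field_simp
        norm_num
      rw [e, le_div_iff₀ hsM]
      linarith
    have h4 := abs_sub_le (Real.logb 2 (M / L) - 1) (Real.logb 2 (M / L)) 2
    have h5 : |Real.logb 2 (M / L) - 1 - Real.logb 2 (M / L)| = 1 := by
      rw [sub_sub_cancel_left, abs_neg, abs_one]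
    linarith

theorem Admissible.solves {D : BaryData m N} {s : Fin m → ℝ} {ε : ℝ} (h : Admissible D s ε)
    {L₀ : ℝ} (hL₀ : 0 < L₀) :
    ∃ (o : (Fin N → ℝ) × Plans m N) (n : ℕ), SolvesWith D s ε L₀ o.1 o.2 n ∧
      IsApproximation D ε o ∧
      (n : ℝ) ≤ 4000 * (m * (N : ℝ) ^ 2 * target D s ε) +
        191 * (m * (N : ℝ) ^ 2 *
          |Real.logb 2 (L₀ / smoothness (prepare D s ε).val)|) := by
  have hr := h.regular
  have hm := h.m_pos
  have hN : 1 ≤ N := by have := h.N_ge; omega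
  have hT := h.one_le_target
  have hl := hr.pos_of_le hr.le_smoothness
  set D' := (prepare D s ε).val with hD'
  set ℓ := smoothness D' with hℓ
  set T := target D s ε
  have hsℓ := Real.sqrt_pos.2 hl
  let inv : State m N × ℝ → Prop := fun c =>
    Good D' c.1 ∧ 0 < c.2 ∧ √c.1.A * √ℓ < T
  -- A failed pass lowers the second term by one; a successful pass that does not stop lowers the
  -- first enough to cover both the halving and itself.
  let P : State m N × ℝ → ℝ := fun c =>
    16 * (T - √c.1.A * √ℓ) + |Real.logb 2 (c.2 / ℓ) - 2|
  have hnext : ∀ c c', inv c → (solveBody D D' ε c).val = Sum.inl c' →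
      inv c' ∧ P c' ≤ P c - 1 := by
    rintro ⟨S, M⟩ c' ⟨hS, hM, hlt⟩ hc
    rcases solveBody_inl hc with ⟨y, hy, rfl⟩ | ⟨S', hS', hnone, rfl⟩
    · obtain ⟨rfl, hM2⟩ := pass_inl hr hS hr.le_smoothness hy
      have := abs_logb_double_le hM hl hM2
      refine ⟨⟨hS, mul_pos two_pos hM, hlt⟩, ?_⟩
      simp only [P]
      linarith
    · obtain ⟨hg, ha, hL, hA⟩ := pass_inr hr hS hM hS'
      simp only at hL hA
      refine ⟨⟨hg, half_pos hg.L_pos, ?_⟩, ?_⟩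
      -- The first term stays positive because at the target value the stopping test cannot fail.
      · by_contra hge
        exact h.tryFinish_ne_none hg ha (not_lt.1 hge) hnone
      · have h1 := abs_logb_half_le hM hl
        have h2 := mul_le_mul_of_nonneg_right hA hsℓ.le
        simp only [P, hL]
        linarith
  have hinit : inv (initial m N L₀, L₀ / 2) := by
    refine ⟨Good.initial D' hL₀, half_pos hL₀, ?_⟩
    have : (initial m N L₀).A = 0 := by simp [initial, State.A]
    simp only [this, Real.sqrt_zero, zero_mul]
    linarith
  obtain ⟨o, k, hloop, hk⟩ := exists_loopsTo (body := solveBody D D' ε) inv P (191 * (m * N * N))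
    (fun c _ => solveBody_ops_le D D' ε c hm hN)
    (fun c hc => add_nonneg (by linarith [hc.2.2]) (abs_nonneg _)) hnext _ hinit
  have hpost : IsApproximation D ε o := hloop.of_invariant inv (IsApproximation D ε)
    (fun c c' hc hc' => (hnext c c' hc hc').1) (fun c o hc ho => by
      obtain ⟨S, hS, ht⟩ := solveBody_inr ho
      obtain ⟨hg, ha, -, -⟩ := pass_inr hr hc.1 hc.2.1 hS
      exact h.isApproximation hg ha ht) hinit
  refine ⟨o, _, ⟨k, hloop, rfl⟩, hpost, ?_⟩
  have hprep : ((prepare D s ε).ops : ℝ) ≤ 30 * (m * N * N) := by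
    exact_mod_cast h.prepare_ops_le
  have hX : (1 : ℝ) ≤ m * N * N := by
    exact_mod_cast Nat.mul_pos (Nat.mul_pos hm hN) hN
  have hP : P (initial m N L₀, L₀ / 2) ≤ 16 * T + |Real.logb 2 (L₀ / ℓ)| + 3 := by
    have h0 : (initial m N L₀).A = 0 := by simp [initial, State.A]
    have h1 : Real.logb 2 (L₀ / 2 / ℓ) = Real.logb 2 (L₀ / ℓ) - 1 := by
      rw [div_right_comm, Real.logb_div (by positivity) two_ne_zero,
        Real.logb_self_eq_one one_lt_two]
    simp only [P, h0, Real.sqrt_zero, zero_mul, h1, sub_zero]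
    have h2 : |Real.logb 2 (L₀ / ℓ) - 1 - 2| ≤ |Real.logb 2 (L₀ / ℓ)| + 3 := by
      rw [sub_sub]
      refine (abs_sub _ _).trans ?_
      norm_num
    linarith
  have hk2 : (k : ℝ) ≤ 191 * (m * N * N) * (16 * T + |Real.logb 2 (L₀ / ℓ)| + 4) := by
    refine hk.trans ?_
    push_cast
    exact mul_le_mul_of_nonneg_left (by linarith) (by positivity)
  -- Since the target is at least 1, constant multiples of mN² (preparation, the 4 extra passes) are
  -- absorbed: 191 · (16 + 4) + 30 + 1 ≤ 4000.
  have hXT : (m : ℝ) * N * N ≤ m * N * N * T := le_mul_of_one_le_right (by positivity) hT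
  simp only [ops_div, ops_rd]
  push_cast
  rw [sq, ← mul_assoc]
  linarith

end WBary

/-! ### Assembly of the three claims. -/

theorem mainTheorem4 :
    -- the two blocks: gradient and exact block minimization
    (∀ (m N : ℕ) (D : RegData m N),
      0 < D.γ → (∀ l, 0 < D.w l) → ∑ l, D.w l = 1 → (∀ l, 0 < D.s l) →
      (∀ l, D.p l ∈ stdSimplex ℝ (Fin N)) → (∀ l i, 0 < D.p l i) →
      ∀ x ∈ dualFeasible D.toBaryData,
        grad D x ∈ dualFeasible D.toBaryData ∧
        (∀ d ∈ dualFeasible D.toBaryData,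
          HasDerivAt (fun t : ℝ => dual D (x + t • d)) (dualInner D.s (grad D x) d) 0) ∧
        uStep D x ∈ {y ∈ dualFeasible D.toBaryData | y.2 = x.2} ∧
        IsMinOn (dual D) {y ∈ dualFeasible D.toBaryData | y.2 = x.2} (uStep D x) ∧
        vStep D x ∈ {y ∈ dualFeasible D.toBaryData | y.1 = x.1} ∧
        IsMinOn (dual D) {y ∈ dualFeasible D.toBaryData | y.1 = x.1} (vStep D x)) ∧
    -- the primal-dual guarantees
    (∀ (m N : ℕ) (D : RegData m N) (L₀ : ℝ),
      0 < D.γ → (∀ l, 0 < D.w l) → ∑ l, D.w l = 1 → (∀ l, 0 < D.s l) →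
      (∀ l, D.p l ∈ stdSimplex ℝ (Fin N)) → (∀ l i, 0 < D.p l i) → 0 < L₀ →
        (∃ xopt, IsDualSolution D xopt) ∧
        (∃ S, IsRun D L₀ S) ∧
        ∀ S, IsRun D L₀ S →
          ∀ (L R : ℝ), (∀ l, 2 * D.γ * (D.w l / D.s l) ≤ L) → L₀ ≤ 8 * L →
            (∃ xopt, IsDualSolution D xopt ∧ dualNorm D.s xopt ≤ R) →
            ∀ k : ℕ, 1 ≤ k →
              dualNorm D.s (constraintResidual D (S k).x) ≤ 32 * L * R / (k : ℝ) ^ 2 ∧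
              |dual D (S k).η + primal D (S k).x| ≤ 32 * L * R ^ 2 / (k : ℝ) ^ 2 ∧
              ∀ πopt ∈ primalFeasible D.toBaryData,
                IsMinOn (primal D) (primalFeasible D.toBaryData) πopt →
                Real.sqrt (∑ l, D.w l * (∑ i, ∑ j, |(S k).x l i j - πopt l i j|) ^ 2) ≤
                  8 * Real.sqrt (2 * L / D.γ) * R / k) ∧
    -- the complexity
    (∃ K : ℝ, 0 < K ∧
      ∀ (m N : ℕ) (D : BaryData m N) (s : Fin m → ℝ) (ε L₀ : ℝ),
        2 ≤ N → (∀ l, 0 < D.w l) → ∑ l, D.w l = 1 → (∀ l, 0 < s l) →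
        (∀ l, D.p l ∈ stdSimplex ℝ (Fin N)) → 0 < ε → ε ≤ ‖D.C‖ → 0 < L₀ →
        ∃ (q : Fin N → ℝ) (π : Plans m N) (n : ℕ),
          SolvesWith D s ε L₀ q π n ∧
          q ∈ stdSimplex ℝ (Fin N) ∧
          (∀ l, π l ∈ couplings (D.p l) q) ∧
          (∀ q' ∈ stdSimplex ℝ (Fin N),
            baryObjective D q ≤ planCost D π ∧
            planCost D π ≤ baryObjective D q' + ε) ∧
          (n : ℝ) ≤
            K * Real.sqrt (distortion D.w s) *
              (m * (N : ℝ) ^ (5 / 2 : ℝ) * Real.sqrt (Real.log N) * ‖D.C‖ / ε) +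
            K * (m * (N : ℝ) ^ 2 *
              |Real.logb 2 (L₀ / (2 * (ε / (4 * Real.log N)) * ‖fun l => D.w l / s l‖))|)) := by
  refine ⟨fun m N D hγ hw hw1 hs hp hp0 x hx => ?_, fun m N D L₀ hγ hw hw1 hs hp hp0 hL₀ => ?_,
    352000, by norm_num, fun m N D s ε L₀ hN hw hw1 hs hp hε hεC hL₀ => ?_⟩
  · have h : Regular D := ⟨hγ, hw, hw1, hs, hp, hp0⟩
    exact ⟨h.constraintResidual_mem _, fun d hd => h.hasDerivAt_dual x hd,
      ⟨Regular.uStep_mem x hx, rfl⟩, h.isMinOn_uStep hx, ⟨h.vStep_mem x hx, rfl⟩,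
      h.isMinOn_vStep hx⟩
  · have h : Regular D := ⟨hγ, hw, hw1, hs, hp, hp0⟩
    refine ⟨h.exists_isDualSolution, exists_isRun h hL₀, ?_⟩
    rintro S hS L R hL hL₀L ⟨x, hx, hR⟩ k hk
    exact primal_dual_guarantees h hL hL₀ hL₀L hS hx hR hk
  · have h : Admissible D s ε := ⟨hN, hw, hw1, hs, hp, hε, hεC⟩
    obtain ⟨o, n, hsolve, ⟨hq, hπ, happ⟩, hn⟩ := h.solves hL₀
    refine ⟨o.1, o.2, n, hsolve, hq, hπ, happ, ?_⟩
    have hlog := h.log_pos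
    have hNpos := h.N_pos
    have hκ := h.one_le_distortion
    have hpow : (N : ℝ) ^ (5 / 2 : ℝ) = (N : ℝ) ^ 2 * √N := by
      rw [Real.sqrt_eq_rpow, ← Real.rpow_natCast, ← Real.rpow_add hNpos]
      norm_num
    -- The universal constant is 352000 = 4000 · 88, and the factor √N of the target raises N² to
    -- N^(5/2).
    have e : 4000 * (m * (N : ℝ) ^ 2 * Admissible.target D s ε) =
        352000 * √(distortion D.w s) *
          (m * (N : ℝ) ^ (5 / 2 : ℝ) * √(Real.log N) * ‖D.C‖ / ε) := by
      rw [hpow, Admissible.target, Real.sqrt_mul (by positivity), Real.sqrt_mul hNpos.le]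
      ring
    rw [e] at hn
    refine hn.trans (add_le_add le_rfl ?_)
    exact mul_le_mul_of_nonneg_right (by norm_num) (by positivity)
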